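/- **Setting.** Let $d\in\{2,3\}$, let $\Omega\subset\mathbb R^d$ be a bounded open polygonal/polyhedral set with $\Omega=\operatorname{int}\overline\Omega$, and let $\mathcal T_h$ be a conforming mesh of $\Omega$ whose closed elements $T=\Phi_T(\hat T)$ are images, under invertible affine maps $\Phi_T$, of one reference element $\hat T$ (the unit simplex or the unit cube). The mesh is shape regular with constant $\sigma>0$: each $T$ contains a ball of radius $h_T/\sigma$, $h_T=\operatorname{diam}T$. Let $\mathcal E_h$ be the set of facets, $h_E=\operatorname{diam}E$, and let $\bm n$ be the outward unit normal. Let $p\ge 0$; $\mathcal P_p(\hat T)$ denotes the polynomials of total degree $\le p$ (simplex) or of degree $\le p$ in each variable (cube), $\mathcal P_p(T)=\{\hat v\circ\Phi_T^{-1}:\hat v\in\mathcal P_p(\hat T)\}$, and $\mathrm{RT}_p(\hat T)$ is the Raviart–Thomas element: $[\mathcal P_p]^d+\mathbf x\,\mathcal P_p$ on the simplex; on the cube, the fields whose $i$-th component has degree $\le p+1$ in $x_i$ and $\le p$ in each other variable. Put $$V_h^p=\{v:\ v|_T\in\mathcal P_p(T)\ \forall T\},\qquad \bm\Sigma_h^p=\{\bm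 r:\ \bm r|_T=(\det\Phi_T')^{-1}\Phi_T'\,\hat{\bm r}\circ\Phi_T^{-1},\ \hat{\bm r}\in\mathrm{RT}_p(\hat T)\ \forall T\},$$ and let $\bm\Sigma_{h,\mathrm{div}}^p$ be the set of $\bm r\in\bm\Sigma_h^p$ whose normal component is continuous across interior facets. Let $A$ be a measurable symmetric matrix field on $\Omega$ with eigenvalues in $[a_0,a_1]$ a.e., $a_0>0$; let $f\in L^2(\Omega)$, $g\in L^2(\partial\Omega)$; $(\cdot,\cdot)$ is the $L^2(\Omega)$ inner product, with differential operators taken elementwise, and $$\|v\|_{\mathrm{DG}}^2=\sum_{T}\|A^{1/2}\nabla v\|_{L^2(T)}^2+\sum_{E\in\mathcal E_h}h_E^{-1}\|[v]\|_{L^2(E)}^2,$$ where $[v]$ is the jump on interior facets and the trace on boundary facets. **Quadrature.** Let $(\hat x_i,\hat w_i)_{i=1}^{n_p}$ be a quadrature rule on $\hat T$ with nodes $\hat x_i\in\hat T$, weights $\hat w_i>0$, exact on $\mathcal P_{2p}(\hat T)$; put $x_i^T=\Phi_T(\hat x_i)$, $\omega_i^T=\frac{|T|}{|\hat T|}\hat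 w_i$ and $(v,w)_h=\sum_T\sum_i v|_T(x_i^T)\,w|_T(x_i^T)\,\omega_i^T$. Assume the *quadrature space condition*: for all $T$ and $i$ there is $\psi_i^T\in\mathcal P_p(T)$ with $\psi_i^T(x_j^T)=\delta_{ij}$ for all $j$. (It can be satisfied for $p=0$ on simplices and for every $p$ on parallelotope meshes.) **Bounds and entropy.** At each quadrature node $x$ let bounds $-\infty\le\underline u(x)<\overline u(x)\le\infty$ be given, a function $R(x,\cdot)$ that is real-valued and strictly convex on $[\underline u(x),\overline u(x)]\cap\mathbb R$ and differentiable on $(\underline u(x),\overline u(x))$, and an increasing bijection $\Upsilon(x,\cdot):\mathbb R\to(\underline u(x),\overline u(x))$ that is the inverse of $\partial_yR(x,\cdot)$. Write $\mathcal U(\psi)(x)=\Upsilon(x,\psi(x))$, $\mathcal R(v)(x)=R(x,v(x))$, $\mathcal R'(v)(x)=\partial_yR(x,v(x))$, and $$\Lambda_h=\{v\in V_h^p:\ \underline u(x_i^T)\le v|_T(x_i^T)\le\overline u(x_i^T)\ \forall i,T\},\qquad D_h(u,v)=(\mathcal R(u)-\mathcal R(v),1)_h-(\mathcal R'(v),u-v)_h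 .$$ **Iterates.** Given $\psi_h^0\in V_h^p$ and step sizes $\alpha_k>0$, let $u_h^0\in V_h^p$ satisfy $(u_h^0,w)=(\mathcal U(\psi_h^0),w)_h$ for all $w\in V_h^p$. The FOSPG iterates $(\bm q_h^k,u_h^k,\psi_h^k)\in\bm\Sigma_{h,\mathrm{div}}^p\times V_h^p\times V_h^p$, $k\ge1$, satisfy $$\begin{aligned}\alpha_k(\nabla\cdot\bm q_h^k,v)+(\psi_h^k,v)&=\alpha_k(f,v)+(\psi_h^{k-1},v)&&\forall v\in V_h^p,\\ (A^{-1}\bm q_h^k,\bm r)-(\nabla\cdot\bm r,u_h^k)&=-\langle g,\bm r\cdot\bm n\rangle_{\partial\Omega}&&\forall\bm r\in\bm\Sigma_{h,\mathrm{div}}^p,\\ (u_h^k,w)-(\mathcal U(\psi_h^k),w)_h&=0&&\forall w\in V_h^p.\end{aligned}$$ The hybridized FOSPG iterates $(\bm q_h^k,u_h^k,\hat u_h^k,\psi_h^k)\in\bm\Sigma_h^p\times V_h^p\times M_{h,g}^p\times V_h^p$, $k\ge1$, satisfy, with $\mathcal B_h(\bm q,(v,\hat v))=\sum_T\big[(\bm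 q,\nabla v)_T-(v-\hat v,\bm q\cdot\bm n)_{\partial T}\big]$, $$\begin{aligned}-\alpha_k\mathcal B_h(\bm q_h^k,(v,\hat v))+(\psi_h^k,v)&=\alpha_k(f,v)+(\psi_h^{k-1},v)&&\forall (v,\hat v)\in V_h^p\times M_{h,0}^p,\\ (A^{-1}\bm q_h^k,\bm r)+\mathcal B_h(\bm r,(u_h^k,\hat u_h^k))&=0&&\forall\bm r\in\bm\Sigma_h^p,\end{aligned}$$ and the same third equation. Here $M_{h,g}^p$ is the set of single-valued functions on $\bigcup\mathcal E_h$ whose restriction to each facet $E$ is in $\mathcal P_p(E)$ (the restriction to $E$ of $\mathcal P_p(T)$, $E\subset\partial T$) and equals the $L^2(E)$-projection of $g$ onto $\mathcal P_p(E)$ if $E\subset\partial\Omega$. **Theorem.** There is a constant $C>0$ that depends only on $d$, $p$, the type of reference element, $\sigma$, $a_0$ and $a_1$ (in particular not on the mesh size) such that the following holds in the setting above. 1. There is a unique $(\bm q_h^*,u_h^*)\in\bm\Sigma_{h,\mathrm{div}}^p\times\Lambda_h$ with $$\begin{aligned}(A^{-1}\bm q_h^*,\bm r)-(u_h^*,\nabla\cdot\bm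 r)&=-\langle g,\bm r\cdot\bm n\rangle_{\partial\Omega}&&\forall\bm r\in\bm\Sigma_{h,\mathrm{div}}^p,\\ (\nabla\cdot\bm q_h^*-f,\,v-u_h^*)&\ge0&&\forall v\in\Lambda_h.\end{aligned}$$ 2. For all positive step sizes, FOSPG iterates and all $\ell\ge1$, $$\|u_h^\ell-u_h^*\|_{\mathrm{DG}}^2+\|A^{-1/2}(\bm q_h^\ell-\bm q_h^*)\|_{L^2(\Omega)}^2\le C\,\frac{D_h(u_h^*,u_h^0)}{\sum_{k=1}^\ell\alpha_k},$$ and if $\sum_{k\ge1}\alpha_k=\infty$, then $\|u_h^\ell-u_h^*\|_{\mathrm{DG}}\to0$ and $\|A^{-1/2}(\bm q_h^\ell-\bm q_h^*)\|_{L^2(\Omega)}\to0$ as $\ell\to\infty$. 3. Part 2 also holds for the iterates of the hybridized method. -/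

import Mathlib

open MeasureTheory Filter Topology

noncomputable section

namespace FOSPG

/-- Points and vectors of `ℝ^d`, with the Euclidean norm. -/
abbrev Vec (d : ℕ) : Type := EuclideanSpace ℝ (Fin d)

/-! ### Reference elements -/

/-- The two types of reference elements: the unit simplex and the unit cube. -/
inductive ElemKind : Type
  | simplex
  | cube

/-- Labels of the facets of the reference element. Simplex: `none` is the facet `∑ xᵢ = 1` and
`some i` the facet `xᵢ = 0`. Cube: `(i, true)` is the facet `xᵢ = 1` and `(i, false)` the
facet `xᵢ = 0`. -/
def RefFacet (K : ElemKind) (d : ℕ) : Type :=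
  match K with
  | .simplex => Option (Fin d)
  | .cube => Fin d × Bool

instance (K : ElemKind) (d : ℕ) : Fintype (RefFacet K d) :=
  match K with
  | .simplex => inferInstanceAs (Fintype (Option (Fin d)))
  | .cube => inferInstanceAs (Fintype (Fin d × Bool))

/-- An outward normal vector (not normalized) of a facet of the reference element. -/
def refNormal {d : ℕ} : (K : ElemKind) → RefFacet K d → Vec d
  | .simplex, none => WithLp.toLp 2 (fun _ => 1)
  | .simplex, some i => -EuclideanSpace.single i 1
  | .cube, (i, true) => EuclideanSpace.single i 1
  | .cube, (i, false) => -EuclideanSpace.single i 1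

/-- The offset of the hyperplane spanned by a facet of the reference element. -/
def refOffset {d : ℕ} : (K : ElemKind) → RefFacet K d → ℝ
  | .simplex, none => 1
  | .simplex, some _ => 0
  | .cube, (_, true) => 1
  | .cube, (_, false) => 0

/-- The closed reference element as an intersection of half-spaces:
`{x | 0 ≤ xᵢ, ∑ xᵢ ≤ 1}` or `[0,1]^d`. -/
def refElem (K : ElemKind) (d : ℕ) : Set (Vec d) :=
  {x | ∀ F : RefFacet K d, inner ℝ (refNormal K F) x ≤ refOffset K F}

/-- The face of the reference element on which all the facets in `G` meet. -/
def refFace (K : ElemKind) {d : ℕ} (G : Set (RefFacet K d)) : Set (Vec d) :=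
  {x ∈ refElem K d | ∀ F ∈ G, inner ℝ (refNormal K F) x = refOffset K F}

/-! ### Polynomial spaces on the reference element -/

/-- A polynomial as a function on `ℝ^d`. -/
def evalLin (d : ℕ) : MvPolynomial (Fin d) ℝ →ₗ[ℝ] (Vec d → ℝ) where
  toFun P := fun x => MvPolynomial.eval (fun i => x i) P
  map_add' P Q := by ext x; simp
  map_smul' c P := by ext x; simp

/-- `𝒫_p`: total degree at most `p` on the simplex (`ℙ_p`), degree at most `p` in each
variable on the cube (`ℚ_p`). -/
def polySpace (K : ElemKind) (d p : ℕ) : Submodule ℝ (Vec d → ℝ) :=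
  match K with
  | .simplex => (MvPolynomial.restrictTotalDegree (Fin d) ℝ p).map (evalLin d)
  | .cube => (MvPolynomial.restrictDegree (Fin d) ℝ p).map (evalLin d)

/-- The Raviart--Thomas element of degree `p` on the reference element. On the simplex,
`[ℙ_p]^d + x ℙ_p`; on the cube, the fields whose `i`-th component lies in `ℚ_p + xᵢ ℚ_p`,
i.e. has degree at most `p + 1` in `xᵢ` and at most `p` in each other variable. -/
def refRT (K : ElemKind) (d p : ℕ) : Set (Vec d → Vec d) :=
  match K with
  | .simplex =>
    {r | ∃ a : Fin d → Vec d → ℝ, ∃ b : Vec d → ℝ,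
      (∀ i, a i ∈ polySpace .simplex d p) ∧ b ∈ polySpace .simplex d p ∧
      ∀ x i, r x i = a i x + x i * b x}
  | .cube =>
    {r | ∃ a b : Fin d → Vec d → ℝ,
      (∀ i, a i ∈ polySpace .cube d p) ∧ (∀ i, b i ∈ polySpace .cube d p) ∧
      ∀ x i, r x i = a i x + x i * b i x}

/-! ### Meshes -/

/-- A conforming partition of `Ω` into finitely many affine images of one reference element:
the closed elements cover the closure of `Ω`, their interiors are disjoint, and two distinct
elements that meet do so in a common face. -/
structure Mesh (K : ElemKind) (d : ℕ) (Ω : Set (Vec d)) where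
  numElem : ℕ
  Φ : Fin numElem → (Vec d ≃ᵃ[ℝ] Vec d)
  cover : ⋃ T, Φ T '' refElem K d = closure Ω
  disjoint : ∀ T T', T ≠ T' →
    Disjoint (interior (Φ T '' refElem K d)) (interior (Φ T' '' refElem K d))
  conforming : ∀ T T', T ≠ T' → (Φ T '' refElem K d ∩ Φ T' '' refElem K d).Nonempty →
    ∃ G G' : Set (RefFacet K d),
      Φ T '' refElem K d ∩ Φ T' '' refElem K d = Φ T '' refFace K G ∧
      Φ T '' refElem K d ∩ Φ T' '' refElem K d = Φ T' '' refFace K G'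

/-- Divergence of a vector field. -/
def divergence {d : ℕ} (r : Vec d → Vec d) (x : Vec d) : ℝ :=
  ∑ i, (fderiv ℝ r x (EuclideanSpace.single i 1)) i

/-- `v · B w`. -/
def bil {d : ℕ} (B : Matrix (Fin d) (Fin d) ℝ) (v w : Vec d) : ℝ :=
  WithLp.ofLp v ⬝ᵥ B.mulVec (WithLp.ofLp w)

namespace Mesh

variable {K : ElemKind} {d : ℕ} {Ω : Set (Vec d)} (M : Mesh K d Ω)

/-- Indices of the elements. -/
abbrev Elem : Type := Fin M.numElem

/-- A side: a facet of an element, seen from that element. -/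
abbrev Side : Type := M.Elem × RefFacet K d

/-- Piecewise defined scalar functions: one function for each element `T`, of which only the
values on `T` matter. The discrete ones are polynomials on each element. -/
abbrev ScalarFn : Type := M.Elem → Vec d → ℝ

/-- Piecewise defined vector fields. -/
abbrev VectorFn : Type := M.Elem → Vec d → Vec d

/-- Functions on the sides. -/
abbrev SideFn : Type := M.Side → Vec d → ℝ

/-- The closed element `T`. -/
def elem (T : M.Elem) : Set (Vec d) := M.Φ T '' refElem K d

/-- The facet underlying a side. -/
def facet (s : M.Side) : Set (Vec d) := M.Φ s.1 '' refFace K {s.2}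

/-- Two sides of different elements that form the same (interior) facet. -/
def Adj (s t : M.Side) : Prop := s.1 ≠ t.1 ∧ M.facet s = M.facet t

/-- A boundary facet: a facet of one element only. The union of these is the boundary of `Ω`. -/
def IsBdry (s : M.Side) : Prop := ∀ t, ¬ M.Adj s t

/-- Shape regularity: each element of diameter `h_T` contains a ball of radius `h_T / σ`. -/
def ShapeRegular (σ : ℝ) : Prop :=
  0 < σ ∧ ∀ T, ∃ c, Metric.closedBall c (Metric.diam (M.elem T) / σ) ⊆ M.elem T

/-- The outward unit normal on a side, with the inverse transpose of the linear part of the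
affine map applied to the reference normal. -/
def normal (s : M.Side) : Vec d :=
  let m := LinearMap.adjoint ((M.Φ s.1).linear.symm : Vec d →ₗ[ℝ] Vec d) (refNormal K s.2)
  ‖m‖⁻¹ • m

/-- The surface measure on a side. -/
def surf (s : M.Side) : Measure (Vec d) := (μHE[d - 1]).restrict (M.facet s)

/-! ### Finite element spaces -/

/-- `𝒫_p(T)`: the functions `φ ∘ Φ_T⁻¹` with `φ ∈ 𝒫_p` on the reference element. -/
def localPoly (p : ℕ) (T : M.Elem) : Submodule ℝ (Vec d → ℝ) :=
  (polySpace K d p).map (LinearMap.funLeft ℝ ℝ (M.Φ T).symm)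

/-- `V_h^p`. -/
def V (p : ℕ) : Submodule ℝ M.ScalarFn := Submodule.pi Set.univ (M.localPoly p)

/-- The broken Raviart--Thomas space `Σ_h^p`, through the Piola transform. -/
def Sig (p : ℕ) : Set M.VectorFn :=
  {r | ∀ T, ∃ r' ∈ refRT K d p, ∀ x,
    r T x = (LinearMap.det ((M.Φ T).linear : Vec d →ₗ[ℝ] Vec d))⁻¹ •
      (M.Φ T).linear (r' ((M.Φ T).symm x))}

/-- `Σ_{h,div}^p`: the fields in `Σ_h^p` with continuous normal components. -/
def SigDiv (p : ℕ) : Set M.VectorFn :=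
  {r ∈ M.Sig p | ∀ s t, M.Adj s t → ∀ x ∈ M.facet s,
    inner ℝ (r s.1 x - r t.1 x) (M.normal s) = 0}

/-- `M_{h,g}^p`: single-valued functions on the facets, on each facet `E` in `𝒫_p(E)` (the
restriction to `E` of `𝒫_p(T)` for an element `T` with facet `E`), and equal on each boundary
facet to the `L²` projection of `g` onto `𝒫_p(E)`. -/
def FacetSpace (p : ℕ) (g : Vec d → ℝ) : Set M.SideFn :=
  {μ | (∀ s, ∃ φ ∈ M.localPoly p s.1, ∀ x ∈ M.facet s, μ s x = φ x) ∧
    (∀ s t, M.Adj s t → ∀ x ∈ M.facet s, μ s x = μ t x) ∧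
    ∀ s, M.IsBdry s → ∀ φ ∈ M.localPoly p s.1,
      ∫ x, μ s x * φ x ∂(M.surf s) = ∫ x, g x * φ x ∂(M.surf s)}

/-! ### Forms and norms -/

/-- A function on `Ω` as a piecewise defined function. -/
def glob (f : Vec d → ℝ) : M.ScalarFn := fun _ => f

/-- The `L²(Ω)` inner product `(v, w)`. -/
def l2 (v w : M.ScalarFn) : ℝ := ∑ T, ∫ x in M.elem T, v T x * w T x

/-- `(A⁻¹ q, r)`. -/
def invForm (A : Vec d → Matrix (Fin d) (Fin d) ℝ) (q r : M.VectorFn) : ℝ :=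
  ∑ T, ∫ x in M.elem T, bil (A x)⁻¹ (r T x) (q T x)

/-- The piecewise divergence. -/
def dvg (r : M.VectorFn) : M.ScalarFn := fun T => divergence (r T)

open scoped Classical in
/-- `⟨g, r · n⟩` on the boundary of `Ω`. -/
def bdryForm (g : Vec d → ℝ) (r : M.VectorFn) : ℝ :=
  ∑ s : M.Side, if M.IsBdry s then
    ∫ x, g x * inner ℝ (r s.1 x) (M.normal s) ∂(M.surf s) else 0

/-- `‖A^{-1/2} q‖²` in `L²(Ω)`. -/
def fluxNormSq (A : Vec d → Matrix (Fin d) (Fin d) ℝ) (q : M.VectorFn) : ℝ := M.invForm A q q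

open scoped Classical in
/-- The squared DG norm. The integrand of the volume term is `|A^{1/2} ∇v|² = ∇v · A ∇v`. The sum
over the pairs of adjacent sides runs through each interior facet twice, hence the factor
`1/2`; the last sum is over the boundary facets. -/
def dgNormSq (A : Vec d → Matrix (Fin d) (Fin d) ℝ) (v : M.ScalarFn) : ℝ :=
  (∑ T, ∫ x in M.elem T, bil (A x) (gradient (v T) x) (gradient (v T) x)) +
  (1 / 2) * (∑ s : M.Side, ∑ t : M.Side, if M.Adj s t then
    (Metric.diam (M.facet s))⁻¹ * ∫ x, (v s.1 x - v t.1 x) ^ 2 ∂(M.surf s) else 0) +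
  ∑ s : M.Side, if M.IsBdry s then
    (Metric.diam (M.facet s))⁻¹ * ∫ x, (v s.1 x) ^ 2 ∂(M.surf s) else 0

/-- The form `ℬ_h(q, (v, μ)) = (q, ∇_h v) - (v - μ, q · n)_{∂𝒯_h}` of the hybridized method. -/
def hybForm (q : M.VectorFn) (v : M.ScalarFn) (μ : M.SideFn) : ℝ :=
  (∑ T, ∫ x in M.elem T, inner ℝ (q T x) (gradient (v T) x)) -
  ∑ s : M.Side, ∫ x, (v s.1 x - μ s x) * inner ℝ (q s.1 x) (M.normal s) ∂(M.surf s)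

end Mesh

/-! ### Quadrature -/

/-- A quadrature rule on the reference element with nodes in it and positive weights, exact
on `𝒫_{2p}`. -/
structure QuadRule (K : ElemKind) (d p : ℕ) where
  n : ℕ
  node : Fin n → Vec d
  weight : Fin n → ℝ
  node_mem : ∀ i, node i ∈ refElem K d
  weight_pos : ∀ i, 0 < weight i
  exact_poly : ∀ φ ∈ polySpace K d (2 * p),
    ∫ x in refElem K d, φ x = ∑ i, weight i * φ (node i)

section Discrete

variable {K : ElemKind} {d p : ℕ} {Ω : Set (Vec d)} (M : Mesh K d Ω) (Q : QuadRule K d p)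

/-- The quadrature node `x_i^T`. -/
def qnode (T : M.Elem) (i : Fin Q.n) : Vec d := M.Φ T (Q.node i)

/-- The quadrature weight `(|T| / |T̂|) ŵ_i`. -/
def qweight (T : M.Elem) (i : Fin Q.n) : ℝ :=
  volume.real (M.elem T) / volume.real (refElem K d) * Q.weight i

/-- The discrete inner product `(v, w)_h`. -/
def qInner (v w : M.ScalarFn) : ℝ :=
  ∑ T, ∑ i, v T (qnode M Q T i) * w T (qnode M Q T i) * qweight M Q T i

/-- The condition for a quadrature rule space discretization: on each element, `𝒫_p(T)`
contains the nodal functions of the quadrature nodes. -/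
def IsQuadSpace : Prop :=
  ∀ T i, ∃ φ ∈ M.localPoly p T, ∀ j, φ (qnode M Q T j) = if i = j then 1 else 0

/-! ### Entropies and the Bregman distance -/

/-- The pointwise assumptions on the entropy `R` and the generating function `Υ`, for the bounds
`lo` and `hi`: `R` is strictly convex on `[lo, hi] ∩ ℝ` (its values elsewhere play no role) and
differentiable on `(lo, hi)`, and `Υ` is an increasing bijection of `ℝ` onto `(lo, hi)`,
inverse to the derivative of `R`. -/
structure IsEntropyPair (lo hi : EReal) (Υ R : ℝ → ℝ) : Prop where
  strictMono : StrictMono Υ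
  range_eq : Set.range Υ = {y : ℝ | lo < (y : EReal) ∧ (y : EReal) < hi}
  strictConvex : StrictConvexOn ℝ {y : ℝ | lo ≤ (y : EReal) ∧ (y : EReal) ≤ hi} R
  hasDerivAt : ∀ z, HasDerivAt R z (Υ z)

/-- The superposition operator `v ↦ (x ↦ N(x, v(x)))`. -/
def superpose (N : Vec d → ℝ → ℝ) (v : M.ScalarFn) : M.ScalarFn := fun T x => N x (v T x)

/-- The discrete Bregman distance
`D_h(u, v) = (ℛ(u) - ℛ(v), 1)_h - (ℛ'(v), u - v)_h`. -/
def bregman (R : Vec d → ℝ → ℝ) (u v : M.ScalarFn) : ℝ :=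
  qInner M Q (superpose M R u - superpose M R v) (M.glob fun _ => 1) -
  qInner M Q (superpose M (fun x => deriv (R x)) v) (u - v)

/-- The set `Λ_h`. -/
def feasible (lo hi : Vec d → EReal) : Set M.ScalarFn :=
  {v | v ∈ M.V p ∧ ∀ T i, lo (qnode M Q T i) ≤ (v T (qnode M Q T i) : EReal) ∧
    (v T (qnode M Q T i) : EReal) ≤ hi (qnode M Q T i)}

/-! ### The discrete mixed variational inequality and the two algorithms -/

variable (A : Vec d → Matrix (Fin d) (Fin d) ℝ) (f g : Vec d → ℝ)

/-- `(q, u)` solves the discrete mixed variational inequality. -/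
structure IsVISolution (lo hi : Vec d → EReal) (q : M.VectorFn) (u : M.ScalarFn) : Prop where
  flux_mem : q ∈ M.SigDiv p
  mem : u ∈ feasible M Q lo hi
  flux_eq : ∀ r ∈ M.SigDiv p, M.invForm A q r - M.l2 u (M.dvg r) = -M.bdryForm g r
  ineq : ∀ v ∈ feasible M Q lo hi, 0 ≤ M.l2 (M.dvg q - M.glob f) (v - u)

/-- One step of the first-order system proximal Galerkin method, from the latent variable `ψ₀`
to `(q, u, ψ)`, with step size `α`. -/
structure IsMixedStep (Υ : Vec d → ℝ → ℝ) (α : ℝ) (ψ₀ : M.ScalarFn)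
    (q : M.VectorFn) (u ψ : M.ScalarFn) : Prop where
  flux_mem : q ∈ M.SigDiv p
  mem : u ∈ M.V p
  latent_mem : ψ ∈ M.V p
  balance : ∀ v ∈ M.V p,
    α * M.l2 (M.dvg q) v + M.l2 ψ v = α * M.l2 (M.glob f) v + M.l2 ψ₀ v
  flux_eq : ∀ r ∈ M.SigDiv p, M.invForm A q r - M.l2 (M.dvg r) u = -M.bdryForm g r
  latent_eq : ∀ w ∈ M.V p, M.l2 u w - qInner M Q (superpose M Υ ψ) w = 0

/-- One step of the hybridized method; `μ` is the facet unknown. -/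
structure IsHybridStep (Υ : Vec d → ℝ → ℝ) (α : ℝ) (ψ₀ : M.ScalarFn)
    (q : M.VectorFn) (u : M.ScalarFn) (μ : M.SideFn) (ψ : M.ScalarFn) : Prop where
  flux_mem : q ∈ M.Sig p
  mem : u ∈ M.V p
  facet_mem : μ ∈ M.FacetSpace p g
  latent_mem : ψ ∈ M.V p
  balance : ∀ v ∈ M.V p, ∀ η ∈ M.FacetSpace p 0,
    -α * M.hybForm q v η + M.l2 ψ v = α * M.l2 (M.glob f) v + M.l2 ψ₀ v
  flux_eq : ∀ r ∈ M.Sig p, M.invForm A q r + M.hybForm r u μ = 0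
  latent_eq : ∀ w ∈ M.V p, M.l2 u w - qInner M Q (superpose M Υ ψ) w = 0

/-- `u⁰ ∈ V_h^p` belongs to the initial latent guess `ψ⁰ ∈ V_h^p`. -/
structure IsInitial (Υ : Vec d → ℝ → ℝ) (u₀ ψ₀ : M.ScalarFn) : Prop where
  latent_mem : ψ₀ ∈ M.V p
  mem : u₀ ∈ M.V p
  latent_eq : ∀ w ∈ M.V p, M.l2 u₀ w = qInner M Q (superpose M Υ ψ₀) w

/-- The sequences `(q^k, u^k, ψ^k)`, `k ≥ 1`, are generated by the first-order system proximal
Galerkin method with step sizes `α^k`; `q 0` plays no role. -/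
structure IsMixedRun (Υ : Vec d → ℝ → ℝ) (α : ℕ → ℝ)
    (q : ℕ → M.VectorFn) (u ψ : ℕ → M.ScalarFn) : Prop where
  init : IsInitial M Q Υ (u 0) (ψ 0)
  step : ∀ k, IsMixedStep M Q A f g Υ (α (k + 1)) (ψ k) (q (k + 1)) (u (k + 1)) (ψ (k + 1))

/-- The sequences `(q^k, u^k, μ^k, ψ^k)`, `k ≥ 1`, are generated by the hybridized method;
`q 0` and `μ 0` play no role. -/
structure IsHybridRun (Υ : Vec d → ℝ → ℝ) (α : ℕ → ℝ)
    (q : ℕ → M.VectorFn) (u : ℕ → M.ScalarFn) (μ : ℕ → M.SideFn) (ψ : ℕ → M.ScalarFn) :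
    Prop where
  init : IsInitial M Q Υ (u 0) (ψ 0)
  step : ∀ k, IsHybridStep M Q A f g Υ (α (k + 1)) (ψ k)
    (q (k + 1)) (u (k + 1)) (μ (k + 1)) (ψ (k + 1))

/-- The squared error `‖u - u*‖²_DG + ‖A^{-1/2} (q - q*)‖²`. -/
def errSq (q : M.VectorFn) (u : M.ScalarFn) (qs : M.VectorFn) (us : M.ScalarFn) : ℝ :=
  M.dgNormSq A (u - us) + M.fluxNormSq A (q - qs)

/-- The iterates `(q^ℓ, u^ℓ)` satisfy the rate with constant `C`, and they converge to `(q*, u*)`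
if the step sizes have a divergent sum. -/
def ConvergesTo (C : ℝ) (R : Vec d → ℝ → ℝ) (α : ℕ → ℝ)
    (q : ℕ → M.VectorFn) (u : ℕ → M.ScalarFn) (qs : M.VectorFn) (us : M.ScalarFn) : Prop :=
  (∀ ℓ, 1 ≤ ℓ → errSq M A (q ℓ) (u ℓ) qs us ≤
    C * (bregman M Q R us (u 0) / ∑ k ∈ Finset.Icc 1 ℓ, α k)) ∧
  (Tendsto (fun ℓ => ∑ k ∈ Finset.Icc 1 ℓ, α k) atTop atTop →
    Tendsto (fun ℓ => M.dgNormSq A (u ℓ - us)) atTop (𝓝 0) ∧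
    Tendsto (fun ℓ => M.fluxNormSq A (q ℓ - qs)) atTop (𝓝 0))

end Discrete

/-- `A` is a measurable symmetric diffusion tensor on `Ω` with eigenvalues in `[a₀, a₁]`. -/
structure IsDiffusion {d : ℕ} (Ω : Set (Vec d)) (a₀ a₁ : ℝ)
    (A : Vec d → Matrix (Fin d) (Fin d) ℝ) : Prop where
  measurable : ∀ i j, AEMeasurable (fun x => A x i j) (volume.restrict Ω)
  symm : ∀ᵐ x ∂(volume.restrict Ω), (A x).IsSymm
  bounds : ∀ᵐ x ∂(volume.restrict Ω), ∀ ξ : Vec d,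
    a₀ * ‖ξ‖ ^ 2 ≤ bil (A x) ξ ξ ∧ bil (A x) ξ ξ ≤ a₁ * ‖ξ‖ ^ 2

end FOSPG

end

open FOSPG

noncomputable section

namespace FOSPG

/-! ### Geometry of the reference element -/

/-! The discrete problem is a strictly convex minimization in disguise. The flux equation determines
`q` as an affine function of `u`, and `∇·q - f` is then the gradient at `u` of the energy `J(u) =
(A⁻¹q, q)/2 - (f, u)`. The variational inequality says that `u*` minimizes `J` over a box of nodal
values, and one step of the method is a Bregman proximal step for `J`. Existence is a projection in
the inner product given by the Hessian of `J` (`exists_mixed_VI`). That Hessian is definite because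
only `v = 0` is orthogonal to all discrete divergences (`divForm_injective`).

Rate: the quadrature is exact on products of discrete functions and admits nodal functions, so the
third equation says `u^k = Υ(ψ^k)` at every node (`nodal_eq`), that is, `ψ^k = R'(u^k)` there. The
first equation becomes `α_k (∇·q^k - f, v) = (ψ^{k-1} - ψ^k, v)_h`. With `v = u^k - u*`, the
three-point inequality gives `α_k (J(u^k) - J(u*)) ≤ D^{k-1} - D^k`; with `v = u^{k-1} - u^k`, the
monotonicity of `Υ` shows that `J` decreases along the iterates. Summation bounds `J(u^ℓ) - J(u*)`
by `D^0 / ∑ α_k`. This gap equals `‖A^{-1/2}(q^ℓ - q*)‖²/2 + (∇·q* - f, u^ℓ - u*)`, whose second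
term is nonnegative because `u^ℓ` is feasible. This is the flux estimate
(`IsMixedRun.fluxNormSq_le`).

The potential error `w = u^ℓ - u*` satisfies `(∇·r, w) = (A⁻¹(q^ℓ - q*), r)`, so an inf-sup bound in
the DG norm finishes the argument (`exists_stability`). Two families of test fields prove it. Bubble
fields, made from the gradient of `w` with a weight that annihilates normal components, control the
gradient. Lifts of the jumps, with normal component `h_E⁻¹ [w]`, control the jumps. On the reference
element the required bounds hold because forms on finite-dimensional spaces are comparable modulo
kernels; shape regularity bounds the condition numbers of the affine maps, so the Piola transform
carries the bounds to all meshes with one constant.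

The geometric input is integration by parts on each element, together with facts on common facets:
at most two elements share a facet, their normals there are opposite, and both induce the same
polynomial traces. For cubes the last fact holds because an affine map between facets of the cube
acts as a signed permutation.

In a hybridized step, testing with the normal jump of `q` itself forces `q` into `Σ_{h,div}^p`, so
the step is a mixed step (`IsHybridStep.isMixedStep`). -/

theorem inner_refNormal_simplex_none {d : ℕ} (x : Vec d) :
    inner ℝ (refNormal .simplex (none : Option (Fin d))) x = ∑ i, x i := by
  simp [refNormal, PiLp.inner_apply]

theorem inner_refNormal_simplex_some {d : ℕ} (i : Fin d) (x : Vec d) :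
    inner ℝ (refNormal .simplex (some i)) x = - x i := by
  simp [refNormal, EuclideanSpace.inner_single_left]

theorem inner_refNormal_cube_true {d : ℕ} (i : Fin d) (x : Vec d) :
    inner ℝ (refNormal .cube (i, true)) x = x i := by
  simp [refNormal, EuclideanSpace.inner_single_left]

theorem inner_refNormal_cube_false {d : ℕ} (i : Fin d) (x : Vec d) :
    inner ℝ (refNormal .cube (i, false)) x = - x i := by
  simp [refNormal, EuclideanSpace.inner_single_left]

theorem forall_refFacet_simplex {d : ℕ} {P : RefFacet .simplex d → Prop} :
    (∀ F, P F) ↔ P (none : Option (Fin d)) ∧ ∀ i : Fin d, P (some i) :=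
  Option.forall (α := Fin d) (p := P)

theorem forall_refFacet_cube {d : ℕ} {P : RefFacet .cube d → Prop} :
    (∀ F, P F) ↔ ∀ i : Fin d, P (i, true) ∧ P (i, false) := by
  constructor
  · intro h i
    exact ⟨h _, h _⟩
  · rintro h ⟨i, _ | _⟩
    exacts [(h i).2, (h i).1]

theorem mem_refElem_simplex {d : ℕ} {x : Vec d} :
    x ∈ refElem .simplex d ↔ ∑ i, x i ≤ 1 ∧ ∀ i, 0 ≤ x i := by
  simp only [refElem, Set.mem_ofPred_eq]
  rw [forall_refFacet_simplex]
  simp only [inner_refNormal_simplex_none, inner_refNormal_simplex_some, refOffset]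
  simp

theorem mem_refElem_cube {d : ℕ} {x : Vec d} :
    x ∈ refElem .cube d ↔ ∀ i, x i ≤ 1 ∧ 0 ≤ x i := by
  simp only [refElem, Set.mem_ofPred_eq]
  rw [forall_refFacet_cube]
  simp only [inner_refNormal_cube_true, inner_refNormal_cube_false, refOffset]
  simp

theorem refElem_mem_Icc {K : ElemKind} {d : ℕ} {x : Vec d} (hx : x ∈ refElem K d) (i : Fin d) :
    0 ≤ x i ∧ x i ≤ 1 := by
  cases K
  · rw [mem_refElem_simplex] at hx
    exact ⟨hx.2 i, (Finset.single_le_sum (fun j _ => hx.2 j) (Finset.mem_univ i)).trans hx.1⟩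
  · rw [mem_refElem_cube] at hx
    exact ⟨(hx i).2, (hx i).1⟩

theorem isClosed_refElem (K : ElemKind) (d : ℕ) : IsClosed (refElem K d) := by
  simp only [refElem, Set.ofPred_forall]
  refine isClosed_iInter fun F => isClosed_le ?_ ?_ <;> fun_prop

theorem isCompact_refElem (K : ElemKind) (d : ℕ) : IsCompact (refElem K d) := by
  refine Metric.isCompact_of_isClosed_isBounded (isClosed_refElem K d) ?_
  refine (Metric.isBounded_closedBall (x := (0 : Vec d)) (r := √d)).subset fun x hx => ?_
  rw [mem_closedBall_zero_iff, EuclideanSpace.norm_eq]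
  refine Real.sqrt_le_sqrt ?_
  calc ∑ i, ‖x i‖ ^ 2 ≤ ∑ _i : Fin d, (1 : ℝ) := by
        refine Finset.sum_le_sum fun i _ => ?_
        have := refElem_mem_Icc hx i
        rw [Real.norm_eq_abs, sq_abs]
        nlinarith
    _ = d := by simp

theorem convex_refElem (K : ElemKind) (d : ℕ) : Convex ℝ (refElem K d) := by
  simp only [refElem, Set.ofPred_forall]
  refine convex_iInter fun F => ?_
  exact convex_halfSpace_le (f := fun x => inner ℝ (refNormal K F) x)
    ⟨fun x y => inner_add_right _ _ _, fun c x => inner_smul_right _ _ _⟩ _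

theorem exists_strict_refElem (K : ElemKind) (d : ℕ) :
    ∃ c : Vec d, ∀ F : RefFacet K d, inner ℝ (refNormal K F) c < refOffset K F := by
  have h2 : (0 : ℝ) < d + 2 := by positivity
  refine ⟨WithLp.toLp 2 (fun _ => 1 / (d + 2 : ℝ)), ?_⟩
  cases K
  · rw [forall_refFacet_simplex]
    simp only [inner_refNormal_simplex_none, inner_refNormal_simplex_some, refOffset]
    refine ⟨?_, fun i => ?_⟩
    · simp only [Finset.sum_const, Finset.card_univ, Fintype.card_fin, nsmul_eq_mul]
      rw [mul_one_div, div_lt_one h2]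
      linarith
    · simpa using h2
  · rw [forall_refFacet_cube]
    simp only [inner_refNormal_cube_true, inner_refNormal_cube_false, refOffset]
    intro i
    refine ⟨?_, by simpa using h2⟩
    rw [div_lt_one h2]
    have : (0 : ℝ) ≤ d := by positivity
    linarith

theorem isOpen_strict (K : ElemKind) (d : ℕ) :
    IsOpen {x : Vec d | ∀ F : RefFacet K d, inner ℝ (refNormal K F) x < refOffset K F} := by
  simp only [Set.ofPred_forall]
  exact isOpen_iInter_of_finite fun F => isOpen_lt (by fun_prop) (by fun_prop)

theorem strict_subset_interior (K : ElemKind) (d : ℕ) :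
    {x : Vec d | ∀ F : RefFacet K d, inner ℝ (refNormal K F) x < refOffset K F} ⊆
      interior (refElem K d) :=
  interior_maximal (fun _ hx F => (hx F).le) (isOpen_strict K d)

theorem interior_refElem_nonempty (K : ElemKind) (d : ℕ) : (interior (refElem K d)).Nonempty := by
  obtain ⟨c, hc⟩ := exists_strict_refElem K d
  exact ⟨c, strict_subset_interior K d hc⟩

theorem closure_interior_refElem (K : ElemKind) (d : ℕ) :
    closure (interior (refElem K d)) = refElem K d := by
  rw [(convex_refElem K d).closure_interior_eq_closure_of_nonempty_interior
    (interior_refElem_nonempty K d), (isClosed_refElem K d).closure_eq]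

/-! ### Slicing the reference element along a coordinate -/

/-- Insertion of a coordinate `t` at the place `i`. -/
def ins {m : ℕ} (i : Fin (m + 1)) (t : ℝ) (y : Vec m) : Vec (m + 1) :=
  WithLp.toLp 2 (Fin.insertNth (α := fun _ => ℝ) i t (WithLp.ofLp y))

@[simp] theorem ins_same {m : ℕ} (i : Fin (m + 1)) (t : ℝ) (y : Vec m) : ins i t y i = t := by
  simp [ins]

@[simp] theorem ins_succAbove {m : ℕ} (i : Fin (m + 1)) (t : ℝ) (y : Vec m) (j : Fin m) :
    ins i t y (i.succAbove j) = y j := by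
  simp [ins]

theorem sum_ins {m : ℕ} (i : Fin (m + 1)) (t : ℝ) (y : Vec m) :
    ∑ j, ins i t y j = t + ∑ j, y j := by
  rw [Fin.sum_univ_succAbove _ i]
  simp

/-- The coordinates other than the `i`-th. -/
def del {m : ℕ} (i : Fin (m + 1)) (x : Vec (m + 1)) : Vec m :=
  WithLp.toLp 2 (fun j => x (i.succAbove j))

@[simp] theorem del_apply {m : ℕ} (i : Fin (m + 1)) (x : Vec (m + 1)) (j : Fin m) :
    del i x j = x (i.succAbove j) := rfl

theorem vec_ext_succAbove {m : ℕ} (i : Fin (m + 1)) {x y : Vec (m + 1)} (h : x i = y i)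
    (h' : ∀ j, x (i.succAbove j) = y (i.succAbove j)) : x = y := by
  ext j
  obtain rfl | ⟨k, rfl⟩ := Fin.eq_self_or_eq_succAbove i j
  exacts [h, h' _]

@[simp] theorem del_ins {m : ℕ} (i : Fin (m + 1)) (t : ℝ) (y : Vec m) : del i (ins i t y) = y := by
  ext j; simp

theorem ins_del {m : ℕ} (i : Fin (m + 1)) (x : Vec (m + 1)) : ins i (x i) (del i x) = x :=
  vec_ext_succAbove i (by simp) (by simp)

/-- The height of the reference element above a point of its lower facet. -/
def height {m : ℕ} : ElemKind → Vec m → ℝ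
  | .simplex, y => 1 - ∑ j, y j
  | .cube, _ => 1

theorem continuous_height {m : ℕ} (K : ElemKind) : Continuous (height (m := m) K) := by
  cases K
  · change Continuous fun y : Vec m => 1 - ∑ j, y j
    fun_prop
  · exact continuous_const

theorem continuous_ins {m : ℕ} (i : Fin (m + 1)) :
    Continuous (fun q : ℝ × Vec m => ins i q.1 q.2) := by
  refine (PiLp.continuous_toLp 2 _).comp (continuous_pi fun j => ?_)
  obtain rfl | ⟨k, rfl⟩ := Fin.eq_self_or_eq_succAbove i j
  · simpa using continuous_fst
  · simp only [Fin.insertNth_apply_succAbove]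
    fun_prop

@[fun_prop]
theorem Continuous.ins {X : Type*} [TopologicalSpace X] {m : ℕ} (i : Fin (m + 1))
    {t : X → ℝ} {y : X → Vec m} (ht : Continuous t) (hy : Continuous y) :
    Continuous (fun x => FOSPG.ins i (t x) (y x)) :=
  (continuous_ins i).comp (ht.prodMk hy)

theorem ins_mem_refElem {K : ElemKind} {m : ℕ} (i : Fin (m + 1)) (t : ℝ) (y : Vec m) :
    ins i t y ∈ refElem K (m + 1) ↔ y ∈ refElem K m ∧ t ∈ Set.Icc 0 (height K y) := by
  cases K
  · rw [mem_refElem_simplex, mem_refElem_simplex, sum_ins, Fin.forall_iff_succAbove i]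
    simp only [ins_same, ins_succAbove, height, Set.mem_Icc]
    constructor
    · rintro ⟨h1, h2, h3⟩
      exact ⟨⟨by linarith, h3⟩, h2, by linarith⟩
    · rintro ⟨⟨h1, h2⟩, h3, h4⟩
      exact ⟨by linarith, h3, h2⟩
  · rw [mem_refElem_cube, mem_refElem_cube, Fin.forall_iff_succAbove i]
    simp only [ins_same, ins_succAbove, height, Set.mem_Icc]
    tauto

theorem height_nonneg {K : ElemKind} {m : ℕ} {y : Vec m} (hy : y ∈ refElem K m) :
    0 ≤ height K y := by
  cases K
  · rw [mem_refElem_simplex] at hy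
    simp only [height]; linarith [hy.1]
  · simp [height]

/-- The upper facet of the reference element in the direction of the `i`-th coordinate. -/
def topFacet {d : ℕ} (i : Fin d) : (K : ElemKind) → RefFacet K d
  | .simplex => (none : Option (Fin d))
  | .cube => (i, true)

/-- The lower facet of the reference element in the direction of the `i`-th coordinate. -/
def botFacet {d : ℕ} (i : Fin d) : (K : ElemKind) → RefFacet K d
  | .simplex => some i
  | .cube => (i, false)

theorem facet_cases {K : ElemKind} {m : ℕ} (F : RefFacet K (m + 1)) :
    ∃ i, F = topFacet i K ∨ F = botFacet i K := by
  cases K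
  · rcases F with _ | i
    exacts [⟨0, Or.inl rfl⟩, ⟨i, Or.inr rfl⟩]
  · rcases F with ⟨i, _ | _⟩
    exacts [⟨i, Or.inr rfl⟩, ⟨i, Or.inl rfl⟩]

theorem facet_cases_of_ne {K : ElemKind} {d : ℕ} {F : RefFacet K d} {i : Fin d}
    (h : refNormal K F i ≠ 0) : F = topFacet i K ∨ F = botFacet i K := by
  cases K
  · rcases F with _ | j
    · exact Or.inl rfl
    · right
      by_contra hne
      apply h
      have : i ≠ j := fun h' => hne (by rw [h']; rfl)
      simp [refNormal, this]
  · rcases F with ⟨j, _ | _⟩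
    · right
      by_contra hne
      apply h
      have : i ≠ j := fun h' => hne (by rw [h']; rfl)
      simp [refNormal, this]
    · left
      by_contra hne
      apply h
      have : i ≠ j := fun h' => hne (by rw [h']; rfl)
      simp [refNormal, this]

theorem refNormal_topFacet {K : ElemKind} {d : ℕ} (i : Fin d) :
    refNormal K (topFacet i K) i = 1 := by
  cases K <;> simp [topFacet, refNormal]

theorem refNormal_botFacet {K : ElemKind} {d : ℕ} (i : Fin d) :
    refNormal K (botFacet i K) i = -1 := by
  cases K <;> simp [botFacet, refNormal]

theorem refNormal_ne_zero {K : ElemKind} {m : ℕ} (F : RefFacet K (m + 1)) :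
    refNormal K F ≠ 0 := by
  intro h
  obtain ⟨i, rfl | rfl⟩ := facet_cases F
  · simpa [h] using refNormal_topFacet (K := K) i
  · simpa [h] using refNormal_botFacet (K := K) i

/-- The `i`-th component of a reference normal is nonzero on two facets only, where it is `1` and
`-1`. The divergence theorem can therefore be proved one coordinate at a time. -/
theorem sum_facets {K : ElemKind} {d : ℕ} (X : RefFacet K d → Fin d → ℝ) :
    ∑ F, ∑ i, refNormal K F i * X F i = ∑ i, (X (topFacet i K) i - X (botFacet i K) i) := by
  cases K
  · refine (Fintype.sum_option (α := Fin d)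
      (fun F => ∑ i, refNormal .simplex F i * X F i)).trans ?_
    rw [Finset.sum_sub_distrib, sub_eq_add_neg, ← Finset.sum_neg_distrib]
    congr 1
    · simp [refNormal, topFacet]
    · refine Finset.sum_congr rfl fun i _ => ?_
      rw [Finset.sum_eq_single i]
      · simp [refNormal, botFacet]
      · intro j _ hj
        simp [refNormal, hj]
      · simp
  · refine (Fintype.sum_prod_type (α₁ := Fin d) (α₂ := Bool)
      (fun F => ∑ i, refNormal .cube F i * X F i)).trans ?_
    refine Finset.sum_congr rfl fun i _ => ?_
    rw [Fintype.sum_bool, Finset.sum_eq_single i, Finset.sum_eq_single i]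
    · simp [refNormal, botFacet, topFacet, sub_eq_add_neg]
    · intro j _ hj
      simp [refNormal, hj]
    · simp
    · intro j _ hj
      simp [refNormal, hj]
    · simp

theorem inner_topFacet_ins {K : ElemKind} {m : ℕ} (i : Fin (m + 1)) (t : ℝ) (y : Vec m) :
    inner ℝ (refNormal K (topFacet i K)) (ins i t y) - refOffset K (topFacet i K)
      = t - height K y := by
  cases K
  · rw [topFacet, inner_refNormal_simplex_none, sum_ins]
    simp [refOffset, height]; ring
  · rw [topFacet, inner_refNormal_cube_true]
    simp [refOffset, height]

theorem inner_botFacet_ins {K : ElemKind} {m : ℕ} (i : Fin (m + 1)) (t : ℝ) (y : Vec m) :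
    inner ℝ (refNormal K (botFacet i K)) (ins i t y) - refOffset K (botFacet i K) = - t := by
  cases K
  · rw [botFacet, inner_refNormal_simplex_some]
    simp [refOffset]
  · rw [botFacet, inner_refNormal_cube_false]
    simp [refOffset]

theorem refFace_topFacet {K : ElemKind} {m : ℕ} (i : Fin (m + 1)) :
    refFace K {topFacet i K} = (fun y => ins i (height K y) y) '' refElem K m := by
  ext x
  simp only [refFace, Set.mem_singleton_iff, forall_eq, Set.mem_ofPred_eq, Set.mem_image]
  constructor
  · rintro ⟨hx, h⟩
    rw [← ins_del i x, ins_mem_refElem] at hx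
    refine ⟨del i x, hx.1, ?_⟩
    have := inner_topFacet_ins (K := K) i (x i) (del i x)
    rw [ins_del, h, sub_self] at this
    rw [← sub_eq_zero.mp this.symm, ins_del]
  · rintro ⟨y, hy, rfl⟩
    refine ⟨(ins_mem_refElem i _ _).2 ⟨hy, height_nonneg hy, le_rfl⟩, ?_⟩
    have := inner_topFacet_ins (K := K) i (height K y) y
    linarith

theorem refFace_botFacet {K : ElemKind} {m : ℕ} (i : Fin (m + 1)) :
    refFace K {botFacet i K} = (fun y => ins i 0 y) '' refElem K m := by
  ext x
  simp only [refFace, Set.mem_singleton_iff, forall_eq, Set.mem_ofPred_eq, Set.mem_image]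
  constructor
  · rintro ⟨hx, h⟩
    rw [← ins_del i x, ins_mem_refElem] at hx
    refine ⟨del i x, hx.1, ?_⟩
    have := inner_botFacet_ins (K := K) i (x i) (del i x)
    rw [ins_del, h, sub_self] at this
    rw [show (0 : ℝ) = x i by linarith, ins_del]
  · rintro ⟨y, hy, rfl⟩
    refine ⟨(ins_mem_refElem i _ _).2 ⟨hy, le_rfl, height_nonneg hy⟩, ?_⟩
    have := inner_botFacet_ins (K := K) i 0 y
    linarith

theorem height_strict {K : ElemKind} {m : ℕ} {y : Vec m}
    (hy : ∀ F : RefFacet K m, inner ℝ (refNormal K F) y < refOffset K F) : 0 < height K y := by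
  cases K
  · have := hy (none : Option (Fin m))
    rw [inner_refNormal_simplex_none] at this
    simp only [refOffset, height] at *
    linarith
  · simp [height]

/-- A point of a facet of the reference element that lies on no other facet. -/
theorem exists_facet_center {K : ElemKind} {m : ℕ} (F : RefFacet K (m + 1)) :
    ∃ c : Vec (m + 1), inner ℝ (refNormal K F) c = refOffset K F ∧
      ∀ F', F' ≠ F → inner ℝ (refNormal K F') c < refOffset K F' := by
  obtain ⟨y, hy⟩ := exists_strict_refElem K m
  have hh := height_strict hy
  -- In both cases the center is a strictly interior point of the reference element of one dimension
  -- less, lifted to the facet.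
  obtain ⟨i, rfl | rfl⟩ := facet_cases F
  · refine ⟨ins i (height K y) y, by linarith [inner_topFacet_ins (K := K) i (height K y) y], ?_⟩
    cases K
    · rw [forall_refFacet_simplex] at hy ⊢
      refine ⟨fun h => absurd rfl h, fun j _ => ?_⟩
      rw [inner_refNormal_simplex_some]
      obtain rfl | ⟨k, rfl⟩ := Fin.eq_self_or_eq_succAbove i j
      · simpa [refOffset] using hh
      · have := hy.2 k
        rw [inner_refNormal_simplex_some] at this
        simpa [refOffset] using this
    · rw [forall_refFacet_cube] at hy ⊢
      intro j
      rw [inner_refNormal_cube_true, inner_refNormal_cube_false]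
      obtain rfl | ⟨k, rfl⟩ := Fin.eq_self_or_eq_succAbove i j
      · refine ⟨fun h => absurd rfl h, fun _ => ?_⟩
        simp [refOffset, height]
      · have := hy k
        rw [inner_refNormal_cube_true, inner_refNormal_cube_false] at this
        simp only [ins_succAbove]
        exact ⟨fun _ => this.1, fun _ => this.2⟩
  · refine ⟨ins i 0 y, by linarith [inner_botFacet_ins (K := K) i 0 y], ?_⟩
    cases K
    · rw [forall_refFacet_simplex] at hy ⊢
      refine ⟨fun _ => ?_, fun j hj => ?_⟩
      · rw [inner_refNormal_simplex_none, sum_ins]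
        simp only [refOffset, height] at *
        linarith
      · rw [inner_refNormal_simplex_some]
        obtain rfl | ⟨k, rfl⟩ := Fin.eq_self_or_eq_succAbove i j
        · exact absurd rfl hj
        · have := hy.2 k
          rw [inner_refNormal_simplex_some] at this
          simpa [refOffset] using this
    · rw [forall_refFacet_cube] at hy ⊢
      intro j
      rw [inner_refNormal_cube_true, inner_refNormal_cube_false]
      obtain rfl | ⟨k, rfl⟩ := Fin.eq_self_or_eq_succAbove i j
      · refine ⟨fun _ => ?_, fun h => absurd rfl h⟩
        simp [refOffset]
      · have := hy k
        rw [inner_refNormal_cube_true, inner_refNormal_cube_false] at this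
        simp only [ins_succAbove]
        exact ⟨fun _ => this.1, fun _ => this.2⟩

theorem measurePreserving_ins {m : ℕ} (i : Fin (m + 1)) :
    MeasurePreserving (fun q : ℝ × Vec m => ins i q.1 q.2) (volume.prod volume) volume := by
  have h1 : MeasurePreserving (Prod.map id (WithLp.ofLp (p := 2)) : ℝ × Vec m → ℝ × (Fin m → ℝ))
      (volume.prod volume) (volume.prod volume) :=
    (MeasurePreserving.id volume).prod (PiLp.volume_preserving_ofLp (Fin m))
  have h2 := (volume_preserving_piFinSuccAbove (fun _ : Fin (m + 1) => ℝ) i).symm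
  exact ((PiLp.volume_preserving_toLp (Fin (m + 1))).comp h2).comp h1

theorem measurableEmbedding_ins {m : ℕ} (i : Fin (m + 1)) :
    MeasurableEmbedding (fun q : ℝ × Vec m => ins i q.1 q.2) := by
  refine (continuous_ins i).measurableEmbedding fun a b hab => ?_
  have h1 := congrArg (fun x : Vec (m + 1) => x i) hab
  have h2 := congrArg (del i) hab
  simp only [ins_same, del_ins] at h1 h2
  exact Prod.ext h1 h2

/-- Fubini with the `i`-th coordinate as the inner variable; the slice over `y` is the interval from
the lower facet to the upper one. -/
theorem setIntegral_refElem {K : ElemKind} {m : ℕ} (i : Fin (m + 1)) {f : Vec (m + 1) → ℝ}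
    (hf : Continuous f) :
    ∫ x in refElem K (m + 1), f x =
      ∫ y in refElem K m, ∫ t in (0 : ℝ)..height K y, f (ins i t y) := by
  have hfi : IntegrableOn f (refElem K (m + 1)) :=
    hf.continuousOn.integrableOn_compact (isCompact_refElem K _)
  have hS := (isClosed_refElem K (m + 1)).measurableSet
  have hS' := (isClosed_refElem K m).measurableSet
  rw [← (measurePreserving_ins i).setIntegral_preimage_emb (measurableEmbedding_ins i)]
  have hpre : MeasurableSet ((fun q : ℝ × Vec m => ins i q.1 q.2) ⁻¹' refElem K (m + 1)) :=
    (measurableEmbedding_ins i).measurable hS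
  have hfi' : IntegrableOn (fun q : ℝ × Vec m => f (ins i q.1 q.2))
      ((fun q : ℝ × Vec m => ins i q.1 q.2) ⁻¹' refElem K (m + 1)) (volume.prod volume) :=
    ((measurePreserving_ins i).integrableOn_comp_preimage (measurableEmbedding_ins i)).2 hfi
  rw [← integral_indicator hpre, integral_prod_symm _ (hfi'.integrable_indicator hpre),
    ← integral_indicator hS']
  congr 1
  ext y
  by_cases hy : y ∈ refElem K m
  · rw [Set.indicator_of_mem hy, intervalIntegral.integral_of_le (height_nonneg hy),
      ← integral_Icc_eq_integral_Ioc, ← integral_indicator measurableSet_Icc]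
    congr 1
    ext t
    simp [Set.indicator, ins_mem_refElem, hy]
  · rw [Set.indicator_of_notMem hy]
    simp [Set.indicator, ins_mem_refElem, hy]

theorem hasDerivAt_ins {m : ℕ} (i : Fin (m + 1)) (y : Vec m) (t : ℝ) :
    HasDerivAt (fun t => ins i t y) (EuclideanSpace.single i 1) t := by
  have : (fun t => ins i t y) = fun t => ins i 0 y + t • (EuclideanSpace.single i (1 : ℝ)) := by
    ext t : 1
    refine vec_ext_succAbove i (by simp) fun j => ?_
    simp [Fin.succAbove_ne]
  rw [this]
  simpa using ((hasDerivAt_id t).smul_const (EuclideanSpace.single i (1 : ℝ))).const_add (ins i 0 y)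

/-- The fundamental theorem of calculus on each slice, whose end points lie on the two facets that
see the `i`-th coordinate. -/
theorem setIntegral_partial_refElem {K : ElemKind} {m : ℕ} (i : Fin (m + 1)) {f : Vec (m + 1) → ℝ}
    (hf : ContDiff ℝ 1 f) :
    ∫ x in refElem K (m + 1), fderiv ℝ f x (EuclideanSpace.single i 1) =
      (∫ y in refElem K m, f (ins i (height K y) y)) - ∫ y in refElem K m, f (ins i 0 y) := by
  have hc : Continuous fun x => fderiv ℝ f x (EuclideanSpace.single i 1) :=
    (hf.continuous_fderiv one_ne_zero).clm_apply continuous_const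
  rw [setIntegral_refElem i hc]
  have hfc := hf.continuous
  have hh := continuous_height (m := m) K
  rw [← integral_sub]
  · refine setIntegral_congr_fun (isClosed_refElem K m).measurableSet fun y _ => ?_
    refine intervalIntegral.integral_eq_sub_of_hasDerivAt (f := fun t => f (ins i t y))
      (fun t _ => ?_) ?_
    · exact ((hf.differentiable one_ne_zero).differentiableAt.hasFDerivAt).comp_hasDerivAt t
        (hasDerivAt_ins i y t)
    · refine Continuous.intervalIntegrable ?_ _ _
      exact hc.comp (by fun_prop)
  · exact (hfc.comp (by fun_prop)).continuousOn.integrableOn_compact (isCompact_refElem K _)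
  · exact (hfc.comp (by fun_prop)).continuousOn.integrableOn_compact (isCompact_refElem K _)

/-! ### The surface measure on an affine facet -/

/-- Insertion of the coordinate `0` as a linear isometry. -/
def insIso {m : ℕ} (i : Fin (m + 1)) : Vec m →ₗᵢ[ℝ] Vec (m + 1) where
  toFun y := ins i 0 y
  map_add' x y := vec_ext_succAbove i (by simp) (by simp)
  map_smul' c y := vec_ext_succAbove i (by simp) (by simp)
  norm_map' y := by
    change ‖ins i 0 y‖ = ‖y‖
    rw [EuclideanSpace.norm_eq, EuclideanSpace.norm_eq, Fin.sum_univ_succAbove _ i]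
    simp

@[simp] theorem insIso_apply {m : ℕ} (i : Fin (m + 1)) (y : Vec m) : insIso i y = ins i 0 y := rfl

/-- Deletion of a coordinate as a linear map. -/
def delLin {m : ℕ} (i : Fin (m + 1)) : Vec (m + 1) →ₗ[ℝ] Vec m where
  toFun := del i
  map_add' x y := by ext; simp
  map_smul' c y := by ext; simp

@[simp] theorem delLin_apply {m : ℕ} (i : Fin (m + 1)) (x : Vec (m + 1)) :
    delLin i x = del i x := rfl

/-- Laplace expansion along row `i`, whose only nonzero entry is the `1` on the diagonal. -/
theorem det_of_block {m : ℕ} (i : Fin (m + 1)) (L : Vec m →ₗ[ℝ] Vec m)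
    (W : Vec (m + 1) →ₗ[ℝ] Vec (m + 1)) (h : ∀ x, W x = ins i (x i) (L (del i x))) :
    LinearMap.det W = LinearMap.det L := by
  have hb : ∀ n : ℕ, ∀ j : Fin n, (EuclideanSpace.basisFun (Fin n) ℝ).toBasis j
      = EuclideanSpace.single j (1 : ℝ) := fun n j => by simp
  rw [← LinearMap.det_toMatrix (EuclideanSpace.basisFun (Fin (m + 1)) ℝ).toBasis W,
    ← LinearMap.det_toMatrix (EuclideanSpace.basisFun (Fin m) ℝ).toBasis L,
    Matrix.det_succ_row _ i, Finset.sum_eq_single i]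
  · have h1 : (-1 : ℝ) ^ ((i : ℕ) + i) = 1 := by rw [← two_mul]; simp
    rw [h1, one_mul]
    have h2 : LinearMap.toMatrix (EuclideanSpace.basisFun (Fin (m + 1)) ℝ).toBasis
        (EuclideanSpace.basisFun (Fin (m + 1)) ℝ).toBasis W i i = 1 := by
      rw [LinearMap.toMatrix_apply, hb, h]
      simp
    rw [h2, one_mul]
    congr 1
    ext a b
    rw [Matrix.submatrix_apply, LinearMap.toMatrix_apply, LinearMap.toMatrix_apply, hb, hb, h]
    have : del i (EuclideanSpace.single (i.succAbove b) (1 : ℝ)) = EuclideanSpace.single b 1 := by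
      ext c
      simp
    simp [this]
  · intro j _ hj
    have h2 : LinearMap.toMatrix (EuclideanSpace.basisFun (Fin (m + 1)) ℝ).toBasis
        (EuclideanSpace.basisFun (Fin (m + 1)) ℝ).toBasis W i j = 0 := by
      rw [LinearMap.toMatrix_apply, hb, h]
      simp [hj.symm]
    rw [h2]; simp
  · simp

/-- A Householder reflection takes the unit normal `n` to the `i`-th axis. The range of `D` then
lies in a coordinate hyperplane, and `E` becomes block diagonal with the block of `D` and a `1`. So
an area factor can be computed as an ordinary determinant by adding the normal as one more column.
-/
theorem normDet_eq_abs_det_of_normal {m : ℕ} (i : Fin (m + 1)) (D : Vec m →ₗ[ℝ] Vec (m + 1))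
    (E : Vec (m + 1) →ₗ[ℝ] Vec (m + 1)) (n : Vec (m + 1)) (hn : ‖n‖ = 1)
    (hD : ∀ y, inner ℝ n (D y) = 0) (hE : ∀ x, E x = D (del i x) + x i • n) :
    D.normDet = |LinearMap.det E| := by
  let e : Vec (m + 1) := EuclideanSpace.single i 1
  obtain ⟨U, hU⟩ : ∃ U : Vec (m + 1) ≃ₗᵢ[ℝ] Vec (m + 1), U e = n :=
    ⟨(ℝ ∙ (e - n))ᗮ.reflection, Submodule.reflection_sub (by simp [e, hn])⟩
  let L : Vec m →ₗ[ℝ] Vec m := delLin i ∘ₗ U.symm.toLinearEquiv.toLinearMap ∘ₗ D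
  have hco : ∀ y, (U.symm (D y)) i = 0 := by
    intro y
    have h1 : inner ℝ e (U.symm (D y)) = 0 := by
      rw [← U.inner_map_map, hU, U.apply_symm_apply, hD]
    simpa [e, EuclideanSpace.inner_single_left] using h1
  have hL : ∀ y, U.symm (D y) = ins i 0 (L y) := by
    intro y
    conv_lhs => rw [← ins_del i (U.symm (D y)), hco]
    rfl
  have hDL : D = (U.toLinearIsometry.comp (insIso i)).toLinearMap ∘ₗ L := by
    ext1 y
    have := congrArg U (hL y)
    simpa using this
  have h1 : D.normDet = |LinearMap.det L| := by
    conv_lhs => rw [hDL]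
    rw [LinearMap.normDet_comp_of_finrank_eq _ _ rfl, LinearIsometry.normDet_eq_one, one_mul,
      LinearMap.normDet_eq_abs_det]
  have h2 : LinearMap.det (U.symm.toLinearEquiv.toLinearMap ∘ₗ E) = LinearMap.det L := by
    refine det_of_block i L _ fun x => ?_
    change U.symm (E x) = _
    rw [hE, map_add, map_smul, hL, ← hU, U.symm_apply_apply]
    refine vec_ext_succAbove i ?_ fun j => ?_
    · simp [e]
    · simp [e, Fin.succAbove_ne]
  rw [h1, ← h2, LinearMap.det_comp, abs_mul]
  have h3 : |LinearMap.det U.symm.toLinearEquiv.toLinearMap| = 1 := by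
    rw [← LinearMap.normDet_eq_abs_det]
    exact U.symm.toLinearIsometry.normDet_eq_one
  rw [h3, one_mul]

theorem ins_eq_sub {m : ℕ} (i : Fin (m + 1)) (x : Vec (m + 1)) :
    ins i 0 (del i x) = x - x i • EuclideanSpace.single i (1 : ℝ) := by
  refine vec_ext_succAbove i (by simp) fun j => ?_
  simp [Fin.succAbove_ne]

/-- The tangential part of the parametrization of a hyperplane with conormal `N` over the
coordinates other than the `i`-th. -/
def tangent {m : ℕ} (i : Fin (m + 1)) (N : Vec (m + 1)) : Vec m →ₗ[ℝ] Vec (m + 1) :=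
  (insIso i).toLinearMap -
    (((innerₛₗ ℝ N : Vec (m + 1) →ₗ[ℝ] ℝ) ∘ₗ (insIso i).toLinearMap).smulRight
      ((N i)⁻¹ • EuclideanSpace.single i (1 : ℝ)))

theorem tangent_apply {m : ℕ} (i : Fin (m + 1)) (N : Vec (m + 1)) (y : Vec m) :
    tangent i N y = ins i 0 y -
      (inner ℝ N (ins i 0 y) * (N i)⁻¹) • EuclideanSpace.single i (1 : ℝ) := by
  simp [tangent, smul_smul]

/-- `G` is a product of two transvections, and a transvection has determinant `1 + f v`. The first
factor has determinant `1` because `fN` annihilates `e`. -/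
theorem det_tangent_add {m : ℕ} (i : Fin (m + 1)) (N w : Vec (m + 1)) (hN : N i ≠ 0)
    (G : Vec (m + 1) →ₗ[ℝ] Vec (m + 1)) (hG : ∀ x, G x = tangent i N (del i x) + x i • w) :
    LinearMap.det G = inner ℝ N w / N i := by
  let e : Vec (m + 1) := EuclideanSpace.single i 1
  let ci : Vec (m + 1) →ₗ[ℝ] ℝ := innerₛₗ ℝ e
  have hci : ∀ x, ci x = x i := fun x => by simp [ci, e, EuclideanSpace.inner_single_left]
  let fN : Vec (m + 1) →ₗ[ℝ] ℝ := (N i)⁻¹ • (N i • ci - innerₛₗ ℝ N)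
  have hfN : ∀ x, fN x = (N i)⁻¹ * (N i * x i - inner ℝ N x) := fun x => by
    simp [fN, hci]
  have hNe : inner ℝ N e = N i := by
    rw [real_inner_comm]; simp [e, EuclideanSpace.inner_single_left]
  have hfe : fN e = 0 := by
    rw [hfN, hNe]; simp [e]
  have hGQ : G = LinearMap.transvection fN e ∘ₗ
      LinearMap.transvection ci (w - fN w • e - e) := by
    ext1 x
    rw [hG, tangent_apply, ins_eq_sub, LinearMap.comp_apply]
    simp only [LinearMap.transvection.apply, map_add, map_sub, map_smul, hfe, hci, inner_sub_right,
      inner_smul_right]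
    have h1 : (inner ℝ N x - x i * inner ℝ N (EuclideanSpace.single i (1 : ℝ))) * (N i)⁻¹
        = - fN x := by
      change (inner ℝ N x - x i * inner ℝ N e) * (N i)⁻¹ = _
      rw [hNe, hfN]; ring
    rw [h1]
    change x - x i • e - (-fN x) • e + x i • w = _
    module
  rw [hGQ, LinearMap.det_comp, LinearMap.transvection.det, LinearMap.transvection.det, hfe,
    add_zero, one_mul, hci]
  have : (w - fN w • e - e) i = w i - fN w - 1 := by simp [e]
  rw [this, hfN]
  field_simp
  ring

/-- Nanson's formula for the surface measure of the affine image of a facet. -/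
theorem surface_restrict_image {m : ℕ} (i : Fin (m + 1)) (Φ : Vec (m + 1) ≃ᵃ[ℝ] Vec (m + 1))
    (N : Vec (m + 1)) (hN : |N i| = 1) (c : ℝ) (t : Vec m → ℝ)
    (ht : ∀ y, inner ℝ N (ins i (t y) y) = c) (R : Set (Vec m)) :
    MeasurableEmbedding (fun y => Φ (ins i (t y) y)) ∧
    (μHE[m] : Measure (Vec (m + 1))).restrict ((fun y => Φ (ins i (t y) y)) '' R) =
      ENNReal.ofReal (|LinearMap.det (Φ.linear : Vec (m + 1) →ₗ[ℝ] Vec (m + 1))| *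
        ‖LinearMap.adjoint (Φ.linear.symm : Vec (m + 1) →ₗ[ℝ] Vec (m + 1)) N‖) •
      Measure.map (fun y => Φ (ins i (t y) y)) (volume.restrict R) := by
  have hN0 : N i ≠ 0 := by
    intro h; rw [h] at hN; simp at hN
  set B := (Φ.linear : Vec (m + 1) →ₗ[ℝ] Vec (m + 1)) with hB
  set mm := LinearMap.adjoint (Φ.linear.symm : Vec (m + 1) →ₗ[ℝ] Vec (m + 1)) N with hmm
  have hmm0 : mm ≠ 0 := by
    intro h
    have : inner ℝ mm (B N) = inner ℝ N N := by
      rw [hmm, LinearMap.adjoint_inner_left]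
      simp [hB]
    rw [h, inner_zero_left, eq_comm, inner_self_eq_zero] at this
    rw [this] at hN0; simp at hN0
  have hmn : ‖mm‖ ≠ 0 := norm_ne_zero_iff.2 hmm0
  set n := ‖mm‖⁻¹ • mm with hn
  let D : Vec m →ₗ[ℝ] Vec (m + 1) := B ∘ₗ tangent i N
  let G : Vec (m + 1) →ₗ[ℝ] Vec (m + 1) := tangent i N ∘ₗ delLin i +
    (innerₛₗ ℝ (EuclideanSpace.single i (1 : ℝ) : Vec (m + 1))).smulRight (Φ.linear.symm n)
  have hG : ∀ x, G x = tangent i N (del i x) + x i • Φ.linear.symm n := by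
    intro x
    simp [G, EuclideanSpace.inner_single_left]
  have hNt : ∀ y, inner ℝ N (tangent i N y) = 0 := by
    intro y
    rw [tangent_apply, inner_sub_right, inner_smul_right]
    have : inner ℝ N (EuclideanSpace.single i (1 : ℝ)) = N i := by
      rw [real_inner_comm]; simp [EuclideanSpace.inner_single_left]
    rw [this, mul_assoc, inv_mul_cancel₀ hN0]; ring
  -- The extra column of `G` is `B⁻¹ n`, so that `B ∘ G` completes `D` by the unit normal `n`. Its
  -- determinant contains the factor `⟨N, B⁻¹ n⟩ = ⟨mm, n⟩ = ‖mm‖`, and `N i` drops out since its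
  -- modulus is `1`.
  have hdet : D.normDet = |LinearMap.det B| * ‖mm‖ := by
    rw [normDet_eq_abs_det_of_normal i D (B ∘ₗ G) n, LinearMap.det_comp,
      det_tangent_add i N (Φ.linear.symm n) hN0 G hG, abs_mul, abs_div, hN, div_one]
    · congr 1
      have : inner ℝ N (Φ.linear.symm n) = inner ℝ mm n := by
        rw [hmm, LinearMap.adjoint_inner_left]; rfl
      rw [this, hn, inner_smul_right, real_inner_self_eq_norm_sq]
      rw [pow_two, inv_mul_cancel_left₀ hmn, abs_of_nonneg (norm_nonneg _)]
    · rw [hn, norm_smul, norm_inv, norm_norm, inv_mul_cancel₀ hmn]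
    · intro y
      rw [hn, real_inner_smul_left, hmm, LinearMap.adjoint_inner_left]
      simp [D, hB, hNt]
    · intro x
      simp only [LinearMap.comp_apply, hG, map_add, map_smul, D]
      congr 2
      simp [hB]
  -- As `N i ≠ 0`, the hyperplane equation determines `t y` affinely, so the parametrization is a
  -- translate of `D`.
  have hP : ∀ y, Φ (ins i (t y) y) = Φ (ins i (t 0) 0) + D y := by
    intro y
    have h1 : ins i (t y) y = ins i (t 0) 0 + tangent i N y := by
      have h2 : ins i (t y) y = ins i 0 y + t y • EuclideanSpace.single i (1 : ℝ) :=
        vec_ext_succAbove i (by simp) (by simp [Fin.succAbove_ne])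
      have h3 : ins i (t 0) (0 : Vec m) = t 0 • EuclideanSpace.single i (1 : ℝ) :=
        vec_ext_succAbove i (by simp) (by simp [Fin.succAbove_ne])
      have h4 := ht y
      have h5 := ht 0
      have h6 : inner ℝ N (EuclideanSpace.single i (1 : ℝ)) = N i := by
        rw [real_inner_comm]; simp [EuclideanSpace.inner_single_left]
      rw [h2, inner_add_right, inner_smul_right, h6] at h4
      rw [h3, inner_smul_right, h6] at h5
      rw [h2, h3, tangent_apply]
      have h7 : t y = t 0 - inner ℝ N (ins i 0 y) * (N i)⁻¹ := by
        field_simp; linarith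
      rw [h7]; module
    rw [h1]
    have := Φ.map_vadd (ins i (t 0) 0) (tangent i N y)
    rw [vadd_eq_add, vadd_eq_add] at this
    rw [add_comm (ins i (t 0) 0), this]
    exact add_comm _ _
  set P : Vec m → Vec (m + 1) := fun y => Φ (ins i (t y) y) with hPdef
  have hPD : P = fun y => Φ (ins i (t 0) 0) + D y := funext hP
  have hinj : Function.Injective P := by
    intro a b hab
    have := congrArg (del i) (Φ.injective hab)
    simpa using this
  have hcont : Continuous P := by
    rw [hPD]
    exact continuous_const.add D.continuous_of_finiteDimensional
  have hemb : MeasurableEmbedding P := hcont.measurableEmbedding hinj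
  refine ⟨hemb, Measure.ext fun S hS => ?_⟩
  rw [Measure.restrict_apply hS, Measure.smul_apply, Measure.map_apply hemb.measurable hS,
    Measure.restrict_apply (hemb.measurable hS), ← hdet, smul_eq_mul,
    ← Set.image_preimage_inter P R S]
  have hfr : Module.finrank ℝ (Vec m) = m := by simp
  have h1 := D.euclideanHausdorffMeasure_image_eq_normDet_mul_volume (P ⁻¹' S ∩ R)
  rw [hfr] at h1
  rw [← h1]
  have h2 : P '' (P ⁻¹' S ∩ R) = (fun x => Φ (ins i (t 0) 0) + x) '' (D '' (P ⁻¹' S ∩ R)) := by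
    rw [Set.image_image, ← hPD]
  rw [h2]
  exact (isometry_add_left _).euclideanHausdorffMeasure_image _

theorem abs_refNormal_eq_one {K : ElemKind} {d : ℕ} {F : RefFacet K d} {i : Fin d}
    (h : refNormal K F i ≠ 0) : |refNormal K F i| = 1 := by
  obtain rfl | rfl := facet_cases_of_ne h
  · rw [refNormal_topFacet, abs_one]
  · rw [refNormal_botFacet, abs_neg, abs_one]

/-- The height of the facet `F` above the coordinate hyperplane `xᵢ = 0`. -/
def facetHeight {K : ElemKind} {m : ℕ} (F : RefFacet K (m + 1)) (i : Fin (m + 1))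
    (y : Vec m) : ℝ :=
  (1 + refNormal K F i) / 2 * height K y

theorem facetHeight_topFacet {K : ElemKind} {m : ℕ} (i : Fin (m + 1)) (y : Vec m) :
    facetHeight (topFacet i K) i y = height K y := by
  rw [facetHeight, refNormal_topFacet]; ring

theorem facetHeight_botFacet {K : ElemKind} {m : ℕ} (i : Fin (m + 1)) (y : Vec m) :
    facetHeight (botFacet i K) i y = 0 := by
  rw [facetHeight, refNormal_botFacet]; ring

theorem continuous_facetHeight {K : ElemKind} {m : ℕ} (F : RefFacet K (m + 1))
    (i : Fin (m + 1)) : Continuous (facetHeight F i) :=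
  continuous_const.mul (continuous_height K)

theorem refFace_eq_image {K : ElemKind} {m : ℕ} {F : RefFacet K (m + 1)} {i : Fin (m + 1)}
    (h : refNormal K F i ≠ 0) :
    refFace K {F} = (fun y => ins i (facetHeight F i y) y) '' refElem K m := by
  obtain rfl | rfl := facet_cases_of_ne h
  · simp only [facetHeight_topFacet, refFace_topFacet]
  · simp only [facetHeight_botFacet, refFace_botFacet]

theorem inner_refNormal_facet {K : ElemKind} {m : ℕ} {F : RefFacet K (m + 1)} {i : Fin (m + 1)}
    (h : refNormal K F i ≠ 0) (y : Vec m) :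
    inner ℝ (refNormal K F) (ins i (facetHeight F i y) y) = refOffset K F := by
  obtain rfl | rfl := facet_cases_of_ne h
  · rw [facetHeight_topFacet]
    linarith [inner_topFacet_ins (K := K) i (height K y) y]
  · rw [facetHeight_botFacet]
    linarith [inner_botFacet_ins (K := K) i 0 y]

/-! ### Conormals and surface integrals on the sides of a mesh -/

variable {K : ElemKind} {m : ℕ} {Ω : Set (Vec (m + 1))} (M : Mesh K (m + 1) Ω)

/-- The determinant of the linear part of the affine map of an element. -/
def Mesh.det (T : M.Elem) : ℝ :=
  LinearMap.det ((M.Φ T).linear : Vec (m + 1) →ₗ[ℝ] Vec (m + 1))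

theorem Mesh.det_ne_zero (T : M.Elem) : M.det T ≠ 0 :=
  ((M.Φ T).linear.isUnit_det').ne_zero

/-- The conormal of a side: the inverse transpose of the affine map applied to the
reference normal. -/
def Mesh.conormal (s : M.Side) : Vec (m + 1) :=
  LinearMap.adjoint ((M.Φ s.1).linear.symm : Vec (m + 1) →ₗ[ℝ] Vec (m + 1)) (refNormal K s.2)

theorem Mesh.normal_eq (s : M.Side) : M.normal s = ‖M.conormal s‖⁻¹ • M.conormal s := rfl

theorem Mesh.inner_conormal (s : M.Side) (v : Vec (m + 1)) :
    inner ℝ (M.conormal s) v = inner ℝ (refNormal K s.2) ((M.Φ s.1).linear.symm v) := by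
  rw [Mesh.conormal, LinearMap.adjoint_inner_left]; rfl

theorem Mesh.norm_conormal_pos (s : M.Side) : 0 < ‖M.conormal s‖ := by
  rw [norm_pos_iff]
  intro h
  have := M.inner_conormal s ((M.Φ s.1).linear (refNormal K s.2))
  rw [h, inner_zero_left, LinearEquiv.symm_apply_apply, eq_comm, inner_self_eq_zero] at this
  exact refNormal_ne_zero _ this

theorem Mesh.norm_normal (s : M.Side) : ‖M.normal s‖ = 1 := by
  rw [M.normal_eq, norm_smul, norm_inv, norm_norm, inv_mul_cancel₀ (M.norm_conormal_pos s).ne']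

/-- The ratio of the surface measures on a side and on its reference facet. -/
def Mesh.surfFactor (s : M.Side) : ℝ := |M.det s.1| * ‖M.conormal s‖

theorem Mesh.surfFactor_pos (s : M.Side) : 0 < M.surfFactor s :=
  mul_pos (abs_pos.2 (M.det_ne_zero _)) (M.norm_conormal_pos s)

theorem Mesh.surf_eq_map (s : M.Side) {i : Fin (m + 1)} (h : refNormal K s.2 i ≠ 0) :
    MeasurableEmbedding (fun y => M.Φ s.1 (ins i (facetHeight s.2 i y) y)) ∧
    M.surf s = ENNReal.ofReal (M.surfFactor s) •
      Measure.map (fun y => M.Φ s.1 (ins i (facetHeight s.2 i y) y))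
        (volume.restrict (refElem K m)) := by
  have := surface_restrict_image i (M.Φ s.1) (refNormal K s.2) (abs_refNormal_eq_one h)
    (refOffset K s.2) (facetHeight s.2 i) (inner_refNormal_facet h)
    (refElem K m)
  refine ⟨this.1, ?_⟩
  rw [Mesh.surf, Mesh.facet, refFace_eq_image h, Set.image_image]
  exact this.2

theorem Mesh.integral_surf (s : M.Side) {i : Fin (m + 1)} (h : refNormal K s.2 i ≠ 0)
    (f : Vec (m + 1) → ℝ) :
    ∫ x, f x ∂(M.surf s) = M.surfFactor s *
      ∫ y in refElem K m, f (M.Φ s.1 (ins i (facetHeight s.2 i y) y)) := by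
  obtain ⟨h1, h2⟩ := M.surf_eq_map s h
  rw [h2, integral_smul_measure, h1.integral_map,
    ENNReal.toReal_ofReal (M.surfFactor_pos s).le, smul_eq_mul]

/-! ### The affine maps of the elements -/

section Affine

variable {d : ℕ} (Φ : Vec d ≃ᵃ[ℝ] Vec d)

/-- The linear part of an affine equivalence as a continuous linear equivalence. -/
def linPart : Vec d ≃L[ℝ] Vec d := Φ.linear.toContinuousLinearEquiv

@[simp] theorem linPart_apply (v : Vec d) : linPart Φ v = Φ.linear v := rfl

@[simp] theorem linPart_symm_apply (v : Vec d) : (linPart Φ).symm v = Φ.linear.symm v := rfl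

theorem affine_apply (x : Vec d) : Φ x = linPart Φ x + Φ 0 := by
  have := Φ.map_vadd 0 x
  simpa using this

theorem affine_symm_apply (x : Vec d) : Φ.symm x = (linPart Φ).symm x + Φ.symm 0 := by
  have := Φ.symm.map_vadd 0 x
  simpa using this

theorem affine_sub (x y : Vec d) : Φ x - Φ y = linPart Φ (x - y) := by
  rw [affine_apply Φ x, affine_apply Φ y, map_sub]; abel

theorem affine_symm_sub (x y : Vec d) : Φ.symm x - Φ.symm y = (linPart Φ).symm (x - y) := by
  rw [affine_symm_apply Φ x, affine_symm_apply Φ y, map_sub]; abel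

theorem hasFDerivAt_affine (x : Vec d) :
    HasFDerivAt Φ (linPart Φ : Vec d →L[ℝ] Vec d) x := by
  have : (Φ : Vec d → Vec d) = fun x => linPart Φ x + Φ 0 := funext (affine_apply Φ)
  rw [this]
  exact (linPart Φ).hasFDerivAt.add_const _

theorem contDiff_affine {n : WithTop ℕ∞} : ContDiff ℝ n Φ := by
  have : (Φ : Vec d → Vec d) = fun x => linPart Φ x + Φ 0 := funext (affine_apply Φ)
  rw [this]
  exact (linPart Φ).contDiff.add contDiff_const

theorem contDiff_affine_symm {n : WithTop ℕ∞} : ContDiff ℝ n Φ.symm := contDiff_affine Φ.symm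

theorem continuous_affine : Continuous Φ := (contDiff_affine Φ (n := 0)).continuous

theorem continuous_affine_symm : Continuous Φ.symm := continuous_affine Φ.symm

/-- An affine equivalence as a homeomorphism. -/
def affineHomeo : Vec d ≃ₜ Vec d where
  toEquiv := Φ.toEquiv
  continuous_toFun := continuous_affine Φ
  continuous_invFun := continuous_affine_symm Φ

theorem setIntegral_affine_image {S : Set (Vec d)} (hS : MeasurableSet S) (f : Vec d → ℝ) :
    ∫ x in Φ '' S, f x = |LinearMap.det (Φ.linear : Vec d →ₗ[ℝ] Vec d)| * ∫ x in S, f (Φ x) := by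
  have := integral_image_eq_integral_abs_det_fderiv_smul volume hS
    (fun x _ => (hasFDerivAt_affine Φ x).hasFDerivWithinAt) Φ.injective.injOn f
  rw [this, ← integral_const_mul]
  rfl

theorem divergence_eq_trace (r : Vec d → Vec d) (x : Vec d) :
    divergence r x = LinearMap.trace ℝ (Vec d) (fderiv ℝ r x : Vec d →ₗ[ℝ] Vec d) := by
  rw [LinearMap.trace_eq_matrix_trace ℝ (EuclideanSpace.basisFun (Fin d) ℝ).toBasis]
  simp [divergence, Matrix.trace, LinearMap.toMatrix_apply]

/-- The derivative of the pulled-back field is conjugate to that of `r` by the linear part of `Φ`,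
and conjugation preserves the trace. -/
theorem divergence_conj (r : Vec d → Vec d) (x : Vec d) (hr : DifferentiableAt ℝ r (Φ x)) :
    divergence (fun y => (linPart Φ).symm (r (Φ y))) x = divergence r (Φ x) := by
  have h1 : HasFDerivAt (fun y => (linPart Φ).symm (r (Φ y)))
      (((linPart Φ).symm : Vec d →L[ℝ] Vec d) ∘L (fderiv ℝ r (Φ x) ∘L
        (linPart Φ : Vec d →L[ℝ] Vec d))) x :=
    ((linPart Φ).symm.hasFDerivAt (x := r (Φ x))).comp x
      (hr.hasFDerivAt.comp x (hasFDerivAt_affine Φ x))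
  rw [divergence_eq_trace, divergence_eq_trace, h1.fderiv]
  exact LinearMap.trace_conj' (fderiv ℝ r (Φ x) : Vec d →ₗ[ℝ] Vec d) Φ.linear.symm

end Affine

/-! ### The divergence theorem and integration by parts -/

theorem divergence_apply {d : ℕ} {r : Vec d → Vec d} {x : Vec d} (hr : DifferentiableAt ℝ r x) :
    divergence r x = ∑ i, fderiv ℝ (fun y => r y i) x (EuclideanSpace.single i 1) := by
  unfold divergence
  refine Finset.sum_congr rfl fun i _ => ?_
  have := ((EuclideanSpace.proj i : Vec d →L[ℝ] ℝ).hasFDerivAt (x := r x)).comp x hr.hasFDerivAt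
  have h2 : fderiv ℝ (fun y => r y i) x = (EuclideanSpace.proj i : Vec d →L[ℝ] ℝ) ∘L fderiv ℝ r x :=
    this.fderiv
  rw [h2]; rfl

theorem continuous_divergence {d : ℕ} {r : Vec d → Vec d} (hr : ContDiff ℝ 1 r) :
    Continuous (divergence r) := by
  unfold divergence
  refine continuous_finsetSum _ fun i _ => ?_
  have : Continuous fun x => fderiv ℝ r x (EuclideanSpace.single i 1) :=
    (hr.continuous_fderiv one_ne_zero).clm_apply continuous_const
  fun_prop

theorem contDiff_coord {d : ℕ} {n : WithTop ℕ∞} {r : Vec d → Vec d} (hr : ContDiff ℝ n r)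
    (i : Fin d) : ContDiff ℝ n (fun x => r x i) :=
  (EuclideanSpace.proj i : Vec d →L[ℝ] ℝ).contDiff.comp hr

/-- The divergence theorem on the reference element. -/
theorem setIntegral_divergence_refElem {K : ElemKind} {m : ℕ} {r : Vec (m + 1) → Vec (m + 1)}
    (hr : ContDiff ℝ 1 r) :
    ∫ x in refElem K (m + 1), divergence r x = ∑ F : RefFacet K (m + 1), ∑ i,
      refNormal K F i * ∫ y in refElem K m, r (ins i (facetHeight F i y) y) i := by
  rw [sum_facets]
  have h1 : ∀ x, divergence r x = ∑ i, fderiv ℝ (fun y => r y i) x (EuclideanSpace.single i 1) :=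
    fun x => divergence_apply (hr.differentiable one_ne_zero x)
  simp only [h1]
  rw [integral_finsetSum]
  · refine Finset.sum_congr rfl fun i _ => ?_
    simp only [facetHeight_topFacet, facetHeight_botFacet]
    exact setIntegral_partial_refElem i (contDiff_coord hr i)
  · intro i _
    refine Continuous.continuousOn ?_ |>.integrableOn_compact (isCompact_refElem K _)
    exact ((contDiff_coord hr i).continuous_fderiv one_ne_zero).clm_apply continuous_const

section Mesh

variable {K : ElemKind} {m : ℕ} {Ω : Set (Vec (m + 1))} (M : Mesh K (m + 1) Ω)

theorem Mesh.setIntegral_elem (T : M.Elem) (f : Vec (m + 1) → ℝ) :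
    ∫ x in M.elem T, f x = |M.det T| * ∫ x in refElem K (m + 1), f (M.Φ T x) :=
  setIntegral_affine_image _ (isClosed_refElem K _).measurableSet f

theorem Mesh.isCompact_elem (T : M.Elem) : IsCompact (M.elem T) :=
  (isCompact_refElem K _).image (continuous_affine _)

theorem Mesh.measurableSet_elem (T : M.Elem) : MeasurableSet (M.elem T) :=
  (M.isCompact_elem T).measurableSet

theorem isCompact_refFace (K : ElemKind) {d : ℕ} (G : Set (RefFacet K d)) :
    IsCompact (refFace K G) := by
  have : refFace K G = refElem K d ∩ ⋂ F ∈ G, {x | inner ℝ (refNormal K F) x = refOffset K F} := by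
    ext x; simp [refFace]
  rw [this]
  refine (isCompact_refElem K d).inter_right (isClosed_biInter fun F _ => isClosed_eq ?_ ?_) <;>
    fun_prop

theorem Mesh.isCompact_facet (s : M.Side) : IsCompact (M.facet s) :=
  (isCompact_refFace K _).image (continuous_affine _)

theorem exists_refNormal_ne {K : ElemKind} {m : ℕ} (F : RefFacet K (m + 1)) :
    ∃ i, refNormal K F i ≠ 0 := by
  by_contra h
  push Not at h
  exact refNormal_ne_zero F (by ext i; simpa using h i)

instance (s : M.Side) : IsFiniteMeasure (M.surf s) := by
  obtain ⟨i, hi⟩ := exists_refNormal_ne s.2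
  rw [(M.surf_eq_map s hi).2]
  have : IsFiniteMeasure (volume.restrict (refElem K m)) :=
    ⟨by simpa using (isCompact_refElem K m).measure_lt_top⟩
  exact Measure.smul_finite _ ENNReal.ofReal_ne_top

theorem Mesh.integrable_surf (s : M.Side) {f : Vec (m + 1) → ℝ} (hf : Continuous f) :
    Integrable f (M.surf s) := by
  have hfin : μHE[m] (M.facet s) < ⊤ := by
    have := measure_lt_top (M.surf s) Set.univ
    rw [Mesh.surf, Measure.restrict_apply_univ] at this
    exact this
  exact hf.continuousOn.integrableOn_of_subset_isCompact (M.isCompact_facet s)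
    (M.isCompact_facet s).measurableSet subset_rfl hfin.ne

theorem Mesh.integrableOn_elem (T : M.Elem) {f : Vec (m + 1) → ℝ} (hf : Continuous f) :
    IntegrableOn f (M.elem T) :=
  hf.continuousOn.integrableOn_compact (M.isCompact_elem T)

theorem Mesh.inner_normal (s : M.Side) (v : Vec (m + 1)) :
    inner ℝ v (M.normal s) =
      ‖M.conormal s‖⁻¹ * inner ℝ (refNormal K s.2) ((M.Φ s.1).linear.symm v) := by
  rw [M.normal_eq, inner_smul_right, real_inner_comm, M.inner_conormal]

/-- The divergence theorem on an element. -/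
theorem Mesh.setIntegral_divergence (T : M.Elem) {r : Vec (m + 1) → Vec (m + 1)}
    (hr : ContDiff ℝ 1 r) :
    ∫ x in M.elem T, divergence r x =
      ∑ F : RefFacet K (m + 1), ∫ x, inner ℝ (r x) (M.normal (T, F)) ∂(M.surf (T, F)) := by
  -- Up to the factor `det`, this is the inverse Piola transform of `r`: it has the same divergence,
  -- and its components along the reference normals give those of `r` along the conormals.
  set G : Vec (m + 1) → Vec (m + 1) := fun y => (linPart (M.Φ T)).symm (r (M.Φ T y)) with hG
  have hGc : ContDiff ℝ 1 G :=
    (linPart (M.Φ T)).symm.contDiff.comp (hr.comp (contDiff_affine _))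
  rw [M.setIntegral_elem]
  have h1 : ∀ x, divergence r (M.Φ T x) = divergence G x := fun x =>
    (divergence_conj (M.Φ T) r x (hr.differentiable one_ne_zero _)).symm
  simp only [h1]
  rw [setIntegral_divergence_refElem hGc, Finset.mul_sum]
  refine Finset.sum_congr rfl fun F _ => ?_
  have h2 : ∀ x, inner ℝ (r x) (M.normal (T, F)) =
      ∑ i, ‖M.conormal (T, F)‖⁻¹ * (refNormal K F i * G ((M.Φ T).symm x) i) := by
    intro x
    rw [M.inner_normal, PiLp.inner_apply, Finset.mul_sum]
    refine Finset.sum_congr rfl fun i _ => ?_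
    simp [hG, mul_comm]
  simp only [h2]
  rw [integral_finsetSum, Finset.mul_sum]
  · refine Finset.sum_congr rfl fun i _ => ?_
    -- A vanishing component contributes nothing. For any other component the facet is a graph over
    -- the remaining coordinates; the norm of the conormal in the surface factor cancels the
    -- normalization, and `|det|` remains.
    by_cases hi : refNormal K F i = 0
    · simp [hi]
    · rw [M.integral_surf (T, F) hi]
      simp only [AffineEquiv.symm_apply_apply]
      rw [integral_const_mul, integral_const_mul, Mesh.surfFactor]
      have := (M.norm_conormal_pos (T, F)).ne'
      field_simp
  · intro i _
    refine M.integrable_surf _ ?_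
    have := (hGc.continuous).comp (continuous_affine_symm (M.Φ T))
    have : Continuous fun x => G ((M.Φ T).symm x) i :=
      (EuclideanSpace.proj i : Vec (m + 1) →L[ℝ] ℝ).continuous.comp this
    exact continuous_const.mul (continuous_const.mul this)

theorem inner_gradient {d : ℕ} {v : Vec d → ℝ} {x : Vec d} (w : Vec d) :
    inner ℝ w (gradient v x) = fderiv ℝ v x w := by
  rw [real_inner_comm, gradient, InnerProductSpace.toDual_symm_apply]

theorem divergence_smul {d : ℕ} {v : Vec d → ℝ} {r : Vec d → Vec d} {x : Vec d}
    (hv : DifferentiableAt ℝ v x) (hr : DifferentiableAt ℝ r x) :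
    divergence (fun y => v y • r y) x = divergence r x * v x + inner ℝ (r x) (gradient v x) := by
  have h := (hv.hasFDerivAt.smul hr.hasFDerivAt).fderiv
  have h' : fderiv ℝ (fun y => v y • r y) x = _ := h
  unfold divergence
  rw [h', Finset.sum_mul, inner_gradient]
  have hrx : r x = ∑ i, r x i • EuclideanSpace.single i (1 : ℝ) := by
    have := (EuclideanSpace.basisFun (Fin d) ℝ).sum_repr (r x)
    simpa using this.symm
  conv_rhs => rw [hrx, map_sum, ← Finset.sum_add_distrib]
  refine Finset.sum_congr rfl fun i _ => ?_
  simp only [add_apply, smul_apply, PiLp.add_apply,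
    PiLp.smul_apply, ContinuousLinearMap.smulRight_apply, smul_eq_mul, map_smul]
  ring

theorem continuous_gradient {d : ℕ} {v : Vec d → ℝ} (hv : ContDiff ℝ 1 v) :
    Continuous (gradient v) :=
  (InnerProductSpace.toDual ℝ (Vec d)).symm.continuous.comp (hv.continuous_fderiv one_ne_zero)

/-- Integration by parts on an element. -/
theorem Mesh.setIntegral_divergence_mul (T : M.Elem) {r : Vec (m + 1) → Vec (m + 1)}
    {v : Vec (m + 1) → ℝ} (hr : ContDiff ℝ 1 r) (hv : ContDiff ℝ 1 v) :
    ∫ x in M.elem T, divergence r x * v x =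
      - (∫ x in M.elem T, inner ℝ (r x) (gradient v x)) +
      ∑ F : RefFacet K (m + 1), ∫ x, v x * inner ℝ (r x) (M.normal (T, F)) ∂(M.surf (T, F)) := by
  have h := M.setIntegral_divergence T (r := fun y => v y • r y) (hv.smul hr)
  have h1 : ∀ x, divergence (fun y => v y • r y) x =
      divergence r x * v x + inner ℝ (r x) (gradient v x) := fun x =>
    divergence_smul (hv.differentiable one_ne_zero x) (hr.differentiable one_ne_zero x)
  simp only [h1, real_inner_smul_left] at h
  rw [integral_add] at h
  · linarith
  · exact M.integrableOn_elem T ((continuous_divergence hr).mul hv.continuous)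
  · exact M.integrableOn_elem T (hr.continuous.inner (continuous_gradient hv))

end Mesh

/-! ### Polynomial spaces -/

/-- The admissible exponents of the monomials in `𝒫_p`. -/
def admissible (K : ElemKind) (d p : ℕ) : Set (Fin d →₀ ℕ) :=
  match K with
  | .simplex => {n | (n.sum fun _ e => e) ≤ p}
  | .cube => {n | ∀ i, n i ≤ p}

theorem polySpace_eq (K : ElemKind) (d p : ℕ) :
    polySpace K d p = (MvPolynomial.restrictSupport ℝ (admissible K d p)).map (evalLin d) := by
  cases K <;> rfl

theorem mem_polySpace {K : ElemKind} {d p : ℕ} {φ : Vec d → ℝ} :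
    φ ∈ polySpace K d p ↔
      ∃ P : MvPolynomial (Fin d) ℝ, (∀ s ∈ P.support, s ∈ admissible K d p) ∧ evalLin d P = φ := by
  rw [polySpace_eq, Submodule.mem_map]
  simp only [MvPolynomial.mem_restrictSupport_iff]
  rfl

instance (K : ElemKind) (d p : ℕ) : FiniteDimensional ℝ (polySpace K d p) := by
  cases K
  · exact inferInstanceAs (FiniteDimensional ℝ
      ((MvPolynomial.restrictTotalDegree (Fin d) ℝ p).map (evalLin d)))
  · exact inferInstanceAs (FiniteDimensional ℝ
      ((MvPolynomial.restrictDegree (Fin d) ℝ p).map (evalLin d)))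

theorem evalLin_apply {d : ℕ} (P : MvPolynomial (Fin d) ℝ) (x : Vec d) :
    evalLin d P x = MvPolynomial.eval (fun i => x i) P := rfl

theorem evalLin_mul {d : ℕ} (P Q : MvPolynomial (Fin d) ℝ) :
    evalLin d (P * Q) = fun x => evalLin d P x * evalLin d Q x := by
  ext x; simp [evalLin_apply]

theorem evalLin_X {d : ℕ} (i : Fin d) : evalLin d (MvPolynomial.X i) = fun x => x i := by
  ext x; simp [evalLin_apply]

theorem evalLin_C {d : ℕ} (c : ℝ) : evalLin d (MvPolynomial.C c) = fun _ => c := by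
  ext x; simp [evalLin_apply]

theorem contDiff_apply_coord {d : ℕ} {n : WithTop ℕ∞} (i : Fin d) :
    ContDiff ℝ n (fun x : Vec d => x i) :=
  contDiff_coord contDiff_id i

theorem contDiff_evalLin {d : ℕ} {n : WithTop ℕ∞} (P : MvPolynomial (Fin d) ℝ) :
    ContDiff ℝ n (evalLin d P) := by
  induction P using MvPolynomial.induction_on with
  | C a => rw [evalLin_C]; exact contDiff_const
  | add P Q hP hQ => rw [map_add]; exact hP.add hQ
  | mul_X P i hP =>
    rw [evalLin_mul, evalLin_X]
    exact hP.mul (contDiff_apply_coord i)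

theorem fderiv_evalLin {d : ℕ} (P : MvPolynomial (Fin d) ℝ) (x : Vec d) (i : Fin d) :
    fderiv ℝ (evalLin d P) x (EuclideanSpace.single i 1) =
      evalLin d (MvPolynomial.pderiv i P) x := by
  have hd : ∀ P, DifferentiableAt ℝ (evalLin d P) x := fun P =>
    (contDiff_evalLin (n := 1) P).differentiable one_ne_zero x
  induction P using MvPolynomial.induction_on with
  | C a => rw [evalLin_C]; simp
  | add P Q hP hQ =>
    rw [map_add, map_add, map_add, fderiv_add (hd P) (hd Q), add_apply, hP, hQ]; rfl
  | mul_X P j hP =>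
    have h1 : HasFDerivAt (fun y : Vec d => y j) (EuclideanSpace.proj j : Vec d →L[ℝ] ℝ) x :=
      (EuclideanSpace.proj j : Vec d →L[ℝ] ℝ).hasFDerivAt
    have h2 := ((hd P).hasFDerivAt.mul h1).fderiv
    rw [evalLin_mul, evalLin_X, show (fun x : Vec d => evalLin d P x * x j) =
      evalLin d P * (fun y : Vec d => y j) from rfl, h2, MvPolynomial.pderiv_mul, map_add,
      MvPolynomial.pderiv_X]
    simp only [add_apply, smul_apply, hP, Pi.add_apply, evalLin_mul, evalLin_X, smul_eq_mul,
      PiLp.proj_apply]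
    by_cases hij : j = i
    · subst hij; simp [evalLin_apply]; ring
    · simp [hij, evalLin_apply]; ring

theorem polySpace_contDiff {K : ElemKind} {d p : ℕ} {n : WithTop ℕ∞} {φ : Vec d → ℝ}
    (h : φ ∈ polySpace K d p) : ContDiff ℝ n φ := by
  obtain ⟨P, -, rfl⟩ := mem_polySpace.1 h
  exact contDiff_evalLin P

theorem mul_mem_polySpace {K : ElemKind} {d p q : ℕ} {φ ψ : Vec d → ℝ}
    (hφ : φ ∈ polySpace K d p) (hψ : ψ ∈ polySpace K d q) :
    (fun x => φ x * ψ x) ∈ polySpace K d (p + q) := by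
  obtain ⟨P, hP, rfl⟩ := mem_polySpace.1 hφ
  obtain ⟨Q, hQ, rfl⟩ := mem_polySpace.1 hψ
  refine mem_polySpace.2 ⟨P * Q, fun s hs => ?_, evalLin_mul P Q⟩
  obtain ⟨a, ha, b, hb, rfl⟩ := Finset.mem_add.1 (MvPolynomial.support_mul P Q hs)
  have h1 := hP a ha
  have h2 := hQ b hb
  cases K
  · change (Finsupp.sum _ fun _ e => e) ≤ p at h1
    change (Finsupp.sum _ fun _ e => e) ≤ q at h2
    change (Finsupp.sum _ fun _ e => e) ≤ p + q
    rw [Finsupp.sum_add_index' (by simp) (by simp)]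
    omega
  · intro i
    exact Nat.add_le_add (h1 i) (h2 i)

/-- `xᵢ ∂ᵢ` maps `𝒫_p` into itself. -/
theorem euler_mem_polySpace {K : ElemKind} {d p : ℕ} {φ : Vec d → ℝ}
    (hφ : φ ∈ polySpace K d p) (i : Fin d) :
    (fun x => x i * gradient φ x i) ∈ polySpace K d p := by
  obtain ⟨P, hP, rfl⟩ := mem_polySpace.1 hφ
  refine mem_polySpace.2 ⟨MvPolynomial.X i * MvPolynomial.pderiv i P, fun s hs => hP s ?_, ?_⟩
  -- The Euler operator multiplies each coefficient by an exponent, so no new monomial appears.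
  · rw [MvPolynomial.mem_support_iff] at hs ⊢
    rw [MvPolynomial.coeff_X_mul'] at hs
    split_ifs at hs with h
    · rw [MvPolynomial.coeff_pderiv] at hs
      intro h0
      apply hs
      have : s - Finsupp.single i 1 + Finsupp.single i 1 = s := by
        refine tsub_add_cancel_of_le ?_
        rw [Finsupp.single_le_iff]
        exact Nat.one_le_iff_ne_zero.2 (Finsupp.mem_support_iff.1 h)
      rw [this, h0]; simp
    · exact absurd rfl hs
  · rw [evalLin_mul, evalLin_X]
    ext x
    have : gradient (evalLin d P) x i = fderiv ℝ (evalLin d P) x (EuclideanSpace.single i 1) := by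
      rw [← inner_gradient, EuclideanSpace.inner_single_left]; simp
    rw [this, fderiv_evalLin]

/-- A polynomial that vanishes near a point is zero. -/
theorem evalLin_eq_zero {d : ℕ} (P : MvPolynomial (Fin d) ℝ) {c : Vec d}
    (h : ∀ᶠ x in 𝓝 c, evalLin d P x = 0) : evalLin d P = 0 := by
  have h1 : ∀ᶠ y in 𝓝 (WithLp.ofLp c), evalLin d P (WithLp.toLp 2 y) = 0 :=
    ((PiLp.continuous_toLp 2 (fun _ : Fin d => ℝ)).tendsto _).eventually h
  obtain ⟨ε, hε, hball⟩ := Metric.eventually_nhds_iff_ball.1 h1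
  have hP : P = 0 := by
    refine MvPolynomial.funext_set (fun i => Metric.ball (c i) ε)
      (fun i => infinite_of_mem_nhds (c i) (Metric.ball_mem_nhds _ hε)) fun x hx => ?_
    rw [← ball_pi _ hε] at hx
    simpa [evalLin_apply] using hball x hx
  rw [hP, map_zero]

theorem polySpace_eq_zero {K : ElemKind} {d p : ℕ} {φ : Vec d → ℝ}
    (hφ : φ ∈ polySpace K d p) {c : Vec d} (h : ∀ᶠ x in 𝓝 c, φ x = 0) : φ = 0 := by
  obtain ⟨P, -, rfl⟩ := mem_polySpace.1 hφ
  exact evalLin_eq_zero P h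

/-- Substitution in `𝒫_p`. -/
theorem subst_mem_polySpace {K : ElemKind} {d p : ℕ} {φ : Vec d → ℝ} (hφ : φ ∈ polySpace K d p)
    (q : Fin d → MvPolynomial (Fin d) ℝ)
    (hq : ∀ s ∈ admissible K d p, ∀ u ∈ (∏ j, q j ^ s j).support, u ∈ admissible K d p) :
    (fun x => φ (WithLp.toLp 2 fun j => evalLin d (q j) x)) ∈ polySpace K d p := by
  obtain ⟨P, hP, rfl⟩ := mem_polySpace.1 hφ
  have h1 : (fun x : Vec d => evalLin d P (WithLp.toLp 2 fun j => evalLin d (q j) x)) =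
      ∑ s ∈ P.support, P.coeff s • evalLin d (∏ j, q j ^ s j) := by
    ext x
    rw [evalLin_apply, MvPolynomial.eval_eq', Finset.sum_apply]
    refine Finset.sum_congr rfl fun s _ => ?_
    simp [evalLin_apply, map_prod]
  rw [h1]
  refine Submodule.sum_mem _ fun s hs => Submodule.smul_mem _ _ ?_
  exact mem_polySpace.2 ⟨_, hq s (hP s hs), rfl⟩

/-! ### Raviart--Thomas fields on the reference element -/

theorem refRT_contDiff {K : ElemKind} {d p : ℕ} {n : WithTop ℕ∞} {r : Vec d → Vec d}
    (h : r ∈ refRT K d p) : ContDiff ℝ n r := by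
  rw [contDiff_euclidean]
  intro i
  cases K
  · obtain ⟨a, b, ha, hb, hr⟩ := h
    simp only [hr]
    exact (polySpace_contDiff (ha i)).add ((contDiff_apply_coord i).mul (polySpace_contDiff hb))
  · obtain ⟨a, b, ha, hb, hr⟩ := h
    simp only [hr]
    exact (polySpace_contDiff (ha i)).add ((contDiff_apply_coord i).mul (polySpace_contDiff (hb i)))

theorem refRT_eq_zero {K : ElemKind} {d p : ℕ} {r : Vec d → Vec d} (h : r ∈ refRT K d p)
    {c : Vec d} (h0 : ∀ᶠ x in 𝓝 c, r x = 0) : r = 0 := by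
  have key : ∀ i, ∃ P, (fun x => r x i) = evalLin d P := by
    intro i
    cases K
    · obtain ⟨a, b, ha, hb, hr⟩ := h
      obtain ⟨P, -, hP⟩ := mem_polySpace.1 (ha i)
      obtain ⟨Q, -, hQ⟩ := mem_polySpace.1 hb
      refine ⟨P + MvPolynomial.X i * Q, ?_⟩
      rw [map_add, evalLin_mul, evalLin_X, hP, hQ]
      exact funext fun x => hr x i
    · obtain ⟨a, b, ha, hb, hr⟩ := h
      obtain ⟨P, -, hP⟩ := mem_polySpace.1 (ha i)
      obtain ⟨Q, -, hQ⟩ := mem_polySpace.1 (hb i)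
      refine ⟨P + MvPolynomial.X i * Q, ?_⟩
      rw [map_add, evalLin_mul, evalLin_X, hP, hQ]
      exact funext fun x => hr x i
  ext x i
  obtain ⟨P, hP⟩ := key i
  have h1 := evalLin_eq_zero P (c := c) (by
    rw [← hP]
    filter_upwards [h0] with y hy
    simp [hy])
  rw [← hP] at h1
  simpa using congrFun h1 x

/-- The Raviart--Thomas space as a submodule. -/
def refRTSub (K : ElemKind) (d p : ℕ) : Submodule ℝ (Vec d → Vec d) where
  carrier := refRT K d p
  add_mem' := by
    intro r r' h h'
    cases K
    · obtain ⟨a, b, ha, hb, hr⟩ := h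
      obtain ⟨a', b', ha', hb', hr'⟩ := h'
      refine ⟨a + a', b + b', fun i => add_mem (ha i) (ha' i), add_mem hb hb', fun x i => ?_⟩
      simp only [Pi.add_apply, PiLp.add_apply, hr, hr']; ring
    · obtain ⟨a, b, ha, hb, hr⟩ := h
      obtain ⟨a', b', ha', hb', hr'⟩ := h'
      refine ⟨a + a', b + b', fun i => add_mem (ha i) (ha' i), fun i => add_mem (hb i) (hb' i),
        fun x i => ?_⟩
      simp only [Pi.add_apply, PiLp.add_apply, hr, hr']; ring
  zero_mem' := by
    cases K
    · exact ⟨0, 0, fun i => zero_mem _, zero_mem _, fun x i => by simp⟩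
    · exact ⟨0, 0, fun i => zero_mem _, fun i => zero_mem _, fun x i => by simp⟩
  smul_mem' := by
    intro c r h
    cases K
    · obtain ⟨a, b, ha, hb, hr⟩ := h
      refine ⟨c • a, c • b, fun i => Submodule.smul_mem _ c (ha i), Submodule.smul_mem _ c hb,
        fun x i => ?_⟩
      simp only [Pi.smul_apply, PiLp.smul_apply, hr, smul_eq_mul]; ring
    · obtain ⟨a, b, ha, hb, hr⟩ := h
      refine ⟨c • a, c • b, fun i => Submodule.smul_mem _ c (ha i),
        fun i => Submodule.smul_mem _ c (hb i), fun x i => ?_⟩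
      simp only [Pi.smul_apply, PiLp.smul_apply, hr, smul_eq_mul]; ring

theorem mem_refRTSub {K : ElemKind} {d p : ℕ} {r : Vec d → Vec d} :
    r ∈ refRTSub K d p ↔ r ∈ refRT K d p := Iff.rfl

/-- The field with components `aᵢ + xᵢ bᵢ`. -/
def rtMap (K : ElemKind) (d p : ℕ) :
    ((Fin d → polySpace K d p) × (Fin d → polySpace K d p)) →ₗ[ℝ] (Vec d → Vec d) where
  toFun ab x := WithLp.toLp 2 fun i => (ab.1 i : Vec d → ℝ) x + x i * (ab.2 i : Vec d → ℝ) x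
  map_add' _ _ := by ext; simp; ring
  map_smul' _ _ := by ext; simp; ring

instance (K : ElemKind) (d p : ℕ) : FiniteDimensional ℝ (refRTSub K d p) := by
  have : refRTSub K d p ≤ LinearMap.range (rtMap K d p) := by
    intro r h
    rw [mem_refRTSub] at h
    cases K
    · obtain ⟨a, b, ha, hb, hr⟩ := h
      exact ⟨(fun i => ⟨a i, ha i⟩, fun _ => ⟨b, hb⟩), by ext x i; simp [rtMap, hr]⟩
    · obtain ⟨a, b, ha, hb, hr⟩ := h
      exact ⟨(fun i => ⟨a i, ha i⟩, fun i => ⟨b i, hb i⟩), by ext x i; simp [rtMap, hr]⟩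
  exact Submodule.finiteDimensional_of_le this

/-- On a facet, the normal component of a Raviart--Thomas field belongs to `𝒫_p`. -/
theorem refRT_normal_trace {K : ElemKind} {d p : ℕ} {r : Vec d → Vec d} (h : r ∈ refRT K d p)
    (F : RefFacet K d) : ∃ φ ∈ polySpace K d p, ∀ x,
      inner ℝ (refNormal K F) x = refOffset K F → inner ℝ (refNormal K F) (r x) = φ x := by
  cases K
  · obtain ⟨a, b, ha, hb, hr⟩ := h
    rcases F with _ | i
    -- On this facet `∑ xᵢ = 1`, so the part `x b`, of degree `p + 1`, contributes only `b`.
    · refine ⟨∑ i, a i + b, add_mem (Submodule.sum_mem _ fun i _ => ha i) hb, fun x hx => ?_⟩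
      rw [inner_refNormal_simplex_none] at hx ⊢
      simp only [hr, Pi.add_apply, Finset.sum_apply, Finset.sum_add_distrib, ← Finset.sum_mul, hx]
      simp [refOffset]
    · refine ⟨-a i, neg_mem (ha i), fun x hx => ?_⟩
      rw [inner_refNormal_simplex_some] at hx ⊢
      have hx' : x i = 0 := by simpa [refOffset] using hx
      simp [hr, hx']
  · obtain ⟨a, b, ha, hb, hr⟩ := h
    rcases F with ⟨i, _ | _⟩
    · refine ⟨-a i, neg_mem (ha i), fun x hx => ?_⟩
      rw [inner_refNormal_cube_false] at hx ⊢
      have hx' : x i = 0 := by simpa [refOffset] using hx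
      simp [hr, hx']
    · refine ⟨a i + b i, add_mem (ha i) (hb i), fun x hx => ?_⟩
      rw [inner_refNormal_cube_true] at hx ⊢
      have hx' : x i = 1 := by simpa [refOffset] using hx
      simp [hr, hx']

/-- The affine field with normal component `1` on the facet `F` and `0` on the other facets. -/
def rtLift {d : ℕ} : (K : ElemKind) → RefFacet K d → Vec d → Vec d
  | .simplex, none, x => x
  | .simplex, some i, x => x - EuclideanSpace.single i 1
  | .cube, (i, true), x => x i • EuclideanSpace.single i 1
  | .cube, (i, false), x => (x i - 1) • EuclideanSpace.single i 1

theorem continuous_rtLift {K : ElemKind} {d : ℕ} (F : RefFacet K d) :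
    Continuous (rtLift K F) := by
  cases K
  · rcases F with _ | i
    · exact continuous_id
    · exact continuous_id.sub continuous_const
  · rcases F with ⟨i, _ | _⟩
    · have : Continuous fun x : Vec d => x i - 1 := by fun_prop
      exact this.smul continuous_const
    · have : Continuous fun x : Vec d => x i := by fun_prop
      exact this.smul continuous_const

theorem rtLift_mem {K : ElemKind} {d p : ℕ} (F : RefFacet K d) {φ : Vec d → ℝ}
    (hφ : φ ∈ polySpace K d p) : (fun x => φ x • rtLift K F x) ∈ refRT K d p := by
  cases K
  · rcases F with _ | i
    · exact ⟨0, φ, fun i => zero_mem _, hφ, fun x j => by simp [rtLift, mul_comm]⟩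
    · classical
      refine ⟨fun j => if j = i then -φ else 0, φ, fun j => ?_, hφ, fun x j => ?_⟩
      · dsimp only
        split_ifs
        exacts [neg_mem hφ, zero_mem _]
      · by_cases h : j = i
        · subst h; simp [rtLift]; ring
        · simp [rtLift, h]; ring
  · rcases F with ⟨i, _ | _⟩
    · classical
      refine ⟨fun j => if j = i then -φ else 0, fun j => if j = i then φ else 0, fun j => ?_,
        fun j => ?_, fun x j => ?_⟩
      · dsimp only
        split_ifs
        exacts [neg_mem hφ, zero_mem _]
      · dsimp only
        split_ifs
        exacts [hφ, zero_mem _]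
      · by_cases h : j = i
        · subst h; simp [rtLift]; ring
        · simp [rtLift, h]
    · classical
      refine ⟨0, fun j => if j = i then φ else 0, fun j => zero_mem _,
        fun j => ?_, fun x j => ?_⟩
      · dsimp only
        split_ifs
        exacts [hφ, zero_mem _]
      · by_cases h : j = i
        · subst h; simp [rtLift]; ring
        · simp [rtLift, h]

theorem inner_rtLift_same {K : ElemKind} {d : ℕ} (F : RefFacet K d) {x : Vec d}
    (hx : inner ℝ (refNormal K F) x = refOffset K F) :
    inner ℝ (refNormal K F) (rtLift K F x) = 1 := by
  cases K
  · rcases F with _ | i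
    · rw [rtLift, hx]; rfl
    · rw [inner_refNormal_simplex_some] at *
      have hx' : x i = 0 := by simpa [refOffset] using hx
      simp [rtLift, hx']
  · rcases F with ⟨i, _ | _⟩
    · rw [inner_refNormal_cube_false] at *
      have hx' : x i = 0 := by simpa [refOffset] using hx
      simp [rtLift, hx']
    · rw [inner_refNormal_cube_true] at *
      have hx' : x i = 1 := by simpa [refOffset] using hx
      simp [rtLift, hx']

theorem inner_rtLift_other {K : ElemKind} {d : ℕ} {F F' : RefFacet K d} (hF : F' ≠ F) {x : Vec d}
    (hx : inner ℝ (refNormal K F') x = refOffset K F') :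
    inner ℝ (refNormal K F') (rtLift K F x) = 0 := by
  cases K
  · rcases F' with _ | j
    · rcases F with _ | i
      · exact absurd rfl hF
      · rw [inner_refNormal_simplex_none] at *
        simp only [refOffset] at hx
        simp [rtLift, Finset.sum_sub_distrib, hx]
    · rw [inner_refNormal_simplex_some] at *
      have hx' : x j = 0 := by simpa [refOffset] using hx
      rcases F with _ | i
      · simp [rtLift, hx']
      · have : j ≠ i := fun h => hF (by rw [h])
        simp [rtLift, hx', this]
  · rcases F' with ⟨j, _ | _⟩
    · rw [inner_refNormal_cube_false] at *
      have hx' : x j = 0 := by simpa [refOffset] using hx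
      rcases F with ⟨i, _ | _⟩
      · have : j ≠ i := fun h => hF (by rw [h])
        simp [rtLift, this]
      · by_cases h : j = i
        · subst h; simp [rtLift, hx']
        · simp [rtLift, h]
    · rw [inner_refNormal_cube_true] at *
      have hx' : x j = 1 := by simpa [refOffset] using hx
      rcases F with ⟨i, _ | _⟩
      · by_cases h : j = i
        · subst h; simp [rtLift, hx']
        · simp [rtLift, h]
      · have : j ≠ i := fun h => hF (by rw [h])
        simp [rtLift, this]

/-- The weighted field with vanishing normal component: `diag(x) v - x (x · v)` on the simplex,
`xᵢ (1 - xᵢ) vᵢ` on the cube. -/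
def rtBubble {d : ℕ} (K : ElemKind) (x v : Vec d) : Vec d :=
  match K with
  | .simplex => WithLp.toLp 2 fun i => x i * v i - x i * ∑ j, x j * v j
  | .cube => WithLp.toLp 2 fun i => x i * v i - x i * (x i * v i)

/-- The weight combines a derivative `∂ᵢ φ` with its own coordinate `xᵢ` first, and `xᵢ ∂ᵢ φ` stays
in `𝒫_p`. What remains is at most one further factor `xᵢ`, of the kind that the Raviart–Thomas space
admits. -/
theorem rtBubble_mem {K : ElemKind} {d p : ℕ} {φ : Vec d → ℝ} (hφ : φ ∈ polySpace K d p) :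
    (fun x => rtBubble K x (gradient φ x)) ∈ refRT K d p := by
  have h := fun i => euler_mem_polySpace hφ i
  cases K
  · refine ⟨fun i x => x i * gradient φ x i, -∑ j, fun x => x j * gradient φ x j, h,
      neg_mem (Submodule.sum_mem _ fun j _ => h j), fun x i => ?_⟩
    simp [rtBubble, sub_eq_add_neg]
  · refine ⟨fun i x => x i * gradient φ x i, fun i => -fun x => x i * gradient φ x i, h,
      fun i => neg_mem (h i), fun x i => ?_⟩
    simp [rtBubble, sub_eq_add_neg]

theorem inner_rtBubble_normal {K : ElemKind} {d : ℕ} {F : RefFacet K d} {x : Vec d}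
    (hx : inner ℝ (refNormal K F) x = refOffset K F) (v : Vec d) :
    inner ℝ (refNormal K F) (rtBubble K x v) = 0 := by
  cases K
  · rcases F with _ | j
    · rw [inner_refNormal_simplex_none] at *
      simp only [refOffset] at hx
      simp only [rtBubble, Finset.sum_sub_distrib, ← Finset.sum_mul, hx]
      ring
    · rw [inner_refNormal_simplex_some] at *
      have hx' : x j = 0 := by simpa [refOffset] using hx
      simp [rtBubble, hx']
  · rcases F with ⟨i, _ | _⟩
    · rw [inner_refNormal_cube_false] at *
      have hx' : x i = 0 := by simpa [refOffset] using hx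
      simp [rtBubble, hx']
    · rw [inner_refNormal_cube_true] at *
      have hx' : x i = 1 := by simpa [refOffset] using hx
      simp [rtBubble, hx']

theorem rtBubble_add {K : ElemKind} {d : ℕ} (x v w : Vec d) :
    rtBubble K x (v + w) = rtBubble K x v + rtBubble K x w := by
  cases K
  · ext i; simp [rtBubble, mul_add, Finset.sum_add_distrib]; ring
  · ext i; simp [rtBubble]; ring

theorem rtBubble_smul {K : ElemKind} {d : ℕ} (c : ℝ) (x v : Vec d) :
    rtBubble K x (c • v) = c • rtBubble K x v := by
  cases K
  · ext i
    simp only [rtBubble, PiLp.smul_apply, smul_eq_mul]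
    rw [show ∑ j, x j * (c * v j) = c * ∑ j, x j * v j by
      rw [Finset.mul_sum]; exact Finset.sum_congr rfl fun j _ => by ring]
    ring
  · ext i; simp [rtBubble]; ring

/-- The weight matrices `diag(x) - x xᵀ` and `diag(xᵢ (1 - xᵢ))` are symmetric. -/
theorem inner_rtBubble_comm {K : ElemKind} {d : ℕ} (x v w : Vec d) :
    inner ℝ (rtBubble K x v) w = inner ℝ (rtBubble K x w) v := by
  cases K
  · simp only [rtBubble, PiLp.inner_apply, RCLike.inner_apply, conj_trivial, mul_sub,
      Finset.sum_sub_distrib]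
    have h : ∀ a b : Vec d, ∑ i, a i * (x i * ∑ j, x j * b j) =
        (∑ i, x i * a i) * ∑ j, x j * b j := fun a b => by
      rw [Finset.sum_mul]; exact Finset.sum_congr rfl fun i _ => by ring
    rw [h, h, mul_comm (∑ i, x i * w i)]
    congr 1
    exact Finset.sum_congr rfl fun i _ => by ring
  · simp only [rtBubble, PiLp.inner_apply, RCLike.inner_apply, conj_trivial]
    exact Finset.sum_congr rfl fun i _ => by ring

/-- On the simplex this is Cauchy–Schwarz with weights `xᵢ`: `(∑ xᵢ vᵢ)² ≤ (∑ xᵢ) ∑ xᵢ vᵢ²` with `∑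
xᵢ ≤ 1`, and in the interior both `∑ xᵢ < 1` and `xᵢ > 0` are strict. On the cube the weights `xᵢ (1
- xᵢ)` are nonnegative, and positive in the interior. -/
theorem inner_rtBubble_self {K : ElemKind} {d : ℕ} {x : Vec d} (hx : x ∈ refElem K d) (v : Vec d) :
    0 ≤ inner ℝ (rtBubble K x v) v ∧
      ((∀ F : RefFacet K d, inner ℝ (refNormal K F) x < refOffset K F) →
        inner ℝ (rtBubble K x v) v = 0 → v = 0) := by
  cases K
  · have hx' := mem_refElem_simplex.1 hx
    have h1 : inner ℝ (rtBubble .simplex x v) v = ∑ i, x i * v i ^ 2 - (∑ i, x i * v i) ^ 2 := by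
      simp only [rtBubble, PiLp.inner_apply, RCLike.inner_apply, conj_trivial, mul_sub,
        Finset.sum_sub_distrib]
      congr 1
      · exact Finset.sum_congr rfl fun i _ => by ring
      · rw [pow_two, Finset.sum_mul]; exact Finset.sum_congr rfl fun i _ => by ring
    have h2 : (∑ i, x i * v i) ^ 2 ≤ (∑ i, x i) * ∑ i, x i * v i ^ 2 := by
      refine Finset.sum_sq_le_sum_mul_sum_of_sq_le_mul _ (fun i _ => hx'.2 i)
        (fun i _ => mul_nonneg (hx'.2 i) (sq_nonneg _)) fun i _ => le_of_eq (by ring)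
    have h3 : 0 ≤ ∑ i, x i * v i ^ 2 :=
      Finset.sum_nonneg fun i _ => mul_nonneg (hx'.2 i) (sq_nonneg _)
    refine ⟨by rw [h1]; nlinarith [hx'.1], fun hs h0 => ?_⟩
    rw [forall_refFacet_simplex] at hs
    have hs1 := hs.1
    rw [inner_refNormal_simplex_none] at hs1
    simp only [refOffset] at hs1
    have h4 : ∑ i, x i * v i ^ 2 = 0 := by
      rw [h1] at h0
      nlinarith
    rw [Finset.sum_eq_zero_iff_of_nonneg
      (fun i _ => mul_nonneg (hx'.2 i) (sq_nonneg _))] at h4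
    ext i
    have hs2 := hs.2 i
    rw [inner_refNormal_simplex_some] at hs2
    simp only [refOffset] at hs2
    rcases mul_eq_zero.1 (h4 i (Finset.mem_univ i)) with h | h
    · linarith
    · simpa using h
  · have hx' := mem_refElem_cube.1 hx
    have h1 : inner ℝ (rtBubble .cube x v) v = ∑ i, x i * (1 - x i) * v i ^ 2 := by
      simp only [rtBubble, PiLp.inner_apply, RCLike.inner_apply, conj_trivial]
      exact Finset.sum_congr rfl fun i _ => by ring
    have h0 : ∀ i ∈ Finset.univ, 0 ≤ x i * (1 - x i) * v i ^ 2 := fun i _ =>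
      mul_nonneg (mul_nonneg (hx' i).2 (by linarith [(hx' i).1])) (sq_nonneg _)
    refine ⟨by rw [h1]; exact Finset.sum_nonneg h0, fun hs h => ?_⟩
    rw [h1, Finset.sum_eq_zero_iff_of_nonneg h0] at h
    rw [forall_refFacet_cube] at hs
    ext i
    have hs' := hs i
    rw [inner_refNormal_cube_true, inner_refNormal_cube_false] at hs'
    simp only [refOffset] at hs'
    have h3 : 0 < x i * (1 - x i) := mul_pos (by linarith [hs'.2]) (by linarith [hs'.1])
    rcases mul_eq_zero.1 (h i (Finset.mem_univ i)) with h | h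
    · exact absurd h h3.ne'
    · simpa using h

theorem continuous_rtBubble {K : ElemKind} {d : ℕ} {X : Type*} [TopologicalSpace X]
    {x v : X → Vec d} (hx : Continuous x) (hv : Continuous v) :
    Continuous fun t => rtBubble K (x t) (v t) := by
  cases K
  · simp only [rtBubble]; fun_prop
  · simp only [rtBubble]; fun_prop

/-! ### Adjacent sides -/

section Sides

variable {K : ElemKind} {m : ℕ} {Ω : Set (Vec (m + 1))} (M : Mesh K (m + 1) Ω)

theorem mem_refFace_singleton {K : ElemKind} {d : ℕ} {F : RefFacet K d} {x : Vec d} :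
    x ∈ refFace K {F} ↔ x ∈ refElem K d ∧ inner ℝ (refNormal K F) x = refOffset K F := by
  simp [refFace]

theorem Mesh.mem_facet {s : M.Side} {x : Vec (m + 1)} :
    x ∈ M.facet s ↔ (M.Φ s.1).symm x ∈ refElem K (m + 1) ∧
      inner ℝ (refNormal K s.2) ((M.Φ s.1).symm x) = refOffset K s.2 := by
  rw [← mem_refFace_singleton]
  constructor
  · rintro ⟨y, hy, rfl⟩
    simpa using hy
  · intro h
    exact ⟨_, h, by simp⟩

theorem Mesh.mem_elem {T : M.Elem} {x : Vec (m + 1)} :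
    x ∈ M.elem T ↔ (M.Φ T).symm x ∈ refElem K (m + 1) := by
  constructor
  · rintro ⟨y, hy, rfl⟩
    simpa using hy
  · intro h
    exact ⟨_, h, by simp⟩

theorem Mesh.facet_injective {T : M.Elem} {F F' : RefFacet K (m + 1)}
    (h : M.facet (T, F) = M.facet (T, F')) : F = F' := by
  obtain ⟨c, hc, hc'⟩ := exists_facet_center F
  by_contra hne
  have hmem : M.Φ T c ∈ M.facet (T, F) := by
    rw [M.mem_facet]
    simp only [AffineEquiv.symm_apply_apply]
    refine ⟨fun F'' => ?_, hc⟩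
    by_cases h'' : F'' = F
    · rw [h'', hc]
    · exact (hc' F'' h'').le
  rw [h, M.mem_facet] at hmem
  simp only [AffineEquiv.symm_apply_apply] at hmem
  exact (hc' F' (Ne.symm hne)).ne hmem.2

/-- A point in the relative interior of a side, in reference coordinates. -/
theorem eventually_facet_center {F : RefFacet K (m + 1)} {c : Vec (m + 1)}
    (hc' : ∀ F', F' ≠ F → inner ℝ (refNormal K F') c < refOffset K F') (v : Vec (m + 1)) :
    ∀ᶠ ε in 𝓝 (0 : ℝ), ∀ F', F' ≠ F →
      inner ℝ (refNormal K F') (c + ε • v) < refOffset K F' := by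
  rw [eventually_all]
  intro F'
  by_cases h : F' = F
  · exact Eventually.of_forall fun _ h' => absurd h h'
  · have hcont : Continuous fun ε : ℝ => inner ℝ (refNormal K F') (c + ε • v) := by fun_prop
    have := hcont.tendsto 0
    simp only [zero_smul, add_zero] at this
    filter_upwards [this.eventually_lt_const (hc' F' h)] with ε hε _ using hε

theorem Mesh.symm_affine_sub (T : M.Elem) (x y : Vec (m + 1)) :
    (M.Φ T).symm x - (M.Φ T).symm y = (M.Φ T).linear.symm (x - y) := by
  rw [affine_symm_sub]; rfl

/-- From a relative interior point of the facet a small step along a tangential vector of `s` stays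
in the facet. It then also stays in the hyperplane of `t`, so the vector is tangential for `t`. -/
theorem Mesh.conormal_orthogonal {s t : M.Side} (h : M.facet s = M.facet t) {v : Vec (m + 1)}
    (hv : inner ℝ (M.conormal s) v = 0) : inner ℝ (M.conormal t) v = 0 := by
  obtain ⟨c, hc, hc'⟩ := exists_facet_center s.2
  rw [M.inner_conormal] at hv
  have key : ∀ᶠ ε in 𝓝 (0 : ℝ), M.Φ s.1 c + ε • v ∈ M.facet t := by
    filter_upwards [eventually_facet_center hc' ((M.Φ s.1).linear.symm v)] with ε hε
    rw [← h, M.mem_facet]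
    have h1 : (M.Φ s.1).symm (M.Φ s.1 c + ε • v) = c + ε • (M.Φ s.1).linear.symm v := by
      have := M.symm_affine_sub s.1 (M.Φ s.1 c + ε • v) (M.Φ s.1 c)
      rw [AffineEquiv.symm_apply_apply, add_sub_cancel_left, map_smul] at this
      rw [← this]; abel
    rw [h1]
    have h2 : inner ℝ (refNormal K s.2) (c + ε • (M.Φ s.1).linear.symm v) = refOffset K s.2 := by
      rw [inner_add_right, inner_smul_right, hv, hc]; ring
    refine ⟨fun F' => ?_, h2⟩
    by_cases hF : F' = s.2
    · rw [hF, h2]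
    · exact (hε F' hF).le
  have h0 := key.self_of_nhds
  obtain ⟨ε, hε, hε0⟩ := ((eventually_nhdsWithin_of_eventually_nhds key).and
    (self_mem_nhdsWithin (a := (0 : ℝ)) (s := {0}ᶜ))).exists
  rw [M.mem_facet] at hε h0
  rw [zero_smul, add_zero] at h0
  have h3 := M.symm_affine_sub t.1 (M.Φ s.1 c + ε • v) (M.Φ s.1 c)
  rw [add_sub_cancel_left, map_smul] at h3
  have h4 := congrArg (inner ℝ (refNormal K t.2)) h3
  rw [inner_sub_right, hε.2, h0.2, sub_self, inner_smul_right] at h4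
  rw [M.inner_conormal]
  exact (mul_eq_zero.1 h4.symm).resolve_left hε0

theorem Mesh.normal_eq_or_neg {s t : M.Side} (h : M.facet s = M.facet t) :
    M.normal t = M.normal s ∨ M.normal t = - M.normal s := by
  set c := inner ℝ (M.normal t) (M.normal s) with hc
  set v := M.normal t - c • M.normal s with hv
  have hs : inner ℝ (M.normal s) (M.normal s) = (1 : ℝ) := by
    rw [real_inner_self_eq_norm_sq, M.norm_normal]; norm_num
  have ht : inner ℝ (M.normal t) (M.normal t) = (1 : ℝ) := by
    rw [real_inner_self_eq_norm_sq, M.norm_normal]; norm_num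
  have h1 : inner ℝ (M.normal s) v = 0 := by
    rw [hv, inner_sub_right, inner_smul_right, hs, real_inner_comm, ← hc]; ring
  have h2 : inner ℝ (M.normal t) v = 0 := by
    rw [M.normal_eq, real_inner_smul_left] at h1 ⊢
    rw [M.conormal_orthogonal h
      ((mul_eq_zero.1 h1).resolve_left (inv_ne_zero (M.norm_conormal_pos s).ne')), mul_zero]
  have h3 : v = 0 := by
    rw [← inner_self_eq_zero (𝕜 := ℝ)]
    conv_lhs => rw [hv]
    rw [inner_sub_left, real_inner_smul_left, h1, h2]; ring
  have h4 : M.normal t = c • M.normal s := by rwa [hv, sub_eq_zero] at h3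
  have h5 : c * c = 1 := by
    rw [h4, real_inner_smul_left, inner_smul_right, hs] at ht
    linarith
  rcases mul_self_eq_one_iff.1 h5 with h | h
  · left; rw [h4, h, one_smul]
  · right; rw [h4, h, neg_one_smul]

theorem Mesh.strict_subset_interior_elem {T : M.Elem} {x : Vec (m + 1)}
    (h : ∀ F : RefFacet K (m + 1),
      inner ℝ (refNormal K F) ((M.Φ T).symm x) < refOffset K F) : x ∈ interior (M.elem T) := by
  have h1 : IsOpen ((M.Φ T).symm ⁻¹'
      {y | ∀ F : RefFacet K (m + 1), inner ℝ (refNormal K F) y < refOffset K F}) :=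
    (isOpen_strict K (m + 1)).preimage (continuous_affine_symm _)
  refine interior_maximal (fun y hy => ?_) h1 h
  rw [M.mem_elem]
  exact fun F => (hy F).le

/-- With equal normals the two elements would lie on the same side of their facet. A short step from
a relative interior point of the facet towards an interior point of `t.1` would then enter the
interiors of both elements, which are disjoint. -/
theorem Mesh.normal_ne_of_facet_eq {s t : M.Side} (hne : s.1 ≠ t.1)
    (h : M.facet s = M.facet t) : M.normal t ≠ M.normal s := by
  intro hn
  obtain ⟨c, hc, hc'⟩ := exists_facet_center s.2
  obtain ⟨e, he⟩ := exists_strict_refElem K (m + 1)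
  set x₀ := M.Φ s.1 c with hx₀
  set y₀ := M.Φ t.1 e with hy₀
  have hmem : x₀ ∈ M.facet t := by
    rw [← h, M.mem_facet, hx₀, AffineEquiv.symm_apply_apply]
    refine ⟨fun F' => ?_, hc⟩
    by_cases hF : F' = s.2
    · rw [hF, hc]
    · exact (hc' F' hF).le
  rw [M.mem_facet] at hmem
  have hneg : inner ℝ (refNormal K s.2) ((M.Φ s.1).linear.symm (y₀ - x₀)) < 0 := by
    have h1 : inner ℝ (M.conormal t) (y₀ - x₀) < 0 := by
      rw [M.inner_conormal, ← M.symm_affine_sub, inner_sub_right, hmem.2, hy₀,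
        AffineEquiv.symm_apply_apply]
      linarith [he t.2]
    have h2 : inner ℝ (M.normal t) (y₀ - x₀) < 0 := by
      rw [M.normal_eq, real_inner_smul_left]
      exact mul_neg_of_pos_of_neg (inv_pos.2 (M.norm_conormal_pos t)) h1
    rw [hn, M.normal_eq, real_inner_smul_left, M.inner_conormal] at h2
    by_contra h3
    push Not at h3
    exact absurd h2 (not_lt.2 (mul_nonneg (inv_nonneg.2 (norm_nonneg _)) h3))
  have hev := eventually_facet_center hc' ((M.Φ s.1).linear.symm (y₀ - x₀))
  have hev2 : ∀ᶠ ε in 𝓝[>] (0 : ℝ), ε ∈ Set.Ioo (0 : ℝ) 1 := Ioo_mem_nhdsGT one_pos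
  obtain ⟨ε, hε, hε0, hε1⟩ :=
    ((eventually_nhdsWithin_of_eventually_nhds hev).and hev2).exists
  have hs : x₀ + ε • (y₀ - x₀) ∈ interior (M.elem s.1) := by
    refine M.strict_subset_interior_elem fun F => ?_
    have h1 : (M.Φ s.1).symm (x₀ + ε • (y₀ - x₀)) =
        c + ε • (M.Φ s.1).linear.symm (y₀ - x₀) := by
      have := M.symm_affine_sub s.1 (x₀ + ε • (y₀ - x₀)) x₀
      rw [add_sub_cancel_left, map_smul, hx₀, AffineEquiv.symm_apply_apply] at this
      rw [hx₀, ← this]; abel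
    rw [h1]
    by_cases hF : F = s.2
    · rw [hF, inner_add_right, inner_smul_right, hc]
      nlinarith
    · exact hε F hF
  have ht : x₀ + ε • (y₀ - x₀) ∈ interior (M.elem t.1) := by
    refine M.strict_subset_interior_elem fun F => ?_
    have h1 : (M.Φ t.1).symm (x₀ + ε • (y₀ - x₀)) =
        (M.Φ t.1).symm x₀ + ε • (e - (M.Φ t.1).symm x₀) := by
      have h2 := M.symm_affine_sub t.1 (x₀ + ε • (y₀ - x₀)) x₀
      have h3 := M.symm_affine_sub t.1 y₀ x₀
      rw [add_sub_cancel_left, map_smul, ← h3, hy₀, AffineEquiv.symm_apply_apply] at h2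
      rw [hy₀, ← h2]; abel
    rw [h1, inner_add_right, inner_smul_right, inner_sub_right]
    have h4 := hmem.1 F
    have h5 := he F
    nlinarith
  exact Set.disjoint_left.1 (M.disjoint s.1 t.1 hne) hs ht

theorem Mesh.Adj.symm {M : Mesh K (m + 1) Ω} {s t : M.Side} (h : M.Adj s t) : M.Adj t s :=
  ⟨h.1.symm, h.2.symm⟩

theorem Mesh.Adj.normal_eq {M : Mesh K (m + 1) Ω} {s t : M.Side} (h : M.Adj s t) :
    M.normal t = - M.normal s :=
  (M.normal_eq_or_neg h.2).resolve_left (M.normal_ne_of_facet_eq h.1 h.2)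

theorem Mesh.Adj.surf_eq {M : Mesh K (m + 1) Ω} {s t : M.Side} (h : M.Adj s t) :
    M.surf t = M.surf s := by
  rw [Mesh.surf, Mesh.surf, h.2]

/-- Two partners of `s` both have the normal opposite to that of `s`, hence the same normal, which
is impossible for distinct elements; within one element a facet determines its label. -/
theorem Mesh.Adj.unique {M : Mesh K (m + 1) Ω} {s t t' : M.Side} (h : M.Adj s t)
    (h' : M.Adj s t') : t = t' := by
  have hf : M.facet t = M.facet t' := h.2.symm.trans h'.2
  have h1 : t.1 = t'.1 := by
    by_contra hne
    exact M.normal_ne_of_facet_eq hne hf (by rw [h.normal_eq, h'.normal_eq])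
  obtain ⟨T, F⟩ := t
  obtain ⟨T', F'⟩ := t'
  obtain rfl : T = T' := h1
  rw [M.facet_injective hf]

open scoped Classical in
-- A side that is not on the boundary has exactly one partner, so the inner sum over `t` has a
-- single nonzero term.
theorem Mesh.sum_sides (X : M.Side → ℝ) :
    ∑ s, X s = (∑ s, ∑ t, if M.Adj s t then X s else 0) + ∑ s, if M.IsBdry s then X s else 0 := by
  rw [← Finset.sum_add_distrib]
  refine Finset.sum_congr rfl fun s _ => ?_
  by_cases hs : M.IsBdry s
  · rw [if_pos hs, Finset.sum_eq_zero, zero_add]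
    intro t _
    rw [if_neg (hs t)]
  · rw [if_neg hs, add_zero]
    unfold Mesh.IsBdry at hs
    push Not at hs
    obtain ⟨t, ht⟩ := hs
    rw [Finset.sum_eq_single t, if_pos ht]
    · intro t' _ hne
      rw [if_neg fun h' => hne (h'.unique ht)]
    · simp

open scoped Classical in
theorem Mesh.sum_adj_symm (X : M.Side → M.Side → ℝ) :
    (∑ s, ∑ t, if M.Adj s t then X s t else 0) =
      (1 / 2) * ∑ s, ∑ t, if M.Adj s t then X s t + X t s else 0 := by
  have h1 : (∑ s, ∑ t, if M.Adj s t then X s t else 0) =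
      ∑ s, ∑ t, if M.Adj s t then X t s else 0 := by
    rw [Finset.sum_comm]
    refine Finset.sum_congr rfl fun s _ => Finset.sum_congr rfl fun t _ => ?_
    have : M.Adj t s ↔ M.Adj s t := ⟨Mesh.Adj.symm, Mesh.Adj.symm⟩
    simp only [this]
  have h2 : (∑ s, ∑ t, if M.Adj s t then X s t + X t s else 0) =
      (∑ s, ∑ t, if M.Adj s t then X s t else 0) + ∑ s, ∑ t, if M.Adj s t then X t s else 0 := by
    rw [← Finset.sum_add_distrib]
    refine Finset.sum_congr rfl fun s _ => ?_
    rw [← Finset.sum_add_distrib]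
    refine Finset.sum_congr rfl fun t _ => ?_
    split_ifs <;> simp
  rw [h2, ← h1]; ring

end Sides

/-! ### Traces on a common facet -/

theorem affine_coord {d : ℕ} (χ : Vec d ≃ᵃ[ℝ] Vec d) (x : Vec d) (j : Fin d) :
    χ x j = χ 0 j + ∑ i, (linPart χ (EuclideanSpace.single i 1)) j * x i := by
  rw [affine_apply]
  have hx : x = ∑ i, x i • EuclideanSpace.single i (1 : ℝ) := by
    have := (EuclideanSpace.basisFun (Fin d) ℝ).sum_repr x
    simpa using this.symm
  conv_lhs => rw [hx]
  rw [map_sum, PiLp.add_apply, add_comm]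
  congr 1
  simp only [map_smul, WithLp.ofLp_sum, Finset.sum_apply, PiLp.smul_apply, smul_eq_mul, mul_comm]

theorem comp_affine_mem_polySpace_simplex {d p : ℕ} (χ : Vec d ≃ᵃ[ℝ] Vec d) {φ : Vec d → ℝ}
    (hφ : φ ∈ polySpace .simplex d p) : (fun x => φ (χ x)) ∈ polySpace .simplex d p := by
  let q : Fin d → MvPolynomial (Fin d) ℝ := fun j => MvPolynomial.C (χ 0 j) +
    ∑ i, MvPolynomial.C ((linPart χ (EuclideanSpace.single i 1)) j) * MvPolynomial.X i
  have hq1 : ∀ j, (q j).totalDegree ≤ 1 := by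
    intro j
    refine (MvPolynomial.totalDegree_add _ _).trans (max_le (by simp) ?_)
    refine MvPolynomial.totalDegree_finsetSum_le fun i _ => ?_
    refine (MvPolynomial.totalDegree_mul _ _).trans ?_
    simp
  have h := subst_mem_polySpace hφ q fun s hs u hu => ?_
  · convert h using 2 with x
    congr 1
    ext j
    rw [affine_coord]
    simp [q, evalLin_apply]
  · change (u.sum fun _ e => e) ≤ p
    change (s.sum fun _ e => e) ≤ p at hs
    refine (MvPolynomial.le_totalDegree hu).trans ?_
    refine (MvPolynomial.totalDegree_finsetProd _ _).trans (le_trans ?_ hs)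
    rw [Finsupp.sum_fintype _ _ (by simp)]
    refine Finset.sum_le_sum fun j _ => ?_
    refine (MvPolynomial.totalDegree_pow _ _).trans ?_
    nlinarith [hq1 j]

/-- The facet `xᵢ = 1` or `xᵢ = 0` of the cube. -/
def cubeFacet {d : ℕ} (i : Fin d) (b : Bool) : RefFacet .cube d := (i, b)

theorem mem_refFace_cube {d : ℕ} {i₀ : Fin d} {b : Bool} {x : Vec d} :
    x ∈ refFace .cube {cubeFacet i₀ b} ↔
      (∀ i, x i ≤ 1 ∧ 0 ≤ x i) ∧ x i₀ = if b then 1 else 0 := by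
  rw [mem_refFace_singleton (K := .cube), mem_refElem_cube]
  cases b
  · rw [cubeFacet, inner_refNormal_cube_false]; simp [refOffset]
  · rw [cubeFacet, inner_refNormal_cube_true]; simp [refOffset]

/-- An affine map between facets of the cube: the rows of its matrix. -/
theorem cube_facet_rows {d : ℕ} (χ : Vec d ≃ᵃ[ℝ] Vec d) {i₀ j₀ : Fin d} {b b' : Bool}
    (h : ∀ x ∈ refFace .cube {cubeFacet i₀ b},
      χ x ∈ refFace .cube {cubeFacet j₀ b'}) :
    (∀ i, i ≠ i₀ → (linPart χ (EuclideanSpace.single i 1)) j₀ = 0) ∧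
      ∀ j, ∑ i ∈ Finset.univ.erase i₀, |(linPart χ (EuclideanSpace.single i 1)) j| ≤ 1 := by
  have hbb : ∀ b : Bool, (if b then (1 : ℝ) else 0) ≤ 1 ∧ 0 ≤ (if b then (1 : ℝ) else 0) := by
    intro b; cases b <;> simp
  constructor
  · intro i hi
    -- Two points of the facet that differ by the `i`-th unit vector; their images have the same
    -- `j₀`-th coordinate.
    let x : Vec d := WithLp.toLp 2 fun k => if k = i₀ then (if b then 1 else 0) else 0
    let x' : Vec d := WithLp.toLp 2 fun k =>
      if k = i₀ then (if b then 1 else 0) else if k = i then 1 else 0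
    have hx : x ∈ refFace .cube {cubeFacet i₀ b} := by
      rw [mem_refFace_cube]
      refine ⟨fun k => ?_, by simp [x]⟩
      simp only [x]
      split_ifs <;> norm_num
    have hx' : x' ∈ refFace .cube {cubeFacet i₀ b} := by
      rw [mem_refFace_cube]
      refine ⟨fun k => ?_, by simp [x']⟩
      simp only [x']
      split_ifs <;> norm_num
    have h1 := (mem_refFace_cube.1 (h x hx)).2
    have h2 := (mem_refFace_cube.1 (h x' hx')).2
    have h3 : x' - x = EuclideanSpace.single i 1 := by
      ext k
      by_cases hk : k = i₀
      · subst hk; simp [x, x', hi.symm]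
      · simp [x, x', hk]
    have h4 := affine_sub χ x' x
    rw [h3] at h4
    rw [← h4, PiLp.sub_apply, h1, h2, sub_self]
  · intro j
    -- Over the facet, these points maximize and minimize the `j`-th coordinate of the image. The
    -- two values lie in `[0, 1]` and differ by the `ℓ¹` norm of the row without its `i₀`-th entry.
    let x : Vec d := WithLp.toLp 2 fun k => if k = i₀ then (if b then 1 else 0) else
      if 0 ≤ (linPart χ (EuclideanSpace.single k 1)) j then 1 else 0
    let x' : Vec d := WithLp.toLp 2 fun k => if k = i₀ then (if b then 1 else 0) else
      if 0 ≤ (linPart χ (EuclideanSpace.single k 1)) j then 0 else 1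
    have hx : x ∈ refFace .cube {cubeFacet i₀ b} := by
      rw [mem_refFace_cube]
      refine ⟨fun k => ?_, by simp [x]⟩
      simp only [x]
      split_ifs <;> norm_num
    have hx' : x' ∈ refFace .cube {cubeFacet i₀ b} := by
      rw [mem_refFace_cube]
      refine ⟨fun k => ?_, by simp [x']⟩
      simp only [x']
      split_ifs <;> norm_num
    have h1 := (mem_refFace_cube.1 (h x hx)).1 j
    have h2 := (mem_refFace_cube.1 (h x' hx')).1 j
    have h3 : χ x j - χ x' j =
        ∑ i ∈ Finset.univ.erase i₀, |(linPart χ (EuclideanSpace.single i 1)) j| := by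
      rw [affine_coord χ x, affine_coord χ x', add_sub_add_left_eq_sub, ← Finset.sum_sub_distrib,
        ← Finset.add_sum_erase _ _ (Finset.mem_univ i₀)]
      have : (linPart χ (EuclideanSpace.single i₀ 1)) j * x i₀ -
          (linPart χ (EuclideanSpace.single i₀ 1)) j * x' i₀ = 0 := by simp [x, x']
      rw [this, zero_add]
      refine Finset.sum_congr rfl fun i hi => ?_
      have hi' := Finset.ne_of_mem_erase hi
      simp only [x, x', if_neg hi']
      split_ifs with h0
      · rw [abs_of_nonneg h0]; ring
      · rw [abs_of_neg (not_le.1 h0)]; ring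
    linarith [h1.1, h2.2]

/-- A general affine map does not preserve the degree in each variable. Here the tangential blocks
of `χ` and of its inverse have rows of `ℓ¹` norm at most `1`, which forces each tangential variable
to enter at most one tangential coordinate of the image. Hence substitution does not raise the
degree in any variable. -/
theorem comp_affine_mem_polySpace_cube {d p : ℕ} (χ : Vec d ≃ᵃ[ℝ] Vec d) {i₀ j₀ : Fin d}
    {b b' : Bool} (h : ∀ x ∈ refFace .cube {cubeFacet i₀ b},
      χ x ∈ refFace .cube {cubeFacet j₀ b'})
    (h' : ∀ x ∈ refFace .cube {cubeFacet j₀ b'},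
      χ.symm x ∈ refFace .cube {cubeFacet i₀ b})
    {φ : Vec d → ℝ} (hφ : φ ∈ polySpace .cube d p) :
    ∃ φ' ∈ polySpace .cube d p, ∀ x ∈ refFace .cube {cubeFacet i₀ b},
      φ' x = φ (χ x) := by
  obtain ⟨ha, hb⟩ := cube_facet_rows χ h
  obtain ⟨ha', hb'⟩ := cube_facet_rows χ.symm h'
  set L : Fin d → Fin d → ℝ := fun j i => (linPart χ (EuclideanSpace.single i 1)) j with hL
  set L' : Fin d → Fin d → ℝ := fun i j => (linPart χ.symm (EuclideanSpace.single j 1)) i with hL'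
  have hinv : ∀ j, ∑ k, L j k * L' k j = 1 := by
    intro j
    have h1 := affine_coord χ (χ.symm (EuclideanSpace.single j 1)) j
    have h2 := affine_coord χ (χ.symm 0) j
    rw [AffineEquiv.apply_symm_apply] at h1 h2
    have h3 : ∀ k, L' k j = χ.symm (EuclideanSpace.single j 1) k - χ.symm 0 k := by
      intro k
      rw [← PiLp.sub_apply, affine_sub χ.symm, sub_zero]
    simp only [h3, mul_sub, Finset.sum_sub_distrib]
    simp only [PiLp.single_apply, if_true, PiLp.zero_apply] at h1 h2
    linarith
  have hcol : ∀ i j j', i ≠ i₀ → j ≠ j₀ → j' ≠ j₀ → L j i ≠ 0 → L j' i ≠ 0 → j = j' := by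
    have hle : ∀ k j, k ≠ i₀ → j ≠ j₀ → |L' k j| ≤ 1 := fun k j _ hj =>
      (Finset.single_le_sum (f := fun j => |L' k j|) (fun _ _ => abs_nonneg _)
        (Finset.mem_erase.2 ⟨hj, Finset.mem_univ j⟩)).trans (hb' k)
    -- Row `j` of `L` has `ℓ¹` norm at most `1`, the entries of `L'` have modulus at most `1`, and
    -- yet the products sum to `1`. So there is equality in every term.
    have hone : ∀ i j, i ≠ i₀ → j ≠ j₀ → L j i ≠ 0 → |L' i j| = 1 := by
      intro i j hi hj hne
      have h1 := hinv j
      rw [← Finset.add_sum_erase _ _ (Finset.mem_univ i₀), show L' i₀ j = 0 from ha' j hj, mul_zero,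
        zero_add] at h1
      have h2 : ∀ k ∈ Finset.univ.erase i₀, 0 ≤ |L j k| * (1 - |L' k j|) := fun k hk =>
        mul_nonneg (abs_nonneg _) (by linarith [hle k j (Finset.ne_of_mem_erase hk) hj])
      have h3 : ∑ k ∈ Finset.univ.erase i₀, |L j k| * (1 - |L' k j|) = 0 := by
        refine le_antisymm ?_ (Finset.sum_nonneg h2)
        have h4 : ∑ k ∈ Finset.univ.erase i₀, |L j k| * (1 - |L' k j|) ≤
            ∑ k ∈ Finset.univ.erase i₀, (|L j k| - L j k * L' k j) := by
          refine Finset.sum_le_sum fun k _ => ?_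
          have := le_abs_self (L j k * L' k j)
          rw [abs_mul] at this
          linarith
        rw [Finset.sum_sub_distrib, h1] at h4
        have h5 : ∑ k ∈ Finset.univ.erase i₀, |L j k| ≤ 1 := hb j
        linarith
      rw [Finset.sum_eq_zero_iff_of_nonneg h2] at h3
      have h6 := h3 i (Finset.mem_erase.2 ⟨hi, Finset.mem_univ i⟩)
      rcases mul_eq_zero.1 h6 with h7 | h7
      · exact absurd (abs_eq_zero.1 h7) hne
      · linarith
    intro i j j' hi hj hj' hne hne'
    -- Two entries of modulus `1` do not fit into a row of `L'` with `ℓ¹` norm at most `1`.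
    by_contra hjj
    have h1 := hone i j hi hj hne
    have h2 := hone i j' hi hj' hne'
    have h3 : |L' i j| + |L' i j'| ≤ 1 := by
      rw [← Finset.sum_pair (f := fun j => |L' i j|) hjj]
      refine (Finset.sum_le_sum_of_subset_of_nonneg ?_ fun _ _ _ => abs_nonneg _).trans (hb' i)
      intro k hk
      simp only [Finset.mem_insert, Finset.mem_singleton] at hk
      rcases hk with rfl | rfl <;> simp [hj, hj']
    linarith
  classical
  -- This substitution agrees with `χ` only on the facet: the variable `i₀` and the image coordinate
  -- `j₀` are replaced by their constant values there, so the uncontrolled `i₀`-th column of `χ`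
  -- does no harm.
  let q : Fin d → MvPolynomial (Fin d) ℝ := fun j =>
    if j = j₀ then MvPolynomial.C (if b' then 1 else 0) else
      MvPolynomial.C (χ 0 j + L j i₀ * if b then 1 else 0) +
        ∑ i ∈ Finset.univ.erase i₀, MvPolynomial.C (L j i) * MvPolynomial.X i
  have hdeg : ∀ i j, MvPolynomial.degreeOf i (q j) ≤
      if i ≠ i₀ ∧ j ≠ j₀ ∧ L j i ≠ 0 then 1 else 0 := by
    intro i j
    by_cases hj : j = j₀
    · simp only [q, if_pos hj, MvPolynomial.degreeOf_C]
      exact Nat.zero_le _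
    · simp only [q, if_neg hj]
      refine (MvPolynomial.degreeOf_add_le _ _ _).trans ?_
      rw [MvPolynomial.degreeOf_C, max_eq_right (Nat.zero_le _)]
      refine (MvPolynomial.degreeOf_sum_le _ _ _).trans ?_
      refine Finset.sup_le fun k hk => ?_
      by_cases h0 : L j k = 0
      · simp [h0]
      refine (MvPolynomial.degreeOf_C_mul_le _ _ _).trans ?_
      have hk' := Finset.ne_of_mem_erase hk
      by_cases hik : i = k
      · subst hik
        simp [hk', hj, h0]
      · simp [MvPolynomial.degreeOf_X, hik]
  refine ⟨_, subst_mem_polySpace hφ q fun s hs u hu => ?_, fun x hx => ?_⟩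
  · intro i
    change ∀ i, s i ≤ p at hs
    refine (MvPolynomial.degreeOf_le_iff.1 le_rfl u hu : u i ≤ _).trans ?_
    refine (MvPolynomial.degreeOf_prod_le _ _ _).trans ?_
    have hpow : ∀ j, MvPolynomial.degreeOf i (q j ^ s j) ≤
        s j * if i ≠ i₀ ∧ j ≠ j₀ ∧ L j i ≠ 0 then 1 else 0 := fun j =>
      (MvPolynomial.degreeOf_pow_le _ _ _).trans (Nat.mul_le_mul_left _ (hdeg i j))
    by_cases hex : ∃ j, i ≠ i₀ ∧ j ≠ j₀ ∧ L j i ≠ 0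
    · obtain ⟨j, hi, hj, hne⟩ := hex
      rw [Finset.sum_eq_single j]
      · refine (hpow j).trans ?_
        rw [if_pos ⟨hi, hj, hne⟩, mul_one]
        exact hs j
      · intro j' _ hj'
        have := hpow j'
        rw [if_neg, mul_zero] at this
        · omega
        · rintro ⟨-, h2, h3⟩
          exact hj' (hcol i j' j hi h2 hj h3 hne)
      · simp
    · rw [Finset.sum_eq_zero]
      · exact Nat.zero_le _
      · intro j _
        have := hpow j
        rw [if_neg fun h => hex ⟨j, h⟩, mul_zero] at this
        omega
  · congr 1
    ext j
    have h1 := (mem_refFace_cube.1 (h x hx)).2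
    have h2 := (mem_refFace_cube.1 hx).2
    by_cases hj : j = j₀
    · subst hj
      simp [q, h1, evalLin_apply]
    · rw [affine_coord, ← Finset.add_sum_erase _ _ (Finset.mem_univ i₀), h2]
      simp [q, hj, evalLin_apply, hL]
      ring

/-- Polynomials on a facet are preserved by affine maps between facets. -/
theorem exists_polySpace_comp_affine {K : ElemKind} {d p : ℕ} (χ : Vec d ≃ᵃ[ℝ] Vec d)
    {F F' : RefFacet K d} (h : χ '' refFace K {F} = refFace K {F'}) {φ : Vec d → ℝ}
    (hφ : φ ∈ polySpace K d p) :
    ∃ φ' ∈ polySpace K d p, ∀ x ∈ refFace K {F}, φ' x = φ (χ x) := by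
  cases K
  · exact ⟨_, comp_affine_mem_polySpace_simplex χ hφ, fun x _ => rfl⟩
  · obtain ⟨i₀, b⟩ := F
    obtain ⟨j₀, b'⟩ := F'
    change χ '' refFace .cube {cubeFacet i₀ b} = refFace .cube {cubeFacet j₀ b'} at h
    refine comp_affine_mem_polySpace_cube χ (i₀ := i₀) (j₀ := j₀) (b := b) (b' := b')
      (fun x hx => ?_) (fun x hx => ?_) hφ
    · rw [← h]; exact ⟨x, hx, rfl⟩
    · rw [← h] at hx
      obtain ⟨y, hy, rfl⟩ := hx
      rwa [AffineEquiv.symm_apply_apply]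

theorem Mesh.mem_localPoly {K : ElemKind} {d p : ℕ} {Ω : Set (Vec d)} (M : Mesh K d Ω)
    {T : M.Elem} {φ : Vec d → ℝ} :
    φ ∈ M.localPoly p T ↔ ∃ ψ ∈ polySpace K d p, φ = fun x => ψ ((M.Φ T).symm x) := by
  simp only [Mesh.localPoly, Submodule.mem_map]
  constructor
  · rintro ⟨ψ, hψ, rfl⟩
    exact ⟨ψ, hψ, rfl⟩
  · rintro ⟨ψ, hψ, rfl⟩
    exact ⟨ψ, hψ, rfl⟩

/-- The transition map between the reference coordinates of the two elements takes one reference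
facet onto the other. This lets jumps across a facet be treated as polynomials of either element. -/
theorem Mesh.Adj.exists_trace {K : ElemKind} {m p : ℕ} {Ω : Set (Vec (m + 1))}
    {M : Mesh K (m + 1) Ω} {s t : M.Side} (h : M.Adj s t) {φ : Vec (m + 1) → ℝ}
    (hφ : φ ∈ M.localPoly p t.1) :
    ∃ φ' ∈ M.localPoly p s.1, ∀ x ∈ M.facet s, φ' x = φ x := by
  obtain ⟨ψ, hψ, rfl⟩ := M.mem_localPoly.1 hφ
  let χ : Vec (m + 1) ≃ᵃ[ℝ] Vec (m + 1) := (M.Φ s.1).trans (M.Φ t.1).symm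
  have hχ : χ '' refFace K {s.2} = refFace K {t.2} := by
    have h1 : M.Φ s.1 '' refFace K {s.2} = M.Φ t.1 '' refFace K {t.2} := h.2
    have h2 : χ '' refFace K {s.2} = (M.Φ t.1).symm '' (M.Φ s.1 '' refFace K {s.2}) := by
      rw [Set.image_image]; rfl
    rw [h2, h1, Set.image_image]
    simp
  obtain ⟨ψ', hψ', he⟩ := exists_polySpace_comp_affine χ hχ hψ
  refine ⟨_, M.mem_localPoly.2 ⟨ψ', hψ', rfl⟩, ?_⟩
  rintro _ ⟨y, hy, rfl⟩
  simp only [AffineEquiv.symm_apply_apply]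
  rw [he y hy]
  rfl

/-! ### The finite element spaces -/

section Spaces

variable {K : ElemKind} {m p : ℕ} {Ω : Set (Vec (m + 1))} (M : Mesh K (m + 1) Ω)

theorem Mesh.mem_V {v : M.ScalarFn} : v ∈ M.V p ↔ ∀ T, v T ∈ M.localPoly p T := by
  simp [Mesh.V, Submodule.mem_pi]

variable {M} in
theorem Mesh.contDiff_of_mem_localPoly {T : M.Elem} {φ : Vec (m + 1) → ℝ}
    (h : φ ∈ M.localPoly p T) {n : WithTop ℕ∞} : ContDiff ℝ n φ := by
  obtain ⟨ψ, hψ, rfl⟩ := M.mem_localPoly.1 h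
  exact (polySpace_contDiff hψ).comp (contDiff_affine_symm _)

variable {M} in
theorem Mesh.contDiff_of_mem_V {v : M.ScalarFn} (h : v ∈ M.V p) (T : M.Elem) {n : WithTop ℕ∞} :
    ContDiff ℝ n (v T) :=
  Mesh.contDiff_of_mem_localPoly (M.mem_V.1 h T)

theorem Submodule_pi_finite {ι : Type*} [Finite ι] {E : ι → Type*} [∀ i, AddCommGroup (E i)]
    [∀ i, Module ℝ (E i)] (W : ∀ i, Submodule ℝ (E i)) [∀ i, FiniteDimensional ℝ (W i)] :
    FiniteDimensional ℝ (Submodule.pi Set.univ W) := by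
  let f : Submodule.pi Set.univ W →ₗ[ℝ] ∀ i, W i :=
    { toFun := fun v i => ⟨v.1 i, v.2 i (Set.mem_univ i)⟩
      map_add' := fun _ _ => rfl
      map_smul' := fun _ _ => rfl }
  refine FiniteDimensional.of_injective f fun v w h => ?_
  ext i : 2
  exact congrArg Subtype.val (congrFun h i)

instance (T : M.Elem) : FiniteDimensional ℝ (M.localPoly p T) := by
  unfold Mesh.localPoly; infer_instance

instance : FiniteDimensional ℝ (M.V p) := Submodule_pi_finite _

/-- The Piola transform. -/
def piola {d : ℕ} (Φ : Vec d ≃ᵃ[ℝ] Vec d) : (Vec d → Vec d) →ₗ[ℝ] (Vec d → Vec d) where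
  toFun r x := (LinearMap.det (Φ.linear : Vec d →ₗ[ℝ] Vec d))⁻¹ • Φ.linear (r (Φ.symm x))
  map_add' r r' := by ext; simp
  map_smul' c r := by ext; simp; ring

theorem Mesh.mem_Sig {r : M.VectorFn} :
    r ∈ M.Sig p ↔ ∀ T, r T ∈ (refRTSub K (m + 1) p).map (piola (M.Φ T)) := by
  simp only [Mesh.Sig, Submodule.mem_map]
  refine forall_congr' fun T => ?_
  constructor
  · rintro ⟨r', h, h'⟩
    exact ⟨r', h, (funext h').symm⟩
  · rintro ⟨r', h, h'⟩
    exact ⟨r', h, fun x => (congrFun h' x).symm⟩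

/-- `Σ_h^p` as a submodule. -/
def Mesh.sigSub (p : ℕ) : Submodule ℝ M.VectorFn :=
  Submodule.pi Set.univ fun T => (refRTSub K (m + 1) p).map (piola (M.Φ T))

theorem Mesh.mem_sigSub {r : M.VectorFn} : r ∈ M.sigSub p ↔ r ∈ M.Sig p := by
  rw [M.mem_Sig]; simp [Mesh.sigSub, Submodule.mem_pi]

instance : FiniteDimensional ℝ (M.sigSub p) := Submodule_pi_finite _

/-- `Σ_{h,div}^p` as a submodule. -/
def Mesh.sigDivSub (p : ℕ) : Submodule ℝ M.VectorFn where
  carrier := M.SigDiv p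
  add_mem' := by
    rintro r r' ⟨h, hn⟩ ⟨h', hn'⟩
    refine ⟨M.mem_sigSub.1 (add_mem (M.mem_sigSub.2 h) (M.mem_sigSub.2 h')),
      fun s t hst x hx => ?_⟩
    have := hn s t hst x hx
    have h2 := hn' s t hst x hx
    simp only [inner_sub_left, Pi.add_apply, inner_add_left] at *
    linarith
  zero_mem' := ⟨M.mem_sigSub.1 (zero_mem _), fun s t _ x _ => by simp⟩
  smul_mem' := by
    rintro c r ⟨h, hn⟩
    refine ⟨M.mem_sigSub.1 (Submodule.smul_mem _ c (M.mem_sigSub.2 h)), fun s t hst x hx => ?_⟩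
    have := hn s t hst x hx
    simp only [Pi.smul_apply, ← smul_sub, real_inner_smul_left, this, mul_zero]

instance : FiniteDimensional ℝ (M.sigDivSub p) :=
  Submodule.finiteDimensional_of_le (fun _ h => M.mem_sigSub.2 h.1 : M.sigDivSub p ≤ M.sigSub p)

variable {M} in
theorem Mesh.contDiff_of_mem_Sig {r : M.VectorFn} (h : r ∈ M.Sig p) (T : M.Elem)
    {n : WithTop ℕ∞} : ContDiff ℝ n (r T) := by
  obtain ⟨r', h', he⟩ := h T
  rw [show r T = _ from funext he]
  have h1 : ContDiff ℝ n fun x => r' ((M.Φ T).symm x) :=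
    (refRT_contDiff h').comp (contDiff_affine_symm _)
  exact ((linPart (M.Φ T)).contDiff.comp h1).const_smul _

/-- The normal component of the Piola transform on a side. -/
theorem Mesh.inner_piola_normal (s : M.Side) (r : Vec (m + 1) → Vec (m + 1)) (x : Vec (m + 1)) :
    inner ℝ (piola (M.Φ s.1) r x) (M.normal s) = (M.det s.1)⁻¹ * ‖M.conormal s‖⁻¹ *
      inner ℝ (refNormal K s.2) (r ((M.Φ s.1).symm x)) := by
  rw [M.inner_normal]
  simp only [piola, LinearMap.coe_mk, AddHom.coe_mk, map_smul, LinearEquiv.symm_apply_apply,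
    inner_smul_right, Mesh.det]
  ring

variable {M} in
theorem Mesh.exists_normal_trace {r : M.VectorFn} (h : r ∈ M.Sig p) (s : M.Side) :
    ∃ φ ∈ M.localPoly p s.1, ∀ x ∈ M.facet s, inner ℝ (r s.1 x) (M.normal s) = φ x := by
  obtain ⟨r', h', he⟩ := M.mem_Sig.1 h s.1
  obtain ⟨φ, hφ, hφe⟩ := refRT_normal_trace h' s.2
  refine ⟨fun x => ((M.det s.1)⁻¹ * ‖M.conormal s‖⁻¹) • φ ((M.Φ s.1).symm x),
    M.mem_localPoly.2 ⟨_, Submodule.smul_mem _ ((M.det s.1)⁻¹ * ‖M.conormal s‖⁻¹) hφ, rfl⟩,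
    fun x hx => ?_⟩
  rw [← he, M.inner_piola_normal, hφe _ (M.mem_facet.1 hx).2]
  rfl

/-! ### Faithfulness of the integrals -/

theorem Mesh.elem_subset_closure_interior (T : M.Elem) :
    M.elem T ⊆ closure (interior (M.elem T)) := by
  have h1 : interior (M.elem T) = M.Φ T '' interior (refElem K (m + 1)) :=
    ((affineHomeo (M.Φ T)).image_interior _).symm
  have h2 : closure (M.Φ T '' interior (refElem K (m + 1))) =
      M.Φ T '' closure (interior (refElem K (m + 1))) :=
    ((affineHomeo (M.Φ T)).image_closure _).symm
  rw [h1, h2, closure_interior_refElem]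
  rfl

theorem Mesh.eqOn_elem {E : Type*} [TopologicalSpace E] [T2Space E] (T : M.Elem)
    {f g : Vec (m + 1) → E} (hf : Continuous f) (hg : Continuous g)
    (h : f =ᵐ[volume.restrict (M.elem T)] g) : Set.EqOn f g (M.elem T) :=
  Measure.eqOn_of_ae_eq h hf.continuousOn hg.continuousOn (M.elem_subset_closure_interior T)

variable {M} in
-- Discrete functions are functions on all of `ℝ^d`, while integrals see them on `T` only. A
-- polynomial that vanishes on a set with interior points is zero, so equality on the elements is
-- equality of functions.
theorem Mesh.eq_zero_of_eqOn_localPoly {T : M.Elem} {φ : Vec (m + 1) → ℝ}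
    (h : φ ∈ M.localPoly p T) (h0 : ∀ x ∈ M.elem T, φ x = 0) : φ = 0 := by
  obtain ⟨ψ, hψ, rfl⟩ := M.mem_localPoly.1 h
  obtain ⟨c, hc⟩ := interior_refElem_nonempty K (m + 1)
  have := polySpace_eq_zero hψ (c := c) (by
    filter_upwards [mem_interior_iff_mem_nhds.1 hc] with x hx
    have := h0 (M.Φ T x) ⟨x, hx, rfl⟩
    simpa using this)
  rw [this]; rfl

variable {M} in
theorem Mesh.eq_zero_of_eqOn_Sig {r : M.VectorFn} (h : r ∈ M.Sig p) (T : M.Elem)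
    (h0 : ∀ x ∈ M.elem T, r T x = 0) : r T = 0 := by
  obtain ⟨r', h', he⟩ := M.mem_Sig.1 h T
  obtain ⟨c, hc⟩ := interior_refElem_nonempty K (m + 1)
  have := refRT_eq_zero (mem_refRTSub.1 h') (c := c) (by
    filter_upwards [mem_interior_iff_mem_nhds.1 hc] with x hx
    have h1 := h0 (M.Φ T x) ⟨x, hx, rfl⟩
    rw [← he] at h1
    simp only [piola, LinearMap.coe_mk, AddHom.coe_mk, AffineEquiv.symm_apply_apply] at h1
    have h2 := (smul_eq_zero.1 h1).resolve_left (inv_ne_zero (M.det_ne_zero T))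
    simpa using h2)
  rw [← he, this, map_zero]

theorem Mesh.eq_zero_on_facet (s : M.Side) {f : Vec (m + 1) → ℝ} (hf : Continuous f)
    (h : ∫ x, f x ^ 2 ∂(M.surf s) = 0) : ∀ x ∈ M.facet s, f x = 0 := by
  obtain ⟨i, hi⟩ := exists_refNormal_ne s.2
  rw [M.integral_surf s hi] at h
  have h1 := (mul_eq_zero.1 h).resolve_left (M.surfFactor_pos s).ne'
  have hcont : Continuous fun y => f (M.Φ s.1 (ins i (facetHeight s.2 i y) y)) := by
    have h1 := continuous_facetHeight s.2 i
    exact hf.comp ((continuous_affine _).comp (by fun_prop))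
  rw [setIntegral_eq_zero_iff_of_nonneg_ae (Eventually.of_forall fun y => sq_nonneg _)
    ((hcont.pow 2).continuousOn.integrableOn_compact (isCompact_refElem K m))] at h1
  have h2 : (fun y => f (M.Φ s.1 (ins i (facetHeight s.2 i y) y)))
      =ᵐ[volume.restrict (refElem K m)] fun _ => 0 := by
    filter_upwards [h1] with y hy
    simpa using hy
  have h3 := Measure.eqOn_of_ae_eq h2 hcont.continuousOn continuousOn_const
    (closure_interior_refElem K m).ge
  intro x hx
  rw [Mesh.facet, refFace_eq_image hi, Set.image_image] at hx
  obtain ⟨y, hy, rfl⟩ := hx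
  exact h3 hy

/-! ### Integration by parts over the mesh -/

theorem Mesh.l2_comm (v w : M.ScalarFn) : M.l2 v w = M.l2 w v := by
  simp only [Mesh.l2, mul_comm]

theorem Mesh.l2_dvg {r : M.VectorFn} {v : M.ScalarFn} (hr : ∀ T, ContDiff ℝ 1 (r T))
    (hv : ∀ T, ContDiff ℝ 1 (v T)) :
    M.l2 (M.dvg r) v = - (∑ T, ∫ x in M.elem T, inner ℝ (r T x) (gradient (v T) x)) +
      ∑ s : M.Side, ∫ x, v s.1 x * inner ℝ (r s.1 x) (M.normal s) ∂(M.surf s) := by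
  rw [Fintype.sum_prod_type, ← Finset.sum_neg_distrib, ← Finset.sum_add_distrib, Mesh.l2]
  exact Finset.sum_congr rfl fun T _ => M.setIntegral_divergence_mul T (hr T) (hv T)

/-! ### Quadrature -/

theorem volume_real_refElem_pos (K : ElemKind) (d : ℕ) : 0 < volume.real (refElem K d) := by
  refine ENNReal.toReal_pos ?_ (isCompact_refElem K d).measure_ne_top
  exact (Measure.measure_pos_of_nonempty_interior _ (interior_refElem_nonempty K d)).ne'

theorem Mesh.volume_real_elem (T : M.Elem) :
    volume.real (M.elem T) = |M.det T| * volume.real (refElem K (m + 1)) := by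
  have := M.setIntegral_elem T (fun _ => 1)
  simpa using this

theorem qweight_eq (Q : QuadRule K (m + 1) p) (T : M.Elem) (i : Fin Q.n) :
    qweight M Q T i = |M.det T| * Q.weight i := by
  rw [qweight, M.volume_real_elem]
  have := (volume_real_refElem_pos K (m + 1)).ne'
  field_simp

theorem qweight_pos (Q : QuadRule K (m + 1) p) (T : M.Elem) (i : Fin Q.n) :
    0 < qweight M Q T i := by
  rw [qweight_eq]
  exact mul_pos (abs_pos.2 (M.det_ne_zero T)) (Q.weight_pos i)

/-- The quadrature is exact for products of discrete functions. -/
theorem l2_eq_qInner (Q : QuadRule K (m + 1) p) {v w : M.ScalarFn} (hv : v ∈ M.V p)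
    (hw : w ∈ M.V p) : M.l2 v w = qInner M Q v w := by
  refine Finset.sum_congr rfl fun T _ => ?_
  obtain ⟨φ, hφ, hv'⟩ := M.mem_localPoly.1 (M.mem_V.1 hv T)
  obtain ⟨ψ, hψ, hw'⟩ := M.mem_localPoly.1 (M.mem_V.1 hw T)
  have h := mul_mem_polySpace hφ hψ
  rw [← two_mul] at h
  rw [M.setIntegral_elem, hv', hw']
  simp only [AffineEquiv.symm_apply_apply]
  rw [Q.exact_poly _ h, Finset.mul_sum]
  refine Finset.sum_congr rfl fun i _ => ?_
  rw [qweight_eq]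
  simp only [qnode, AffineEquiv.symm_apply_apply]
  ring

variable {M} in
/-- A discrete function that represents nodal values in the discrete inner product has these
nodal values. -/
theorem nodal_eq (Q : QuadRule K (m + 1) p) (hQ : IsQuadSpace M Q) {u z : M.ScalarFn}
    (hu : u ∈ M.V p) (h : ∀ w ∈ M.V p, M.l2 u w = qInner M Q z w) (T : M.Elem) (i : Fin Q.n) :
    u T (qnode M Q T i) = z T (qnode M Q T i) := by
  classical
  obtain ⟨φ, hφ, hφe⟩ := hQ T i
  let w : M.ScalarFn := Pi.single T φ
  have hw : w ∈ M.V p := by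
    rw [M.mem_V]
    intro T'
    by_cases hT : T' = T
    · subst hT; simpa [w] using hφ
    · simp [w, hT]
  -- The test function is a nodal function on `T`, extended by zero to the other elements, and so it
  -- isolates one node.
  have key : ∀ y : M.ScalarFn, qInner M Q y w = y T (qnode M Q T i) * qweight M Q T i := by
    intro y
    rw [qInner, Finset.sum_eq_single T, Finset.sum_eq_single i]
    · simp [w, hφe]
    · intro j _ hj
      simp [w, hφe, hj.symm]
    · simp
    · intro T' _ hT
      simp [w, hT]
    · simp
  have h1 := h w hw
  rw [l2_eq_qInner M Q hu hw, key, key] at h1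
  exact mul_right_cancel₀ (qweight_pos M Q T i).ne' h1

end Spaces

/-! ### The diffusion tensor -/

section Matrix

variable {d : ℕ}

theorem bil_eq_inner (B : Matrix (Fin d) (Fin d) ℝ) (v w : Vec d) :
    bil B v w = inner ℝ v (WithLp.toLp 2 (B.mulVec (WithLp.ofLp w))) := by
  simp [bil, PiLp.inner_apply, dotProduct, mul_comm]

theorem bil_add_left (B : Matrix (Fin d) (Fin d) ℝ) (v v' w : Vec d) :
    bil B (v + v') w = bil B v w + bil B v' w := by
  simp [bil, add_dotProduct]

theorem bil_smul_left (B : Matrix (Fin d) (Fin d) ℝ) (c : ℝ) (v w : Vec d) :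
    bil B (c • v) w = c * bil B v w := by
  simp [bil, smul_dotProduct]

theorem bil_add_right (B : Matrix (Fin d) (Fin d) ℝ) (v w w' : Vec d) :
    bil B v (w + w') = bil B v w + bil B v w' := by
  simp [bil, Matrix.mulVec_add, dotProduct_add]

theorem bil_smul_right (B : Matrix (Fin d) (Fin d) ℝ) (c : ℝ) (v w : Vec d) :
    bil B v (c • w) = c * bil B v w := by
  simp [bil, Matrix.mulVec_smul, dotProduct_smul]

theorem bil_comm {B : Matrix (Fin d) (Fin d) ℝ} (hB : B.IsSymm) (v w : Vec d) :
    bil B v w = bil B w v := by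
  simp only [bil]
  rw [Matrix.dotProduct_mulVec, ← Matrix.mulVec_transpose, hB.eq, dotProduct_comm]

theorem bil_eq_sum (B : Matrix (Fin d) (Fin d) ℝ) (v w : Vec d) :
    bil B v w = ∑ i, ∑ j, B i j * (v i * w j) := by
  simp only [bil, dotProduct, Matrix.mulVec, Finset.mul_sum]
  exact Finset.sum_congr rfl fun i _ => Finset.sum_congr rfl fun j _ => by ring

variable {B : Matrix (Fin d) (Fin d) ℝ} {a₀ : ℝ}

theorem isUnit_det_of_coercive (ha : 0 < a₀) (hB : ∀ ξ : Vec d, a₀ * ‖ξ‖ ^ 2 ≤ bil B ξ ξ) :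
    IsUnit B.det := by
  rw [← Matrix.isUnit_iff_isUnit_det, ← Matrix.mulVec_injective_iff_isUnit]
  intro v w h
  have h0 : B.mulVec (v - w) = 0 := by
    rw [Matrix.mulVec_sub, sub_eq_zero]; exact h
  have h1 := hB (WithLp.toLp 2 (v - w))
  have h2 : bil B (WithLp.toLp 2 (v - w)) (WithLp.toLp 2 (v - w)) = 0 := by
    simp [bil, h0]
  rw [h2] at h1
  have h3 : ‖(WithLp.toLp 2 (v - w) : Vec d)‖ ^ 2 = 0 :=
    le_antisymm (by nlinarith [sq_nonneg ‖(WithLp.toLp 2 (v - w) : Vec d)‖]) (sq_nonneg _)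
  have h4 : (WithLp.toLp 2 (v - w) : Vec d) = 0 := by simpa using h3
  have h5 := congrArg WithLp.ofLp h4
  simpa [sub_eq_zero] using h5

/-- Multiplication by the inverse of a coercive matrix. -/
theorem inv_mulVec_bound (ha : 0 < a₀) (hB : ∀ ξ : Vec d, a₀ * ‖ξ‖ ^ 2 ≤ bil B ξ ξ) (v : Vec d) :
    a₀ * ‖(WithLp.toLp 2 (B⁻¹.mulVec (WithLp.ofLp v)) : Vec d)‖ ^ 2 ≤ bil B⁻¹ v v ∧
      a₀ * ‖(WithLp.toLp 2 (B⁻¹.mulVec (WithLp.ofLp v)) : Vec d)‖ ≤ ‖v‖ := by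
  set w : Vec d := WithLp.toLp 2 (B⁻¹.mulVec (WithLp.ofLp v)) with hw
  have hBw : B.mulVec (WithLp.ofLp w) = WithLp.ofLp v := by
    rw [hw]
    simp [Matrix.mulVec_mulVec, Matrix.mul_nonsing_inv _ (isUnit_det_of_coercive ha hB)]
  have h1 : bil B⁻¹ v v = inner ℝ v w := bil_eq_inner _ _ _
  have h2 : bil B w w = inner ℝ w v := by rw [bil_eq_inner, hBw]
  have h3 := hB w
  rw [h2, real_inner_comm] at h3
  refine ⟨h1 ▸ h3, ?_⟩
  have h4 := real_inner_le_norm v w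
  by_contra h5
  push Not at h5
  have h6 : 0 ≤ ‖w‖ := norm_nonneg w
  have h7 : 0 < ‖w‖ := by
    by_contra h8
    have : ‖w‖ = 0 := le_antisymm (not_lt.1 h8) h6
    rw [this, mul_zero] at h5
    exact absurd (norm_nonneg v) (not_le.2 h5)
  nlinarith

theorem bil_inv_nonneg (ha : 0 < a₀) (hB : ∀ ξ : Vec d, a₀ * ‖ξ‖ ^ 2 ≤ bil B ξ ξ) (v : Vec d) :
    0 ≤ bil B⁻¹ v v :=
  le_trans (by positivity) (inv_mulVec_bound ha hB v).1

theorem bil_inv_le (ha : 0 < a₀) (hB : ∀ ξ : Vec d, a₀ * ‖ξ‖ ^ 2 ≤ bil B ξ ξ) (v : Vec d) :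
    bil B⁻¹ v v ≤ a₀⁻¹ * ‖v‖ ^ 2 := by
  have h := (inv_mulVec_bound ha hB v).2
  rw [bil_eq_inner]
  refine (real_inner_le_norm _ _).trans ?_
  rw [← div_eq_inv_mul, le_div_iff₀ ha]
  nlinarith [norm_nonneg v]

theorem eq_zero_of_bil_inv (ha : 0 < a₀) (hB : ∀ ξ : Vec d, a₀ * ‖ξ‖ ^ 2 ≤ bil B ξ ξ) {v : Vec d}
    (h : bil B⁻¹ v v = 0) : v = 0 := by
  have h1 := (inv_mulVec_bound ha hB v).1
  rw [h] at h1
  have h2 : ‖(WithLp.toLp 2 (B⁻¹.mulVec (WithLp.ofLp v)) : Vec d)‖ ^ 2 = 0 :=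
    le_antisymm (by nlinarith [sq_nonneg ‖(WithLp.toLp 2 (B⁻¹.mulVec (WithLp.ofLp v)) : Vec d)‖])
      (sq_nonneg _)
  have h3 : B⁻¹.mulVec (WithLp.ofLp v) = 0 := by
    have : (WithLp.toLp 2 (B⁻¹.mulVec (WithLp.ofLp v)) : Vec d) = 0 := by simpa using h2
    simpa using congrArg WithLp.ofLp this
  have h4 : B.mulVec (B⁻¹.mulVec (WithLp.ofLp v)) = WithLp.ofLp v := by
    simp [Matrix.mulVec_mulVec, Matrix.mul_nonsing_inv _ (isUnit_det_of_coercive ha hB)]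
  rw [h3, Matrix.mulVec_zero] at h4
  ext i
  simpa using (congrFun h4 i).symm

theorem abs_inv_apply_le (ha : 0 < a₀) (hB : ∀ ξ : Vec d, a₀ * ‖ξ‖ ^ 2 ≤ bil B ξ ξ)
    (i j : Fin d) : |B⁻¹ i j| ≤ a₀⁻¹ := by
  have h := (inv_mulVec_bound ha hB (EuclideanSpace.single j 1)).2
  have h1 : B⁻¹ i j = (WithLp.toLp 2 (B⁻¹.mulVec
      (WithLp.ofLp (EuclideanSpace.single j (1 : ℝ)))) : Vec d) i := by
    simp
  rw [h1, ← Real.norm_eq_abs]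
  refine (PiLp.norm_apply_le _ i).trans ?_
  rw [show a₀⁻¹ = 1 / a₀ from (one_div a₀).symm, le_div_iff₀ ha, mul_comm]
  simpa using h

theorem isSymm_inv (hB : B.IsSymm) : (B⁻¹).IsSymm := by
  rw [Matrix.IsSymm, Matrix.transpose_nonsing_inv, hB.eq]

end Matrix

/-! ### Discrete bilinear forms and functionals -/

section Diffusion

variable {K : ElemKind} {m p : ℕ} {Ω : Set (Vec (m + 1))} {M : Mesh K (m + 1) Ω}
  {a₀ a₁ : ℝ} {A : Vec (m + 1) → Matrix (Fin (m + 1)) (Fin (m + 1)) ℝ}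

/-- The interior of a closed element lies in the interior of the closure of `Ω`, which is `Ω`; the
frontier of the element is a null set because the element is convex. So data given almost everywhere
on `Ω` are available on every element. -/
theorem Mesh.restrict_elem_le (hΩ : interior (closure Ω) = Ω) (M : Mesh K (m + 1) Ω)
    (T : M.Elem) : volume.restrict (M.elem T) ≤ volume.restrict Ω := by
  refine Measure.restrict_mono_ae ?_
  have hconv : Convex ℝ (M.elem T) := (convex_refElem K _).affine_image (M.Φ T).toAffineMap
  have hsub : interior (M.elem T) ⊆ Ω := by
    have h : M.elem T ⊆ closure Ω := fun x hx =>
      M.cover.subset (Set.mem_iUnion.2 ⟨T, hx⟩)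
    exact (interior_mono h).trans hΩ.subset
  have h0 : ∀ᵐ x ∂(volume : Measure (Vec (m + 1))), x ∉ frontier (M.elem T) :=
    measure_eq_zero_iff_ae_notMem.1 (hconv.addHaar_frontier volume)
  filter_upwards [h0] with x hx hxT
  refine hsub ?_
  by_contra h
  exact hx ⟨subset_closure hxT, h⟩

theorem IsDiffusion.ae_elem (hA : IsDiffusion Ω a₀ a₁ A) (hΩ : interior (closure Ω) = Ω)
    (T : M.Elem) : ∀ᵐ x ∂(volume.restrict (M.elem T)), (A x).IsSymm ∧ ∀ ξ : Vec (m + 1),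
      a₀ * ‖ξ‖ ^ 2 ≤ bil (A x) ξ ξ ∧ bil (A x) ξ ξ ≤ a₁ * ‖ξ‖ ^ 2 :=
  (Measure.absolutelyContinuous_of_le (M.restrict_elem_le hΩ T)).ae_le (hA.symm.and hA.bounds)

theorem aemeasurable_inv {α : Type*} [MeasurableSpace α] {μ : Measure α} {d : ℕ}
    {A : α → Matrix (Fin d) (Fin d) ℝ} (h : ∀ i j, AEMeasurable (fun x => A x i j) μ)
    (i j : Fin d) : AEMeasurable (fun x => (A x)⁻¹ i j) μ := by
  have h1 : AEMeasurable (fun x => (fun i j => A x i j : Fin d → Fin d → ℝ)) μ :=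
    aemeasurable_pi_lambda _ fun i => aemeasurable_pi_lambda _ fun j => h i j
  have h2 : Continuous fun B : Fin d → Fin d → ℝ => (Matrix.of B).det :=
    Continuous.matrix_det continuous_id
  have h3 : Continuous fun B : Fin d → Fin d → ℝ => (Matrix.of B).adjugate i j :=
    (Continuous.matrix_adjugate continuous_id).matrix_elem i j
  have h4 : ∀ x, (A x)⁻¹ i j = ((A x).det)⁻¹ * (A x).adjugate i j := by
    intro x
    rw [Matrix.inv_def, Ring.inverse_eq_inv', Matrix.smul_apply, smul_eq_mul]
  simp only [h4]
  exact ((h2.measurable.comp_aemeasurable h1).inv).mul (h3.measurable.comp_aemeasurable h1)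

/-- Coercivity bounds the entries of `A⁻¹` by `a₀⁻¹`, so the integrand is a sum of bounded
measurable functions times continuous ones. -/
theorem IsDiffusion.integrableOn_inv (hA : IsDiffusion Ω a₀ a₁ A) (ha : 0 < a₀)
    (hΩ : interior (closure Ω) = Ω) (T : M.Elem) {r q : Vec (m + 1) → Vec (m + 1)}
    (hr : Continuous r) (hq : Continuous q) :
    IntegrableOn (fun x => bil (A x)⁻¹ (r x) (q x)) (M.elem T) := by
  simp only [bil_eq_sum]
  refine integrable_finsetSum _ fun i _ => integrable_finsetSum _ fun j _ => ?_
  refine Integrable.bdd_mul (c := a₀⁻¹) ?_ ?_ ?_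
  · exact M.integrableOn_elem T (by fun_prop)
  · refine (aemeasurable_inv (fun i j => ?_) i j).aestronglyMeasurable
    exact (hA.measurable i j).mono_measure (M.restrict_elem_le hΩ T)
  · filter_upwards [hA.ae_elem hΩ T] with x hx
    exact abs_inv_apply_le ha (fun ξ => (hx.2 ξ).1) i j

variable (M)

/-- The form `(A⁻¹ q, r)` on `Σ_{h,div}^p`. -/
def fluxForm (hA : IsDiffusion Ω a₀ a₁ A) (ha : 0 < a₀) (hΩ : interior (closure Ω) = Ω) (p : ℕ) :
    M.sigDivSub p →ₗ[ℝ] M.sigDivSub p →ₗ[ℝ] ℝ :=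
  have hc : ∀ (r : M.sigDivSub p) (T : M.Elem), Continuous (r.1 T) := fun r T =>
    (Mesh.contDiff_of_mem_Sig r.2.1 T (n := 0)).continuous
  LinearMap.mk₂ ℝ (fun q r => M.invForm A q.1 r.1)
    (fun q q' r => by
      simp only [Mesh.invForm, ← Finset.sum_add_distrib]
      refine Finset.sum_congr rfl fun T _ => ?_
      rw [← integral_add (hA.integrableOn_inv ha hΩ T (hc r T) (hc q T))
        (hA.integrableOn_inv ha hΩ T (hc r T) (hc q' T))]
      refine integral_congr_ae (Eventually.of_forall fun x => ?_)
      exact bil_add_right _ _ _ _)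
    (fun c q r => by
      simp only [Mesh.invForm, smul_eq_mul, Finset.mul_sum]
      refine Finset.sum_congr rfl fun T _ => ?_
      rw [← integral_const_mul]
      refine integral_congr_ae (Eventually.of_forall fun x => ?_)
      exact bil_smul_right _ _ _ _)
    (fun q r r' => by
      simp only [Mesh.invForm, ← Finset.sum_add_distrib]
      refine Finset.sum_congr rfl fun T _ => ?_
      rw [← integral_add (hA.integrableOn_inv ha hΩ T (hc r T) (hc q T))
        (hA.integrableOn_inv ha hΩ T (hc r' T) (hc q T))]
      refine integral_congr_ae (Eventually.of_forall fun x => ?_)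
      exact bil_add_left _ _ _ _)
    (fun c q r => by
      simp only [Mesh.invForm, smul_eq_mul, Finset.mul_sum]
      refine Finset.sum_congr rfl fun T _ => ?_
      rw [← integral_const_mul]
      refine integral_congr_ae (Eventually.of_forall fun x => ?_)
      exact bil_smul_left _ _ _ _)

variable (hA : IsDiffusion Ω a₀ a₁ A) (ha : 0 < a₀) (hΩ : interior (closure Ω) = Ω)

theorem fluxForm_apply (q r : M.sigDivSub p) :
    fluxForm M hA ha hΩ p q r = M.invForm A q.1 r.1 := rfl

theorem invForm_comm (hA : IsDiffusion Ω a₀ a₁ A)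
    (hΩ : interior (closure Ω) = Ω) (q r : M.VectorFn) :
    M.invForm A q r = M.invForm A r q := by
  refine Finset.sum_congr rfl fun T _ => integral_congr_ae ?_
  filter_upwards [hA.ae_elem hΩ T] with x hx
  exact bil_comm (isSymm_inv hx.1) _ _

theorem invForm_nonneg (hA : IsDiffusion Ω a₀ a₁ A) (ha : 0 < a₀)
    (hΩ : interior (closure Ω) = Ω) (q : M.VectorFn) : 0 ≤ M.invForm A q q := by
  refine Finset.sum_nonneg fun T _ => integral_nonneg_of_ae ?_
  filter_upwards [hA.ae_elem hΩ T] with x hx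
  exact bil_inv_nonneg ha (fun ξ => (hx.2 ξ).1) _

/-- The squared `L²` norm of a piecewise defined field. -/
def Mesh.fieldSq (r : M.VectorFn) : ℝ := ∑ T, ∫ x in M.elem T, ‖r T x‖ ^ 2

theorem invForm_le (hA : IsDiffusion Ω a₀ a₁ A) (ha : 0 < a₀)
    (hΩ : interior (closure Ω) = Ω) {r : M.VectorFn} (hr : ∀ T, Continuous (r T)) :
    M.invForm A r r ≤ a₀⁻¹ * M.fieldSq r := by
  rw [Mesh.fieldSq, Finset.mul_sum]
  refine Finset.sum_le_sum fun T _ => ?_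
  rw [← integral_const_mul]
  refine integral_mono_of_nonneg ?_ ?_ ?_
  · filter_upwards [hA.ae_elem hΩ T] with x hx
    exact bil_inv_nonneg ha (fun ξ => (hx.2 ξ).1) _
  · have := hr T
    exact M.integrableOn_elem T (by fun_prop)
  · filter_upwards [hA.ae_elem hΩ T] with x hx
    exact bil_inv_le ha (fun ξ => (hx.2 ξ).1) _

theorem fluxForm_definite {r : M.sigDivSub p} (h : fluxForm M hA ha hΩ p r r = 0) : r = 0 := by
  have hc : ∀ T, Continuous (r.1 T) := fun T =>
    (Mesh.contDiff_of_mem_Sig r.2.1 T (n := 0)).continuous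
  have hnn : ∀ T : M.Elem, 0 ≤ᵐ[volume.restrict (M.elem T)]
      fun x => bil (A x)⁻¹ (r.1 T x) (r.1 T x) := fun T => by
    filter_upwards [hA.ae_elem hΩ T] with x hx
    exact bil_inv_nonneg ha (fun ξ => (hx.2 ξ).1) _
  rw [fluxForm_apply, Mesh.invForm, Finset.sum_eq_zero_iff_of_nonneg
    fun T _ => integral_nonneg_of_ae (hnn T)] at h
  ext1
  funext T
  refine Mesh.eq_zero_of_eqOn_Sig r.2.1 T ?_
  have h1 := h T (Finset.mem_univ T)
  rw [integral_eq_zero_iff_of_nonneg_ae (hnn T)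
    (hA.integrableOn_inv ha hΩ T (hc T) (hc T))] at h1
  refine M.eqOn_elem T (hc T) continuous_const ?_
  filter_upwards [h1, hA.ae_elem hΩ T] with x hx hx'
  exact eq_zero_of_bil_inv ha (fun ξ => (hx'.2 ξ).1) hx

theorem divergence_add {d : ℕ} {r r' : Vec d → Vec d} (hr : ContDiff ℝ 1 r)
    (hr' : ContDiff ℝ 1 r') (x : Vec d) :
    divergence (r + r') x = divergence r x + divergence r' x := by
  simp only [divergence, ← Finset.sum_add_distrib]
  refine Finset.sum_congr rfl fun i _ => ?_
  rw [fderiv_add (hr.differentiable one_ne_zero x) (hr'.differentiable one_ne_zero x)]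
  rfl

theorem divergence_const_smul {d : ℕ} (c : ℝ) {r : Vec d → Vec d} (hr : ContDiff ℝ 1 r)
    (x : Vec d) : divergence (c • r) x = c * divergence r x := by
  simp only [divergence, Finset.mul_sum]
  refine Finset.sum_congr rfl fun i _ => ?_
  rw [fderiv_const_smul (hr.differentiable one_ne_zero x)]
  rfl

/-- The form `(∇ · r, v)` on `Σ_{h,div}^p × V_h^p`. -/
def divForm (p : ℕ) : M.sigDivSub p →ₗ[ℝ] M.V p →ₗ[ℝ] ℝ :=
  have hr : ∀ (r : M.sigDivSub p) (T : M.Elem), ContDiff ℝ 1 (r.1 T) := fun r T =>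
    Mesh.contDiff_of_mem_Sig r.2.1 T
  have hv : ∀ (v : M.V p) (T : M.Elem), Continuous (v.1 T) := fun v T =>
    (Mesh.contDiff_of_mem_V v.2 T (n := 0)).continuous
  have hi : ∀ (r : M.sigDivSub p) (v : M.V p) (T : M.Elem),
      IntegrableOn (fun x => divergence (r.1 T) x * v.1 T x) (M.elem T) := fun r v T =>
    M.integrableOn_elem T ((continuous_divergence (hr r T)).mul (hv v T))
  LinearMap.mk₂ ℝ (fun r v => M.l2 (M.dvg r.1) v.1)
    (fun r r' v => by
      simp only [Mesh.l2, ← Finset.sum_add_distrib]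
      refine Finset.sum_congr rfl fun T _ => ?_
      refine Eq.trans ?_ (integral_add (hi r v T) (hi r' v T))
      refine integral_congr_ae (Eventually.of_forall fun x => ?_)
      change divergence (r.1 T + r'.1 T) x * _ = _
      rw [divergence_add (hr r T) (hr r' T)]
      exact add_mul _ _ _)
    (fun c r v => by
      simp only [Mesh.l2, smul_eq_mul, Finset.mul_sum]
      refine Finset.sum_congr rfl fun T _ => ?_
      rw [← integral_const_mul]
      refine integral_congr_ae (Eventually.of_forall fun x => ?_)
      change divergence (c • r.1 T) x * _ = _
      rw [divergence_const_smul c (hr r T)]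
      exact mul_assoc _ _ _)
    (fun r v v' => by
      simp only [Mesh.l2, ← Finset.sum_add_distrib]
      refine Finset.sum_congr rfl fun T _ => ?_
      refine Eq.trans ?_ (integral_add (hi r v T) (hi r v' T))
      refine integral_congr_ae (Eventually.of_forall fun x => ?_)
      exact mul_add _ _ _)
    (fun c r v => by
      simp only [Mesh.l2, smul_eq_mul, Finset.mul_sum]
      refine Finset.sum_congr rfl fun T _ => ?_
      rw [← integral_const_mul]
      refine integral_congr_ae (Eventually.of_forall fun x => ?_)
      exact mul_left_comm _ _ _)

theorem integrableOn_source {f : Vec (m + 1) → ℝ} (hΩ : interior (closure Ω) = Ω)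
    (hf : MemLp f 2 (volume.restrict Ω)) (T : M.Elem) {v : Vec (m + 1) → ℝ}
    (hv : Continuous v) : IntegrableOn (fun x => f x * v x) (M.elem T) := by
  have h1 : MemLp f 2 (volume.restrict (M.elem T)) := hf.mono_measure (M.restrict_elem_le hΩ T)
  have : IsFiniteMeasure (volume.restrict (M.elem T)) :=
    ⟨by simpa using (M.isCompact_elem T).measure_lt_top⟩
  have h2 : IntegrableOn f (M.elem T) := h1.integrable (by norm_num)
  exact h2.mul_continuousOn hv.continuousOn (M.isCompact_elem T)

/-- The functional `(f, v)` on `V_h^p`. -/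
def sourceForm {f : Vec (m + 1) → ℝ} (hf : MemLp f 2 (volume.restrict Ω))
    (hΩ : interior (closure Ω) = Ω) (p : ℕ) : M.V p →ₗ[ℝ] ℝ where
  toFun v := M.l2 (M.glob f) v.1
  map_add' v v' := by
    simp only [Mesh.l2, ← Finset.sum_add_distrib]
    refine Finset.sum_congr rfl fun T _ => ?_
    refine Eq.trans ?_ (integral_add
      (integrableOn_source M hΩ hf T (Mesh.contDiff_of_mem_V v.2 T (n := 0)).continuous)
      (integrableOn_source M hΩ hf T (Mesh.contDiff_of_mem_V v'.2 T (n := 0)).continuous))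
    refine integral_congr_ae (Eventually.of_forall fun x => ?_)
    exact mul_add _ _ _
  map_smul' c v := by
    simp only [Mesh.l2, smul_eq_mul, Finset.mul_sum, RingHom.id_apply]
    refine Finset.sum_congr rfl fun T _ => ?_
    rw [← integral_const_mul]
    refine integral_congr_ae (Eventually.of_forall fun x => ?_)
    exact mul_left_comm _ _ _

theorem integrable_bdry {g : Vec (m + 1) → ℝ} {s : M.Side} (hg : MemLp g 2 (M.surf s))
    {v : Vec (m + 1) → ℝ} (hv : Continuous v) : Integrable (fun x => g x * v x) (M.surf s) := by
  have h2 : Integrable g (M.surf s) := hg.integrable (by norm_num)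
  exact IntegrableOn.mul_continuousOn h2 hv.continuousOn (M.isCompact_facet s)

/-- The functional `⟨g, r · n⟩` on `Σ_{h,div}^p`. -/
def bdryFunctional {g : Vec (m + 1) → ℝ} (hg : ∀ s, M.IsBdry s → MemLp g 2 (M.surf s)) (p : ℕ) :
    M.sigDivSub p →ₗ[ℝ] ℝ where
  toFun r := M.bdryForm g r.1
  map_add' r r' := by
    simp only [Mesh.bdryForm, ← Finset.sum_add_distrib]
    refine Finset.sum_congr rfl fun s _ => ?_
    split_ifs with hs
    · have hc : ∀ r : M.sigDivSub p, Continuous fun x => inner ℝ (r.1 s.1 x) (M.normal s) :=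
        fun r => (Mesh.contDiff_of_mem_Sig r.2.1 s.1 (n := 0)).continuous.inner continuous_const
      rw [← integral_add (integrable_bdry M (hg s hs) (hc r)) (integrable_bdry M (hg s hs) (hc r'))]
      refine integral_congr_ae (Eventually.of_forall fun x => ?_)
      change g x * inner ℝ (r.1 s.1 x + r'.1 s.1 x) (M.normal s) = _
      rw [inner_add_left, mul_add]
    · simp
  map_smul' c r := by
    simp only [Mesh.bdryForm, smul_eq_mul, Finset.mul_sum, RingHom.id_apply]
    refine Finset.sum_congr rfl fun s _ => ?_
    split_ifs with hs
    · rw [← integral_const_mul]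
      refine integral_congr_ae (Eventually.of_forall fun x => ?_)
      change g x * inner ℝ (c • r.1 s.1 x) (M.normal s) = _
      rw [real_inner_smul_left]; ring
    · simp

end Diffusion

/-! ### Inequalities on finite-dimensional spaces -/

section FiniteDim

variable {W : Type*} [AddCommGroup W] [Module ℝ W]

/-- The inner product given by a symmetric positive definite form. -/
@[reducible] def formCore (b : W →ₗ[ℝ] W →ₗ[ℝ] ℝ) (hsymm : ∀ v w, b v w = b w v)
    (hnn : ∀ v, 0 ≤ b v v) (hdef : ∀ v, b v v = 0 → v = 0) : InnerProductSpace.Core ℝ W where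
  inner v w := b v w
  conj_inner_symm v w := by simp [hsymm]
  re_inner_nonneg v := by simpa using hnn v
  add_left v v' w := by simp
  smul_left v w c := by simp
  definite v := hdef v

theorem exists_form_le_norm_sq {W : Type*} [NormedAddCommGroup W] [InnerProductSpace ℝ W]
    [FiniteDimensional ℝ W] (a : W →ₗ[ℝ] W →ₗ[ℝ] ℝ) :
    ∃ C : ℝ, 0 < C ∧ ∀ v, a v v ≤ C * inner ℝ v v := by
  let a' : W →L[ℝ] W →L[ℝ] ℝ :=
    LinearMap.toContinuousLinearMap (LinearMap.toContinuousLinearMap.toLinearMap ∘ₗ a)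
  refine ⟨‖a'‖ + 1, by positivity, fun v => ?_⟩
  have h1 : a v v ≤ ‖a'‖ * ‖v‖ * ‖v‖ := (le_abs_self _).trans (a'.le_opNorm₂ v v)
  rw [real_inner_self_eq_norm_sq]
  nlinarith [sq_nonneg ‖v‖]

/-- With `b` as inner product, every bilinear form on the finite-dimensional space is bounded. -/
theorem exists_form_le [FiniteDimensional ℝ W] (a b : W →ₗ[ℝ] W →ₗ[ℝ] ℝ)
    (hsymm : ∀ v w, b v w = b w v) (hnn : ∀ v, 0 ≤ b v v) (hdef : ∀ v, b v v = 0 → v = 0) :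
    ∃ C : ℝ, 0 < C ∧ ∀ v, a v v ≤ C * b v v :=
  let core := formCore b hsymm hnn hdef
  @exists_form_le_norm_sq W core.toNormedAddCommGroup (InnerProductSpace.ofCore core.toCore) _ a

/-- Modulo its kernel, a positive semidefinite form dominates every form. -/
theorem exists_form_le_mod_ker [FiniteDimensional ℝ W] (a b : W →ₗ[ℝ] W →ₗ[ℝ] ℝ)
    (hsymm : ∀ v w, b v w = b w v) (hnn : ∀ v, 0 ≤ b v v) :
    ∃ C : ℝ, 0 < C ∧ ∀ v, ∃ v', b (v - v') (v - v') = 0 ∧ a v' v' ≤ C * b v v := by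
  -- By Cauchy–Schwarz, the zeros of the quadratic form make up the kernel of `b`. On a complement
  -- `U` of it `b` is definite, and `v'` is the component in `U`.
  have hker : ∀ v, b v v = 0 → ∀ w, b v w = 0 := by
    intro v hv w
    have h := LinearMap.BilinForm.apply_sq_le_of_symm b hnn ⟨hsymm⟩ v w
    rw [hv, zero_mul] at h
    exact pow_eq_zero_iff two_ne_zero |>.1 (le_antisymm h (sq_nonneg _))
  obtain ⟨U, hU⟩ := (LinearMap.ker b).exists_isCompl
  obtain ⟨C, hC, h⟩ := exists_form_le (W := U) (a.compl₁₂ U.subtype U.subtype)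
    (b.compl₁₂ U.subtype U.subtype) (fun v w => hsymm _ _) (fun v => hnn _) (by
      intro v hv
      have h1 : v.1 ∈ LinearMap.ker b := by
        rw [LinearMap.mem_ker]; ext w; exact hker _ hv w
      exact Subtype.ext ((Submodule.disjoint_def.1 hU.disjoint) _ h1 v.2))
  refine ⟨C, hC, fun v => ?_⟩
  obtain ⟨k, hk, u, hu, rfl⟩ := Submodule.mem_sup.1
    (hU.sup_eq_top ▸ Submodule.mem_top : v ∈ LinearMap.ker b ⊔ U)
  have hk0 : ∀ w, b k w = 0 := fun w => by rw [LinearMap.mem_ker.1 hk]; rfl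
  refine ⟨u, by simp [hk0], ?_⟩
  have h1 : b (k + u) (k + u) = b u u := by simp [hk0, hsymm u k]
  rw [h1]
  exact h ⟨u, hu⟩

variable {X : Type*} [TopologicalSpace X] [MeasurableSpace X] [OpensMeasurableSpace X]
  {E : Type*} [NormedAddCommGroup E] [InnerProductSpace ℝ E]

/-- The form `(φ, ψ) ↦ ∫_S ⟨L φ, L' ψ⟩` given by linear maps into spaces of continuous fields. -/
def pairForm (μ : Measure X) [IsFiniteMeasureOnCompacts μ] {S : Set X} (hS : IsCompact S)
    (hm : MeasurableSet S) (L L' : W →ₗ[ℝ] X → E) (hL : ∀ w, Continuous (L w))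
    (hL' : ∀ w, Continuous (L' w)) : W →ₗ[ℝ] W →ₗ[ℝ] ℝ :=
  have hi : ∀ v w, IntegrableOn (fun x => inner ℝ (L v x) (L' w x)) S μ := fun v w =>
    ((hL v).inner (hL' w)).continuousOn.integrableOn_compact' hS hm
  LinearMap.mk₂ ℝ (fun v w => ∫ x in S, inner ℝ (L v x) (L' w x) ∂μ)
    (fun v v' w => by
      rw [← integral_add (hi v w) (hi v' w)]
      simp [inner_add_left])
    (fun c v w => by
      rw [smul_eq_mul, ← integral_const_mul]
      simp [real_inner_smul_left])
    (fun v w w' => by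
      rw [← integral_add (hi v w) (hi v w')]
      simp [inner_add_right])
    (fun c v w => by
      rw [smul_eq_mul, ← integral_const_mul]
      simp [real_inner_smul_right])

end FiniteDim

/-! ### Inequalities on the reference element -/

section Reference

variable (K : ElemKind) (m p : ℕ)

/-- The gradient on `𝒫_p`. -/
def polyGradient : polySpace K (m + 1) p →ₗ[ℝ] Vec (m + 1) → Vec (m + 1) where
  toFun φ := gradient φ.1
  map_add' φ ψ := by
    have h : ∀ χ : polySpace K (m + 1) p, Differentiable ℝ χ.1 := fun χ =>
      (polySpace_contDiff χ.2 (n := 1)).differentiable one_ne_zero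
    funext x
    refine ext_inner_left ℝ fun w => ?_
    simp only [Pi.add_apply, inner_add_right, inner_gradient, Submodule.coe_add]
    rw [fderiv_add (h φ x) (h ψ x)]
    rfl
  map_smul' c φ := by
    have h : Differentiable ℝ φ.1 :=
      (polySpace_contDiff φ.2 (n := 1)).differentiable one_ne_zero
    funext x
    refine ext_inner_left ℝ fun w => ?_
    simp only [Pi.smul_apply, inner_smul_right, inner_gradient, Submodule.coe_smul,
      RingHom.id_apply]
    rw [fderiv_const_smul (h x)]
    rfl

theorem continuous_polyGradient (φ : polySpace K (m + 1) p) :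
    Continuous (polyGradient K m p φ) :=
  continuous_gradient (polySpace_contDiff φ.2)

/-- The bubble field of a polynomial. -/
def polyBubble : polySpace K (m + 1) p →ₗ[ℝ] Vec (m + 1) → Vec (m + 1) where
  toFun φ x := rtBubble K x (polyGradient K m p φ x)
  map_add' φ ψ := by funext x; simp [rtBubble_add]
  map_smul' c φ := by funext x; simp [rtBubble_smul]

theorem continuous_polyBubble (φ : polySpace K (m + 1) p) : Continuous (polyBubble K m p φ) :=
  continuous_rtBubble continuous_id (continuous_polyGradient K m p φ)

theorem closure_strict_refElem (d : ℕ) :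
    refElem K d ⊆
      closure {x : Vec d | ∀ F : RefFacet K d, inner ℝ (refNormal K F) x < refOffset K F} := by
  obtain ⟨c, hc⟩ := exists_strict_refElem K d
  intro x hx
  have hlim : Tendsto (fun t : ℝ => x + t • (c - x)) (𝓝[>] 0) (𝓝 x) := by
    have : Continuous fun t : ℝ => x + t • (c - x) := by fun_prop
    simpa using (this.tendsto 0).mono_left nhdsWithin_le_nhds
  refine mem_closure_of_tendsto hlim ?_
  filter_upwards [Ioo_mem_nhdsGT one_pos] with t ht F
  have h1 := hc F
  have h2 := hx F
  rw [inner_add_right, inner_smul_right, inner_sub_right]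
  nlinarith [ht.1, ht.2]

theorem integral_inner_bubble_nonneg (v : Vec (m + 1) → Vec (m + 1)) :
    0 ≤ ∫ x in refElem K (m + 1), inner ℝ (rtBubble K x (v x)) (v x) :=
  setIntegral_nonneg (isClosed_refElem K _).measurableSet fun _ hx => (inner_rtBubble_self hx _).1

/-- On polynomials, the gradient and the bubble field are controlled by their pairing. -/
theorem exists_bubble_bound : ∃ C : ℝ, 0 < C ∧ ∀ φ ∈ polySpace K (m + 1) p,
    ∫ x in refElem K (m + 1), ‖gradient φ x‖ ^ 2 ≤
      C * ∫ x in refElem K (m + 1), inner ℝ (rtBubble K x (gradient φ x)) (gradient φ x) ∧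
    ∫ x in refElem K (m + 1), ‖rtBubble K x (gradient φ x)‖ ^ 2 ≤
      C * ∫ x in refElem K (m + 1), inner ℝ (rtBubble K x (gradient φ x)) (gradient φ x) := by
  have hS := isCompact_refElem K (m + 1)
  have hm := (isClosed_refElem K (m + 1)).measurableSet
  have hG := continuous_polyGradient K m p
  have hB := continuous_polyBubble K m p
  let G := pairForm volume hS hm (polyGradient K m p) (polyGradient K m p) hG hG
  let B := pairForm volume hS hm (polyBubble K m p) (polyBubble K m p) hB hB
  let b := pairForm volume hS hm (polyBubble K m p) (polyGradient K m p) hB hG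
  have hbs : ∀ φ ψ, b φ ψ = b ψ φ := fun φ ψ =>
    integral_congr_ae (Eventually.of_forall fun x => inner_rtBubble_comm _ _ _)
  have hbn : ∀ φ, 0 ≤ b φ φ := fun φ => integral_inner_bubble_nonneg K m _
  -- A zero pairing makes the gradient vanish wherever the weight is definite, that is at the
  -- strictly interior points, and by continuity on the whole element.
  have hker : ∀ φ, b φ φ = 0 → Set.EqOn (polyGradient K m p φ) (fun _ => 0)
      (refElem K (m + 1)) := by
    intro φ h
    have h1 : (fun x => inner ℝ (polyBubble K m p φ x) (polyGradient K m p φ x))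
        =ᵐ[volume.restrict (refElem K (m + 1))] 0 := by
      refine (setIntegral_eq_zero_iff_of_nonneg_ae ?_
        (((hB φ).inner (hG φ)).continuousOn.integrableOn_compact hS)).1 h
      exact (ae_restrict_iff' hm).2 (Eventually.of_forall fun x hx => (inner_rtBubble_self hx _).1)
    have h2 := Measure.eqOn_of_ae_eq h1 ((hB φ).inner (hG φ)).continuousOn continuousOn_const
      (closure_interior_refElem K (m + 1)).ge
    have h3 : Set.EqOn (polyGradient K m p φ) (fun _ => 0)
        {x | ∀ F : RefFacet K (m + 1), inner ℝ (refNormal K F) x < refOffset K F} := by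
      intro x hx
      have hx' := interior_subset (strict_subset_interior K _ hx)
      exact (inner_rtBubble_self hx' _).2 hx (h2 hx')
    exact (h3.closure (hG φ) continuous_const).mono (closure_strict_refElem K _)
  obtain ⟨C, hC, h⟩ := exists_form_le_mod_ker (G + B) b hbs hbn
  have hGn : ∀ φ, G φ φ = ∫ x in refElem K (m + 1), ‖gradient φ.1 x‖ ^ 2 := fun φ =>
    integral_congr_ae (Eventually.of_forall fun x => real_inner_self_eq_norm_sq _)
  have hBn : ∀ φ, B φ φ = ∫ x in refElem K (m + 1), ‖rtBubble K x (gradient φ.1 x)‖ ^ 2 :=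
    fun φ => integral_congr_ae (Eventually.of_forall fun x => real_inner_self_eq_norm_sq _)
  refine ⟨C, hC, fun φ hφ => ?_⟩
  obtain ⟨ψ, h0, h1⟩ := h ⟨φ, hφ⟩
  -- The representative modulo the kernel has the same gradient on the element, so the bound for `ψ`
  -- is the bound for `φ`.
  have h2 : ∀ x ∈ refElem K (m + 1), gradient ψ.1 x = gradient φ x := fun x hx => by
    have h3 : polyGradient K m p (⟨φ, hφ⟩ - ψ) x = 0 := hker _ h0 hx
    rw [map_sub] at h3
    exact (sub_eq_zero.1 h3).symm
  have h3 : G ψ ψ = ∫ x in refElem K (m + 1), ‖gradient φ x‖ ^ 2 := by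
    rw [hGn]
    exact setIntegral_congr_fun hm fun x hx => by simp only [h2 x hx]
  have h4 : B ψ ψ = ∫ x in refElem K (m + 1), ‖rtBubble K x (gradient φ x)‖ ^ 2 := by
    rw [hBn]
    exact setIntegral_congr_fun hm fun x hx => by simp only [h2 x hx]
  have h5 : 0 ≤ G ψ ψ := h3 ▸ integral_nonneg fun x => sq_nonneg _
  have h6 : 0 ≤ B ψ ψ := h4 ▸ integral_nonneg fun x => sq_nonneg _
  have h7 : G ψ ψ + B ψ ψ ≤ C * ∫ x in refElem K (m + 1),
      inner ℝ (rtBubble K x (gradient φ x)) (gradient φ x) := h1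
  rw [← h3, ← h4]
  exact ⟨by linarith, by linarith⟩

variable {K m p} in
-- The trace on the facet does not bound a polynomial, but among the polynomials with a given trace
-- one can be chosen in a complement of the kernel of the trace, where the `L²` norm of the trace
-- dominates every form.
theorem exists_facet_lift_bound_aux (F : RefFacet K (m + 1)) {i : Fin (m + 1)}
    (hi : refNormal K F i ≠ 0) : ∃ C : ℝ, 0 < C ∧ ∀ φ ∈ polySpace K (m + 1) p,
      ∃ φ' ∈ polySpace K (m + 1) p, (∀ x ∈ refFace K {F}, φ' x = φ x) ∧
        ∫ x in refElem K (m + 1), ‖φ' x • rtLift K F x‖ ^ 2 ≤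
          C * ∫ y in refElem K m, φ (ins i (facetHeight F i y) y) ^ 2 := by
  let L : polySpace K (m + 1) p →ₗ[ℝ] Vec (m + 1) → Vec (m + 1) :=
    { toFun := fun φ x => φ.1 x • rtLift K F x
      map_add' := fun φ ψ => by funext x; simp [add_smul]
      map_smul' := fun c φ => by funext x; simp [mul_smul] }
  let P : polySpace K (m + 1) p →ₗ[ℝ] Vec m → ℝ :=
    { toFun := fun φ y => φ.1 (ins i (facetHeight F i y) y)
      map_add' := fun φ ψ => rfl
      map_smul' := fun c φ => rfl }
  have hc : ∀ φ : polySpace K (m + 1) p, Continuous φ.1 := fun φ =>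
    (polySpace_contDiff φ.2 (n := 0)).continuous
  have hL : ∀ φ, Continuous (L φ) := fun φ => (hc φ).smul (continuous_rtLift F)
  have hP : ∀ φ, Continuous (P φ) := fun φ => by
    have h1 := continuous_facetHeight F i
    exact (hc φ).comp (by fun_prop)
  have hS := isCompact_refElem K m
  have hm := (isClosed_refElem K m).measurableSet
  let a := pairForm volume (isCompact_refElem K (m + 1)) (isClosed_refElem K (m + 1)).measurableSet
    L L hL hL
  let b := pairForm volume hS hm P P hP hP
  have hbn : ∀ φ, b φ φ = ∫ y in refElem K m, φ.1 (ins i (facetHeight F i y) y) ^ 2 := fun φ =>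
    integral_congr_ae (Eventually.of_forall fun y => by
      simp only [P, LinearMap.coe_mk, AddHom.coe_mk, real_inner_self_eq_norm_sq,
        Real.norm_eq_abs, sq_abs])
  have han : ∀ φ, a φ φ = ∫ x in refElem K (m + 1), ‖φ.1 x • rtLift K F x‖ ^ 2 := fun φ =>
    integral_congr_ae (Eventually.of_forall fun x => real_inner_self_eq_norm_sq _)
  obtain ⟨C, hC, h⟩ := exists_form_le_mod_ker a b
    (fun φ ψ => integral_congr_ae (Eventually.of_forall fun y => real_inner_comm _ _))
    (fun φ => hbn φ ▸ integral_nonneg fun y => sq_nonneg _)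
  refine ⟨C, hC, fun φ hφ => ?_⟩
  obtain ⟨ψ, h0, h1⟩ := h ⟨φ, hφ⟩
  rw [hbn, han] at h1
  refine ⟨ψ.1, ψ.2, ?_, h1⟩
  rw [hbn] at h0
  have h2 := (setIntegral_eq_zero_iff_of_nonneg_ae (f := fun y => P (⟨φ, hφ⟩ - ψ) y ^ 2)
    (Eventually.of_forall fun y => sq_nonneg _)
    (((hP _).pow 2).continuousOn.integrableOn_compact hS)).1 h0
  replace h2 := Measure.eqOn_of_ae_eq h2 ((hP _).pow 2).continuousOn continuousOn_const
    (closure_interior_refElem K m).ge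
  intro x hx
  rw [refFace_eq_image hi] at hx
  obtain ⟨y, hy, rfl⟩ := hx
  have h3 := pow_eq_zero_iff two_ne_zero |>.1 (h2 hy)
  exact (sub_eq_zero.1 h3).symm

/-- Polynomials on a facet extend to the element, with a bound on the lifted field. -/
theorem exists_facet_lift_bound : ∃ C : ℝ, 0 < C ∧ ∀ F : RefFacet K (m + 1), ∃ i : Fin (m + 1),
    refNormal K F i ≠ 0 ∧ ∀ φ ∈ polySpace K (m + 1) p,
      ∃ φ' ∈ polySpace K (m + 1) p, (∀ x ∈ refFace K {F}, φ' x = φ x) ∧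
        ∫ x in refElem K (m + 1), ‖φ' x • rtLift K F x‖ ^ 2 ≤
          C * ∫ y in refElem K m, φ (ins i (facetHeight F i y) y) ^ 2 := by
  choose i hi using exists_refNormal_ne (K := K) (m := m)
  choose C hC h using fun F => exists_facet_lift_bound_aux (p := p) F (hi F)
  have hle : ∀ F, C F ≤ 1 + ∑ F, C F := fun F => by
    have := Finset.single_le_sum (f := C) (fun F _ => (hC F).le) (Finset.mem_univ F)
    linarith
  refine ⟨1 + ∑ F, C F, by have := Finset.sum_nonneg (fun F (_ : F ∈ Finset.univ) => (hC F).le);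
                           linarith, fun F => ⟨i F, hi F, fun φ hφ => ?_⟩⟩
  obtain ⟨φ', h1, h2, h3⟩ := h F φ hφ
  exact ⟨φ', h1, h2, h3.trans
    (mul_le_mul_of_nonneg_right (hle F) (integral_nonneg fun y => sq_nonneg _))⟩

end Reference

/-! ### Shape regularity -/

section Shape

theorem norm_le_of_ball {d : ℕ} {L : Vec d ≃ₗ[ℝ] Vec d} {ρ h : ℝ} (hρ : 0 < ρ)
    (hL : ∀ v, ‖v‖ ≤ ρ → ‖L v‖ ≤ h) (v : Vec d) : ‖L v‖ ≤ h / ρ * ‖v‖ := by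
  by_cases hv : v = 0
  · simp [hv]
  have hv' : 0 < ‖v‖ := norm_pos_iff.2 hv
  have h1 := hL ((ρ / ‖v‖) • v) (by
    rw [norm_smul, Real.norm_of_nonneg (by positivity)]
    field_simp; rfl)
  rw [map_smul, norm_smul, Real.norm_of_nonneg (by positivity)] at h1
  rw [div_mul_eq_mul_div, le_div_iff₀ hρ]
  rw [div_mul_eq_mul_div, div_le_iff₀ hv'] at h1
  linarith

variable {K : ElemKind} {m : ℕ} {Ω : Set (Vec (m + 1))} {M : Mesh K (m + 1) Ω}

/-- `β` and `γ` bound the linear part of the affine map of `T` and its inverse, and `κ` bounds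
its condition number. -/
structure Mesh.IsScaling (M : Mesh K (m + 1) Ω) (κ : ℝ) (T : M.Elem) (β γ : ℝ) : Prop where
  pos : 0 < β
  pos_inv : 0 < γ
  norm_le (v : Vec (m + 1)) : ‖(M.Φ T).linear v‖ ≤ β * ‖v‖
  norm_symm_le (v : Vec (m + 1)) : ‖(M.Φ T).linear.symm v‖ ≤ γ * ‖v‖
  mul_le : β * γ ≤ κ

theorem Mesh.norm_linear_le (T : M.Elem) {c : Vec (m + 1)} {ρ : ℝ} (hρ : 0 < ρ)
    (hball : Metric.closedBall c ρ ⊆ refElem K (m + 1)) (v : Vec (m + 1)) :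
    ‖(M.Φ T).linear v‖ ≤ Metric.diam (M.elem T) / ρ * ‖v‖ := by
  refine norm_le_of_ball (L := (M.Φ T).linear) hρ (fun v hv => ?_) v
  have h2 : c + v ∈ refElem K (m + 1) := hball (by simpa using hv)
  have h3 : c ∈ refElem K (m + 1) := hball (Metric.mem_closedBall_self hρ.le)
  have h4 := Metric.dist_le_diam_of_mem (M.isCompact_elem T).isBounded
    (Set.mem_image_of_mem (M.Φ T) h2) (Set.mem_image_of_mem (M.Φ T) h3)
  rw [dist_eq_norm, affine_sub, add_sub_cancel_left] at h4
  exact h4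

theorem Mesh.norm_linear_symm_le (T : M.Elem) {c : Vec (m + 1)} {ρ : ℝ} (hρ : 0 < ρ)
    (hball : Metric.closedBall c ρ ⊆ M.elem T) (v : Vec (m + 1)) :
    ‖(M.Φ T).linear.symm v‖ ≤ Metric.diam (refElem K (m + 1)) / ρ * ‖v‖ := by
  refine norm_le_of_ball (L := (M.Φ T).linear.symm) hρ (fun v hv => ?_) v
  obtain ⟨x, hx, hx'⟩ := hball (show c + v ∈ _ by simpa using hv)
  obtain ⟨y, hy, hy'⟩ := hball (Metric.mem_closedBall_self hρ.le)
  have h4 := Metric.dist_le_diam_of_mem (isCompact_refElem K (m + 1)).isBounded hx hy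
  have h6 : x - y = (linPart (M.Φ T)).symm v := by
    rw [ContinuousLinearEquiv.eq_symm_apply, ← affine_sub, hx', hy', add_sub_cancel_left]
  rw [dist_eq_norm, h6] at h4
  exact h4

/-- On a shape regular mesh, the condition numbers of the affine maps are bounded. -/
theorem exists_scaling (K : ElemKind) (m : ℕ) (σ : ℝ) :
    ∃ κ : ℝ, 0 < κ ∧ ∀ (Ω : Set (Vec (m + 1))) (M : Mesh K (m + 1) Ω), M.ShapeRegular σ →
      ∀ T, ∃ β γ, M.IsScaling κ T β γ := by
  obtain ⟨c, hc⟩ := interior_refElem_nonempty K (m + 1)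
  obtain ⟨ρ, hρ, hball⟩ := Metric.nhds_basis_closedBall.mem_iff.1 (mem_interior_iff_mem_nhds.1 hc)
  have hD : 0 ≤ Metric.diam (refElem K (m + 1)) := Metric.diam_nonneg
  generalize hDe : Metric.diam (refElem K (m + 1)) = D at hD
  -- With a ball of radius `ρ` in the reference element and `D` its diameter, the linear part is
  -- bounded by `h / ρ` and its inverse by `D σ / h`; the product does not see `h`. The ones and the
  -- absolute value ensure positivity before a mesh, and hence the sign of `σ`, is known.
  refine ⟨(D + 1) * (|σ| + 1) / ρ, by positivity, ?_⟩
  rintro Ω M ⟨hσ, hM⟩ T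
  obtain ⟨c', hc'⟩ := hM T
  have hb := M.norm_linear_le T hρ hball
  have h0 : 0 ≤ Metric.diam (M.elem T) := Metric.diam_nonneg
  have hg := fun hρ => M.norm_linear_symm_le T hρ hc'
  rw [hDe] at hg
  generalize Metric.diam (M.elem T) = h at hb h0 hg
  have hpos : 0 < h := by
    refine lt_of_le_of_ne h0 fun h2 => ?_
    have h3 := hb (EuclideanSpace.single 0 1)
    rw [← h2, zero_div, zero_mul, norm_le_zero_iff] at h3
    have h4 := (M.Φ T).linear.map_eq_zero_iff.1 h3
    simpa using congrArg norm h4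
  refine ⟨h / ρ, (D + 1) / (h / σ), by positivity, by positivity, hb, fun v => ?_, ?_⟩
  · refine (hg (by positivity) v).trans ?_
    gcongr
    linarith
  · rw [abs_of_pos hσ]
    have : h / ρ * ((D + 1) / (h / σ)) = (D + 1) * σ / ρ := by field_simp
    rw [this]
    gcongr
    linarith

/-- The facet is a graph over the `m`-dimensional reference element, which contains the origin and a
unit vector. Dimension at least two matters here: the facets of an interval are points, of diameter
zero. -/
theorem exists_dist_refFace (hm : 1 ≤ m) (F : RefFacet K (m + 1)) :
    ∃ x ∈ refFace K {F}, ∃ y ∈ refFace K {F}, 1 ≤ ‖x - y‖ := by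
  obtain ⟨i, hi⟩ := exists_refNormal_ne F
  obtain ⟨n, rfl⟩ : ∃ n, m = n + 1 := ⟨m - 1, by omega⟩
  have h0 : (0 : Vec (n + 1)) ∈ refElem K (n + 1) := by
    cases K
    · exact mem_refElem_simplex.2 ⟨by simp, by simp⟩
    · exact mem_refElem_cube.2 (by simp)
  have h1 : (EuclideanSpace.single 0 1 : Vec (n + 1)) ∈ refElem K (n + 1) := by
    cases K
    · refine mem_refElem_simplex.2 ⟨by simp, fun i => ?_⟩
      simp only [PiLp.single_apply]; split_ifs <;> norm_num
    · refine mem_refElem_cube.2 fun i => ?_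
      simp only [PiLp.single_apply]; split_ifs <;> norm_num
  rw [refFace_eq_image hi]
  refine ⟨_, ⟨_, h1, rfl⟩, _, ⟨_, h0, rfl⟩, ?_⟩
  refine le_trans ?_ (PiLp.norm_apply_le _ (i.succAbove 0))
  simp

/-- Two points of the reference facet at distance at least `1` have images within the diameter of
the facet, and the inverse map stretches by at most `γ`. -/
theorem Mesh.IsScaling.inv_diam_facet_le {κ β γ : ℝ} {s : M.Side} (h : M.IsScaling κ s.1 β γ)
    (hm : 1 ≤ m) : 0 < Metric.diam (M.facet s) ∧ (Metric.diam (M.facet s))⁻¹ ≤ γ := by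
  obtain ⟨x, hx, y, hy, hxy⟩ := exists_dist_refFace hm s.2
  have h1 := Metric.dist_le_diam_of_mem (M.isCompact_facet s).isBounded
    (Set.mem_image_of_mem (M.Φ s.1) hx) (Set.mem_image_of_mem (M.Φ s.1) hy)
  rw [dist_eq_norm, affine_sub] at h1
  have h2 := h.norm_symm_le ((M.Φ s.1).linear (x - y))
  rw [LinearEquiv.symm_apply_apply] at h2
  have h3 : 1 ≤ γ * Metric.diam (M.facet s) :=
    (hxy.trans h2).trans (mul_le_mul_of_nonneg_left h1 h.pos_inv.le)
  have h4 : 0 < Metric.diam (M.facet s) := by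
    by_contra hh
    have : γ * Metric.diam (M.facet s) ≤ 0 :=
      mul_nonpos_of_nonneg_of_nonpos h.pos_inv.le (not_lt.1 hh)
    linarith
  refine ⟨h4, ?_⟩
  rw [inv_eq_one_div, div_le_iff₀ h4]
  exact h3

theorem norm_refNormal_le (F : RefFacet K (m + 1)) : ‖refNormal K F‖ ^ 2 ≤ m + 1 := by
  rw [EuclideanSpace.norm_sq_eq]
  have : ∀ i ∈ Finset.univ, ‖refNormal K F i‖ ^ 2 ≤ 1 := fun i _ => by
    by_cases h : refNormal K F i = 0
    · simp [h]
    · rw [Real.norm_eq_abs, abs_refNormal_eq_one h]; norm_num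
  simpa using Finset.sum_le_card_nsmul _ _ _ this

theorem Mesh.IsScaling.norm_conormal_le {κ β γ : ℝ} {s : M.Side} (h : M.IsScaling κ s.1 β γ) :
    ‖M.conormal s‖ ≤ γ * (m + 1) := by
  have h1 : ‖refNormal K s.2‖ ≤ m + 1 := by
    have := norm_refNormal_le s.2
    nlinarith [norm_nonneg (refNormal K s.2), (Nat.cast_nonneg m : (0 : ℝ) ≤ m)]
  have h2 : ‖M.conormal s‖ ^ 2 = inner ℝ (refNormal K s.2)
      ((M.Φ s.1).linear.symm (M.conormal s)) := by
    rw [← real_inner_self_eq_norm_sq, M.inner_conormal]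
  have h3 := real_inner_le_norm (refNormal K s.2) ((M.Φ s.1).linear.symm (M.conormal s))
  have h4 := h.norm_symm_le (M.conormal s)
  have h5 := M.norm_conormal_pos s
  have h6 : ‖M.conormal s‖ ^ 2 ≤ (m + 1) * (γ * ‖M.conormal s‖) := by
    rw [h2]
    exact h3.trans (mul_le_mul h1 h4 (norm_nonneg _) (by positivity))
  nlinarith

theorem inner_gradient_comp (T : M.Elem) {v : Vec (m + 1) → ℝ} (hv : ContDiff ℝ 1 v)
    (w x : Vec (m + 1)) :
    inner ℝ ((M.Φ T).linear w) (gradient v (M.Φ T x)) = inner ℝ w (gradient (v ∘ M.Φ T) x) := by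
  rw [inner_gradient, inner_gradient, fderiv_comp x (hv.differentiable one_ne_zero _)
    (hasFDerivAt_affine _ x).differentiableAt, (hasFDerivAt_affine _ x).fderiv]
  rfl

/-- Gradients transform by the inverse transpose. Pairing the chain rule with the preimage of the
gradient itself avoids a bound for the transpose. -/
theorem Mesh.IsScaling.norm_gradient_le {κ β γ : ℝ} {T : M.Elem} (h : M.IsScaling κ T β γ)
    {v : Vec (m + 1) → ℝ} (hv : ContDiff ℝ 1 v) (x : Vec (m + 1)) :
    ‖gradient v (M.Φ T x)‖ ≤ γ * ‖gradient (v ∘ M.Φ T) x‖ := by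
  have h1 := inner_gradient_comp T hv ((M.Φ T).linear.symm (gradient v (M.Φ T x))) x
  rw [LinearEquiv.apply_symm_apply, real_inner_self_eq_norm_sq] at h1
  have h2 := real_inner_le_norm ((M.Φ T).linear.symm (gradient v (M.Φ T x)))
    (gradient (v ∘ M.Φ T) x)
  have h3 := h.norm_symm_le (gradient v (M.Φ T x))
  have h4 : 0 ≤ ‖gradient (v ∘ M.Φ T) x‖ := norm_nonneg _
  have h5 : 0 ≤ ‖gradient v (M.Φ T x)‖ := norm_nonneg _
  have h6 := mul_le_mul_of_nonneg_right h3 h4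
  have h7 := mul_nonneg h.pos_inv.le h4
  by_contra! hlt
  nlinarith

end Shape

/-! ### Stability of the divergence in the DG norm -/

section Stability

variable {K : ElemKind} {m p : ℕ} {Ω : Set (Vec (m + 1))} {M : Mesh K (m + 1) Ω}

variable (M) in
/-- The squared `L²` norm of the piecewise gradient. -/
def Mesh.gradSq (w : M.ScalarFn) : ℝ := ∑ T, ∫ x in M.elem T, ‖gradient (w T) x‖ ^ 2

variable (M) in
open scoped Classical in
/-- The jump part of the squared DG norm. -/
def Mesh.jumpSq (w : M.ScalarFn) : ℝ :=
  (1 / 2) * (∑ s : M.Side, ∑ t : M.Side, if M.Adj s t then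
    (Metric.diam (M.facet s))⁻¹ * ∫ x, (w s.1 x - w t.1 x) ^ 2 ∂(M.surf s) else 0) +
  ∑ s : M.Side, if M.IsBdry s then
    (Metric.diam (M.facet s))⁻¹ * ∫ x, (w s.1 x) ^ 2 ∂(M.surf s) else 0

/-- Division of `X² ≤ C N X` by `X`. It serves for a test field whose pairing `X` also bounds its
squared norm `R`. -/
theorem le_mul_of_sq_le {X N R C : ℝ} (hX : 0 ≤ X) (hN : 0 ≤ N) (hC : 0 ≤ C)
    (h : X ^ 2 ≤ N * R) (hR : R ≤ C * X) : X ≤ C * N := by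
  rcases hX.eq_or_lt with rfl | hX
  · positivity
  have h1 : N * R ≤ N * (C * X) := mul_le_mul_of_nonneg_left hR hN
  by_contra! hlt
  nlinarith [mul_lt_mul_of_pos_right hlt hX]

/-- The test with bubble fields on one element. -/
theorem exists_local_bubble {κ β γ C : ℝ} {T : M.Elem} (hs : M.IsScaling κ T β γ)
    (hb : ∀ φ ∈ polySpace K (m + 1) p,
      ∫ x in refElem K (m + 1), ‖gradient φ x‖ ^ 2 ≤
        C * ∫ x in refElem K (m + 1), inner ℝ (rtBubble K x (gradient φ x)) (gradient φ x) ∧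
      ∫ x in refElem K (m + 1), ‖rtBubble K x (gradient φ x)‖ ^ 2 ≤
        C * ∫ x in refElem K (m + 1), inner ℝ (rtBubble K x (gradient φ x)) (gradient φ x))
    {v : Vec (m + 1) → ℝ} (hv : v ∈ M.localPoly p T) :
    ∃ r ∈ (refRTSub K (m + 1) p).map (piola (M.Φ T)),
      (∀ F, ∀ x ∈ M.facet (T, F), inner ℝ (r x) (M.normal (T, F)) = 0) ∧
      0 ≤ ∫ x in M.elem T, inner ℝ (r x) (gradient v x) ∧
      ∫ x in M.elem T, ‖r x‖ ^ 2 ≤ C * ∫ x in M.elem T, inner ℝ (r x) (gradient v x) ∧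
      ∫ x in M.elem T, ‖gradient v x‖ ^ 2 ≤
        κ ^ 2 * C * ∫ x in M.elem T, inner ℝ (r x) (gradient v x) := by
  have hv1 : ContDiff ℝ 1 v := Mesh.contDiff_of_mem_localPoly hv
  obtain ⟨φ, hφ, hvφ⟩ := M.mem_localPoly.1 hv
  have hcomp : v ∘ M.Φ T = φ := by funext x; simp [hvφ]
  have hφ1 : Continuous (gradient φ) := continuous_gradient (polySpace_contDiff hφ)
  have hbub : Continuous fun x => rtBubble K x (gradient φ x) :=
    continuous_rtBubble continuous_id hφ1
  have hβ := hs.pos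
  have hdet := M.det_ne_zero T
  -- The determinant cancels the Piola factor. With the factor `β⁻²` the squared norm scales like
  -- `β⁻⁴ β² = β⁻²`, as does the pairing with the gradient, so their ratio does not see the mesh
  -- size.
  let r' : Vec (m + 1) → Vec (m + 1) :=
    (M.det T * β⁻¹ ^ 2) • fun x => rtBubble K x (gradient φ x)
  let r := piola (M.Φ T) r'
  have hr : ∀ x, r (M.Φ T x) = (β⁻¹ ^ 2) • (M.Φ T).linear (rtBubble K x (gradient φ x)) := by
    intro x
    simp only [r, r', piola, LinearMap.coe_mk, AddHom.coe_mk, AffineEquiv.symm_apply_apply,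
      Pi.smul_apply, map_smul, smul_smul]
    congr 1
    rw [show LinearMap.det ((M.Φ T).linear : Vec (m + 1) →ₗ[ℝ] Vec (m + 1)) = M.det T from rfl]
    field_simp
  obtain ⟨hb1, hb2⟩ := hb φ hφ
  have hb0 := integral_inner_bubble_nonneg K m (gradient φ)
  set b := ∫ x in refElem K (m + 1), inner ℝ (rtBubble K x (gradient φ x)) (gradient φ x) with hbdef
  have hD : 0 < |M.det T| := abs_pos.2 hdet
  have hX : ∫ x in M.elem T, inner ℝ (r x) (gradient v x) = |M.det T| * (β⁻¹ ^ 2 * b) := by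
    rw [M.setIntegral_elem, hbdef, ← integral_const_mul (β⁻¹ ^ 2)]
    congr 1
    refine integral_congr_ae (Eventually.of_forall fun x => ?_)
    simp only
    rw [hr, real_inner_smul_left, inner_gradient_comp T hv1, hcomp]
  have hS := isCompact_refElem K (m + 1)
  refine ⟨r, ⟨r', (refRTSub K (m + 1) p).smul_mem _ (rtBubble_mem hφ), rfl⟩, ?_, ?_, ?_, ?_⟩
  · intro F x hx
    rw [M.inner_piola_normal (T, F)]
    simp only [r', Pi.smul_apply, inner_smul_right]
    rw [inner_rtBubble_normal (M.mem_facet.1 hx).2, mul_zero, mul_zero]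
  · rw [hX]; positivity
  · rw [hX, M.setIntegral_elem]
    have h1 : ∫ x in refElem K (m + 1), ‖r (M.Φ T x)‖ ^ 2 ≤
        ∫ x in refElem K (m + 1), β⁻¹ ^ 2 * ‖rtBubble K x (gradient φ x)‖ ^ 2 := by
      refine integral_mono_of_nonneg (Eventually.of_forall fun x => sq_nonneg _)
        ((continuous_const.mul (hbub.norm.pow 2)).continuousOn.integrableOn_compact hS)
        (Eventually.of_forall fun x => ?_)
      simp only
      rw [hr, norm_smul, Real.norm_of_nonneg (by positivity)]
      have h2 := hs.norm_le (rtBubble K x (gradient φ x))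
      calc (β⁻¹ ^ 2 * ‖(M.Φ T).linear (rtBubble K x (gradient φ x))‖) ^ 2
          ≤ (β⁻¹ ^ 2 * (β * ‖rtBubble K x (gradient φ x)‖)) ^ 2 := by gcongr
        _ = β⁻¹ ^ 2 * ‖rtBubble K x (gradient φ x)‖ ^ 2 := by field_simp
    rw [integral_const_mul] at h1
    calc |M.det T| * ∫ x in refElem K (m + 1), ‖r (M.Φ T x)‖ ^ 2
        ≤ |M.det T| * (β⁻¹ ^ 2 * (C * b)) := by
          refine mul_le_mul_of_nonneg_left (h1.trans ?_) hD.le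
          exact mul_le_mul_of_nonneg_left hb2 (by positivity)
      _ = C * (|M.det T| * (β⁻¹ ^ 2 * b)) := by ring
  · rw [hX, M.setIntegral_elem]
    have h1 : ∫ x in refElem K (m + 1), ‖gradient v (M.Φ T x)‖ ^ 2 ≤
        ∫ x in refElem K (m + 1), γ ^ 2 * ‖gradient φ x‖ ^ 2 := by
      refine integral_mono_of_nonneg (Eventually.of_forall fun x => sq_nonneg _)
        ((continuous_const.mul (hφ1.norm.pow 2)).continuousOn.integrableOn_compact hS)
        (Eventually.of_forall fun x => ?_)
      have h2 := hs.norm_gradient_le hv1 x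
      rw [hcomp] at h2
      simp only
      rw [← mul_pow]
      gcongr
    rw [integral_const_mul] at h1
    have h3 : γ ^ 2 ≤ κ ^ 2 * β⁻¹ ^ 2 := by
      have h4 := hs.mul_le
      have h5 := hs.pos_inv
      rw [inv_pow, ← div_eq_mul_inv, le_div_iff₀ (by positivity), ← mul_pow, mul_comm γ]
      gcongr
    calc |M.det T| * ∫ x in refElem K (m + 1), ‖gradient v (M.Φ T x)‖ ^ 2
        ≤ |M.det T| * ((κ ^ 2 * β⁻¹ ^ 2) * (C * b)) := by
          refine mul_le_mul_of_nonneg_left (h1.trans ?_) hD.le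
          exact mul_le_mul h3 hb1 (integral_nonneg fun x => sq_nonneg _) (by positivity)
      _ = κ ^ 2 * C * (|M.det T| * (β⁻¹ ^ 2 * b)) := by ring

theorem Mesh.integral_surf_congr (s : M.Side) {f g : Vec (m + 1) → ℝ}
    (h : ∀ x ∈ M.facet s, f x = g x) : ∫ x, f x ∂(M.surf s) = ∫ x, g x ∂(M.surf s) :=
  setIntegral_congr_fun (M.isCompact_facet s).measurableSet h

/-- The bubble fields of all elements together form a field in `Σ_{h,div}^p`, because all their
normal components vanish. For the same reason integration by parts leaves only the pairing with the
piecewise gradient, which controls both the field and the gradient. -/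
theorem exists_gradSq_bound (K : ElemKind) (m p : ℕ) {κ : ℝ} (hκ : 0 < κ) : ∃ C : ℝ, 0 < C ∧
    ∀ (Ω : Set (Vec (m + 1))) (M : Mesh K (m + 1) Ω), (∀ T, ∃ β γ, M.IsScaling κ T β γ) →
      ∀ w ∈ M.V p, ∀ N : ℝ, 0 ≤ N →
        (∀ r ∈ M.SigDiv p, M.l2 (M.dvg r) w ^ 2 ≤ N * M.fieldSq r) → M.gradSq w ≤ C * N := by
  obtain ⟨C, hC, hb⟩ := exists_bubble_bound K m p
  refine ⟨κ ^ 2 * C * C, by positivity, fun Ω M hM w hw N hN h => ?_⟩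
  choose β γ hs using hM
  choose r hr hn h0 h1 h2 using fun T => exists_local_bubble (hs T) hb (M.mem_V.1 hw T)
  have hrS : r ∈ M.Sig p := M.mem_Sig.2 hr
  have hrD : r ∈ M.SigDiv p := by
    refine ⟨hrS, fun s t hst x hx => ?_⟩
    have h3 := hn s.1 s.2 x hx
    have h4 := hn t.1 t.2 x (hst.2 ▸ hx)
    have h5 : inner ℝ (r t.1 x) (M.normal t) = 0 := h4
    rw [hst.normal_eq, inner_neg_right, neg_eq_zero] at h5
    rw [inner_sub_left, h5, sub_zero]
    exact h3
  set X := ∑ T, ∫ x in M.elem T, inner ℝ (r T x) (gradient (w T) x) with hX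
  have hX0 : 0 ≤ X := Finset.sum_nonneg fun T _ => h0 T
  have h3 : M.l2 (M.dvg r) w = -X := by
    rw [M.l2_dvg (fun T => Mesh.contDiff_of_mem_Sig hrS T)
      (fun T => Mesh.contDiff_of_mem_V hw T), Finset.sum_eq_zero (s := Finset.univ (α := M.Side)),
      add_zero]
    intro s _
    rw [M.integral_surf_congr s (g := fun _ => 0), integral_zero]
    intro x hx
    have h6 : inner ℝ (r s.1 x) (M.normal s) = 0 := hn s.1 s.2 x hx
    rw [h6, mul_zero]
  have h4 := h r hrD
  rw [h3, neg_sq] at h4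
  have h5 : M.fieldSq r ≤ C * X := by
    rw [hX, Finset.mul_sum]
    exact Finset.sum_le_sum fun T _ => h1 T
  have h6 := le_mul_of_sq_le hX0 hN hC.le h4 h5
  calc M.gradSq w ≤ κ ^ 2 * C * X := by
        rw [hX, Finset.mul_sum]
        exact Finset.sum_le_sum fun T _ => h2 T
    _ ≤ κ ^ 2 * C * (C * N) := by gcongr
    _ = κ ^ 2 * C * C * N := by ring

/-- The lift of a polynomial from one side. -/
theorem exists_local_lift {κ β γ C : ℝ} {s : M.Side} (hs : M.IsScaling κ s.1 β γ) (hm : 1 ≤ m)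
    (hC : 0 < C) (hb : ∃ i : Fin (m + 1), refNormal K s.2 i ≠ 0 ∧ ∀ φ ∈ polySpace K (m + 1) p,
      ∃ φ' ∈ polySpace K (m + 1) p, (∀ x ∈ refFace K {s.2}, φ' x = φ x) ∧
        ∫ x in refElem K (m + 1), ‖φ' x • rtLift K s.2 x‖ ^ 2 ≤
          C * ∫ y in refElem K m, φ (ins i (facetHeight s.2 i y) y) ^ 2)
    {z : Vec (m + 1) → ℝ} (hz : z ∈ M.localPoly p s.1) :
    ∃ r ∈ (refRTSub K (m + 1) p).map (piola (M.Φ s.1)),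
      (∀ x ∈ M.facet s, inner ℝ (r x) (M.normal s) = (Metric.diam (M.facet s))⁻¹ * z x) ∧
      (∀ F, F ≠ s.2 → ∀ x ∈ M.facet (s.1, F), inner ℝ (r x) (M.normal (s.1, F)) = 0) ∧
      ∫ x in M.elem s.1, ‖r x‖ ^ 2 ≤
        κ ^ 2 * (m + 1) * C * ((Metric.diam (M.facet s))⁻¹ * ∫ x, z x ^ 2 ∂(M.surf s)) := by
  obtain ⟨φ, hφ, rfl⟩ := M.mem_localPoly.1 hz
  obtain ⟨i, hi, hb⟩ := hb
  obtain ⟨φ', hφ', heq, hle⟩ := hb φ hφ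
  obtain ⟨hE, hEγ⟩ := hs.inv_diam_facet_le hm
  have hcon := hs.norm_conormal_le
  have hcon0 := M.norm_conormal_pos s
  have hβ := hs.pos
  have hγ := hs.pos_inv
  have hdet := M.det_ne_zero s.1
  have hD : 0 < |M.det s.1| := abs_pos.2 hdet
  set h := Metric.diam (M.facet s)
  set n := ‖M.conormal s‖
  -- The determinant and the norm `n` of the conormal cancel in the normal component of the Piola
  -- transform, which leaves `h⁻¹ z` on the facet.
  let r' : Vec (m + 1) → Vec (m + 1) := (M.det s.1 * (n * h⁻¹)) • fun x => φ' x • rtLift K s.2 x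
  let r := piola (M.Φ s.1) r'
  have hr : ∀ x, r (M.Φ s.1 x) = (n * h⁻¹) • (M.Φ s.1).linear (φ' x • rtLift K s.2 x) := by
    intro x
    simp only [r, r', piola, LinearMap.coe_mk, AddHom.coe_mk, AffineEquiv.symm_apply_apply,
      Pi.smul_apply, map_smul, smul_smul]
    congr 1
    rw [show LinearMap.det ((M.Φ s.1).linear : Vec (m + 1) →ₗ[ℝ] Vec (m + 1)) =
      M.det s.1 from rfl]
    field_simp
  have hcl : Continuous fun x => φ' x • rtLift K s.2 x :=
    (polySpace_contDiff hφ' (n := 0)).continuous.smul (continuous_rtLift _)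
  refine ⟨r, ⟨r', (refRTSub K (m + 1) p).smul_mem _ (rtLift_mem s.2 hφ'), rfl⟩, ?_, ?_, ?_⟩
  · intro x hx
    have hx' := M.mem_facet.1 hx
    rw [M.inner_piola_normal s]
    simp only [r', Pi.smul_apply, inner_smul_right]
    rw [inner_rtLift_same s.2 hx'.2, heq _ (mem_refFace_singleton.2 hx')]
    change (M.det s.1)⁻¹ * n⁻¹ * _ = _
    field_simp
  · intro F hF x hx
    rw [M.inner_piola_normal (s.1, F)]
    simp only [r', Pi.smul_apply, inner_smul_right]
    rw [inner_rtLift_other hF (M.mem_facet.1 hx).2]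
    simp
  · rw [M.setIntegral_elem, M.integral_surf s hi]
    simp only [AffineEquiv.symm_apply_apply]
    set b := ∫ y in refElem K m, φ (ins i (facetHeight s.2 i y) y) ^ 2
    have hb0 : 0 ≤ b := integral_nonneg fun y => sq_nonneg _
    have h1 : ∫ x in refElem K (m + 1), ‖r (M.Φ s.1 x)‖ ^ 2 ≤
        ∫ x in refElem K (m + 1), (n * h⁻¹ * β) ^ 2 * ‖φ' x • rtLift K s.2 x‖ ^ 2 := by
      refine integral_mono_of_nonneg (Eventually.of_forall fun x => sq_nonneg _)
        ((continuous_const.mul (hcl.norm.pow 2)).continuousOn.integrableOn_compact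
          (isCompact_refElem K _)) (Eventually.of_forall fun x => ?_)
      simp only
      rw [hr, norm_smul, Real.norm_of_nonneg (by positivity), ← mul_pow, mul_assoc (n * h⁻¹)]
      have h2 := hs.norm_le (φ' x • rtLift K s.2 x)
      gcongr
    rw [integral_const_mul] at h1
    -- Both `n` and `h⁻¹` are of the order of `γ`, so only the condition number `β γ` enters.
    have h3 : n * h⁻¹ * β ^ 2 ≤ κ ^ 2 * (m + 1) := by
      calc n * h⁻¹ * β ^ 2 ≤ (γ * (m + 1)) * γ * β ^ 2 := by gcongr
        _ = (β * γ) ^ 2 * (m + 1) := by ring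
        _ ≤ κ ^ 2 * (m + 1) := by
          have := hs.mul_le
          gcongr
    calc |M.det s.1| * ∫ x in refElem K (m + 1), ‖r (M.Φ s.1 x)‖ ^ 2
        ≤ |M.det s.1| * ((n * h⁻¹ * β) ^ 2 * (C * b)) := by
          refine mul_le_mul_of_nonneg_left (h1.trans ?_) hD.le
          exact mul_le_mul_of_nonneg_left hle (by positivity)
      _ = (n * h⁻¹ * β ^ 2) * (C * (h⁻¹ * (|M.det s.1| * n * b))) := by ring
      _ ≤ (κ ^ 2 * (m + 1)) * (C * (h⁻¹ * (|M.det s.1| * n * b))) := by gcongr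
      _ = κ ^ 2 * (m + 1) * C * (h⁻¹ * (M.surfFactor s * b)) := by
        rw [Mesh.surfFactor]; ring

/-- `Mesh.Adj.exists_trace` replaces the neighbour's polynomial by one on the own element, so the
jump can be lifted from either side. -/
theorem exists_jump {w : M.ScalarFn} (hw : w ∈ M.V p) (s : M.Side) :
    ∃ z ∈ M.localPoly p s.1, (∀ t, M.Adj s t → ∀ x ∈ M.facet s, z x = w s.1 x - w t.1 x) ∧
      (M.IsBdry s → z = w s.1) := by
  by_cases hs : M.IsBdry s
  · exact ⟨w s.1, M.mem_V.1 hw _, fun t ht => absurd ht (hs t), fun _ => rfl⟩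
  · simp only [Mesh.IsBdry, not_forall, not_not] at hs
    obtain ⟨t, ht⟩ := hs
    obtain ⟨φ, hφ, hφe⟩ := ht.exists_trace (M.mem_V.1 hw t.1)
    refine ⟨w s.1 - φ, sub_mem (M.mem_V.1 hw _) hφ, fun t' ht' x hx => ?_,
      fun hb => absurd ht (hb t)⟩
    rw [← ht.unique ht', Pi.sub_apply, hφe x hx]

/-- On each element the local lifts from its facets are added; each one is seen on its own facet
only. The data change sign across a facet, as the normals do, so the normal component is continuous.
-/
theorem exists_lift (K : ElemKind) (m p : ℕ) (hm : 1 ≤ m) {κ : ℝ} (hκ : 0 < κ) : ∃ C : ℝ, 0 < C ∧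
    ∀ (Ω : Set (Vec (m + 1))) (M : Mesh K (m + 1) Ω), (∀ T, ∃ β γ, M.IsScaling κ T β γ) →
      ∀ z : M.Side → Vec (m + 1) → ℝ, (∀ s, z s ∈ M.localPoly p s.1) →
        (∀ s t, M.Adj s t → ∀ x ∈ M.facet s, z t x = -z s x) →
        ∃ r ∈ M.SigDiv p, (∀ s, ∀ x ∈ M.facet s,
          inner ℝ (r s.1 x) (M.normal s) = (Metric.diam (M.facet s))⁻¹ * z s x) ∧
          M.fieldSq r ≤ C * ∑ s, (Metric.diam (M.facet s))⁻¹ * ∫ x, z s x ^ 2 ∂(M.surf s) := by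
  obtain ⟨C, hC, hb⟩ := exists_facet_lift_bound K m p
  -- The number of facets comes from `(∑ a_F)² ≤ card * ∑ a_F²`; the added one gives positivity.
  refine ⟨(Fintype.card (RefFacet K (m + 1)) + 1) * (κ ^ 2 * (m + 1) * C), by positivity,
    fun Ω M hM z hz hanti => ?_⟩
  choose β γ hs using hM
  choose ρ hρ hn hn0 hle using fun s : M.Side =>
    exists_local_lift (hs s.1) hm hC (hb s.2) (hz s)
  let r : M.VectorFn := fun T => ∑ F, ρ (T, F)
  have hrS : r ∈ M.Sig p := M.mem_Sig.2 fun T => Submodule.sum_mem _ fun F _ => hρ (T, F)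
  have hnorm : ∀ s, ∀ x ∈ M.facet s,
      inner ℝ (r s.1 x) (M.normal s) = (Metric.diam (M.facet s))⁻¹ * z s x := by
    intro s x hx
    simp only [r, Finset.sum_apply, sum_inner]
    rw [Finset.sum_eq_single s.2]
    · exact hn s x hx
    · intro F _ hF
      exact hn0 (s.1, F) s.2 hF.symm x hx
    · exact fun h => absurd (Finset.mem_univ _) h
  refine ⟨r, ⟨hrS, fun s t hst x hx => ?_⟩, hnorm, ?_⟩
  · have h1 := hnorm t x (hst.2 ▸ hx)
    rw [hst.normal_eq, inner_neg_right, ← hst.2, hanti s t hst x hx] at h1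
    rw [inner_sub_left, hnorm s x hx]
    linarith
  · have hc : ∀ s, Continuous (ρ s) := fun s => by
      obtain ⟨r', hr', he⟩ := hρ s
      rw [← he]
      have h1 : Continuous r' := (refRT_contDiff (mem_refRTSub.1 hr') (n := 0)).continuous
      have h2 : Continuous fun x => r' ((M.Φ s.1).symm x) := h1.comp (continuous_affine_symm _)
      exact ((linPart (M.Φ s.1)).continuous.comp h2).const_smul
        (LinearMap.det ((M.Φ s.1).linear : Vec (m + 1) →ₗ[ℝ] Vec (m + 1)))⁻¹
    have h1 : ∀ T, ∫ x in M.elem T, ‖r T x‖ ^ 2 ≤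
        (Fintype.card (RefFacet K (m + 1)) + 1) * ∑ F, ∫ x in M.elem T, ‖ρ (T, F) x‖ ^ 2 := by
      intro T
      have hi : ∀ F ∈ Finset.univ, IntegrableOn (fun x => ‖ρ (T, F) x‖ ^ 2) (M.elem T) :=
        fun F _ => M.integrableOn_elem T ((hc (T, F)).norm.pow 2)
      rw [← integral_finsetSum _ hi, ← integral_const_mul]
      refine integral_mono_of_nonneg (Eventually.of_forall fun x => sq_nonneg _)
        ((integrable_finsetSum _ hi).const_mul _) (Eventually.of_forall fun x => ?_)
      simp only [r, Finset.sum_apply]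
      have h2 := norm_sum_le Finset.univ (fun F => ρ (T, F) x)
      have h3 := sq_sum_le_card_mul_sum_sq (s := Finset.univ) (f := fun F => ‖ρ (T, F) x‖)
      have h4 : 0 ≤ ∑ F, ‖ρ (T, F) x‖ ^ 2 := Finset.sum_nonneg fun F _ => sq_nonneg _
      rw [Finset.card_univ] at h3
      calc ‖∑ F, ρ (T, F) x‖ ^ 2 ≤ (∑ F, ‖ρ (T, F) x‖) ^ 2 := by gcongr
        _ ≤ _ := h3.trans (mul_le_mul_of_nonneg_right (by linarith) h4)
    calc M.fieldSq r ≤ ∑ T, (Fintype.card (RefFacet K (m + 1)) + 1) *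
          ∑ F, ∫ x in M.elem T, ‖ρ (T, F) x‖ ^ 2 := Finset.sum_le_sum fun T _ => h1 T
      _ = (Fintype.card (RefFacet K (m + 1)) + 1) *
          ∑ s : M.Side, ∫ x in M.elem s.1, ‖ρ s x‖ ^ 2 := by
        rw [← Finset.mul_sum, Fintype.sum_prod_type]
      _ ≤ (Fintype.card (RefFacet K (m + 1)) + 1) * ∑ s : M.Side, κ ^ 2 * (m + 1) * C *
          ((Metric.diam (M.facet s))⁻¹ * ∫ x, z s x ^ 2 ∂(M.surf s)) := by
        refine mul_le_mul_of_nonneg_left (Finset.sum_le_sum fun s _ => hle s) (by positivity)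
      _ = _ := by rw [← Finset.mul_sum]; ring

theorem Mesh.jumpSq_nonneg (w : M.ScalarFn) : 0 ≤ M.jumpSq w := by
  classical
  refine add_nonneg (mul_nonneg (by norm_num) (Finset.sum_nonneg fun s _ =>
    Finset.sum_nonneg fun t _ => ?_)) (Finset.sum_nonneg fun s _ => ?_)
  all_goals
    split_ifs
    · exact mul_nonneg (inv_nonneg.2 Metric.diam_nonneg) (integral_nonneg fun x => sq_nonneg _)
    · exact le_rfl

/-- A sum over sides counts each interior facet twice and each boundary facet once. -/
theorem sum_jump_le {w : M.ScalarFn} {z : M.Side → Vec (m + 1) → ℝ}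
    (hz : ∀ s t, M.Adj s t → ∀ x ∈ M.facet s, z s x = w s.1 x - w t.1 x)
    (hz' : ∀ s, M.IsBdry s → z s = w s.1) :
    ∑ s, (Metric.diam (M.facet s))⁻¹ * ∫ x, z s x ^ 2 ∂(M.surf s) ≤ 2 * M.jumpSq w := by
  classical
  rw [M.sum_sides, Mesh.jumpSq]
  have h1 : (∑ s : M.Side, ∑ t, if M.Adj s t then
      (Metric.diam (M.facet s))⁻¹ * ∫ x, z s x ^ 2 ∂(M.surf s) else 0) =
      ∑ s : M.Side, ∑ t : M.Side, if M.Adj s t then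
        (Metric.diam (M.facet s))⁻¹ * ∫ x, (w s.1 x - w t.1 x) ^ 2 ∂(M.surf s) else 0 := by
    refine Finset.sum_congr rfl fun s _ => Finset.sum_congr rfl fun t _ => ?_
    split_ifs with h
    · rw [M.integral_surf_congr s fun x hx => by rw [hz s t h x hx]]
    · rfl
  have h2 : (∑ s : M.Side, if M.IsBdry s then
      (Metric.diam (M.facet s))⁻¹ * ∫ x, z s x ^ 2 ∂(M.surf s) else 0) =
      ∑ s : M.Side, if M.IsBdry s then
        (Metric.diam (M.facet s))⁻¹ * ∫ x, (w s.1 x) ^ 2 ∂(M.surf s) else 0 := by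
    refine Finset.sum_congr rfl fun s _ => ?_
    split_ifs with h
    · rw [hz' s h]
    · rfl
  have h3 : 0 ≤ ∑ s : M.Side, if M.IsBdry s then
      (Metric.diam (M.facet s))⁻¹ * ∫ x, (w s.1 x) ^ 2 ∂(M.surf s) else 0 := by
    refine Finset.sum_nonneg fun s _ => ?_
    split_ifs
    · exact mul_nonneg (inv_nonneg.2 Metric.diam_nonneg) (integral_nonneg fun x => sq_nonneg _)
    · exact le_rfl
  rw [h1, h2]
  linarith

/-- The two sides of an interior facet together contribute `w_s (w_s - w_t) + w_t (w_t - w_s) = (w_s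
- w_t)²`. -/
theorem sum_mul_jump {w : M.ScalarFn} (hw : ∀ T, Continuous (w T))
    {z : M.Side → Vec (m + 1) → ℝ}
    (hz : ∀ s t, M.Adj s t → ∀ x ∈ M.facet s, z s x = w s.1 x - w t.1 x)
    (hz' : ∀ s, M.IsBdry s → z s = w s.1) :
    ∑ s, (Metric.diam (M.facet s))⁻¹ * ∫ x, w s.1 x * z s x ∂(M.surf s) = M.jumpSq w := by
  classical
  rw [M.sum_sides, Mesh.jumpSq]
  have h1 : (∑ s : M.Side, ∑ t, if M.Adj s t then
      (Metric.diam (M.facet s))⁻¹ * ∫ x, w s.1 x * z s x ∂(M.surf s) else 0) =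
      ∑ s : M.Side, ∑ t : M.Side, if M.Adj s t then
        (Metric.diam (M.facet s))⁻¹ * ∫ x, w s.1 x * (w s.1 x - w t.1 x) ∂(M.surf s) else 0 := by
    refine Finset.sum_congr rfl fun s _ => Finset.sum_congr rfl fun t _ => ?_
    split_ifs with h
    · rw [M.integral_surf_congr s fun x hx => by rw [hz s t h x hx]]
    · rfl
  rw [h1, M.sum_adj_symm]
  congr 1
  · congr 1
    refine Finset.sum_congr rfl fun s _ => Finset.sum_congr rfl fun t _ => ?_
    split_ifs with h
    · have h2 : M.facet t = M.facet s := h.2.symm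
      rw [h.surf_eq, h2, ← mul_add, ← integral_add]
      · congr 1
        refine integral_congr_ae (Eventually.of_forall fun x => ?_)
        ring
      · exact M.integrable_surf s ((hw _).mul ((hw _).sub (hw _)))
      · exact M.integrable_surf s ((hw _).mul ((hw _).sub (hw _)))
    · rfl
  · refine Finset.sum_congr rfl fun s _ => ?_
    split_ifs with h
    · rw [hz' s h]
      simp only [sq]
    · rfl

theorem Mesh.sum_inner_gradient_le {r : M.VectorFn} {w : M.ScalarFn} (hr : ∀ T, Continuous (r T))
    (hw : ∀ T, Continuous (gradient (w T))) {ε : ℝ} (hε : 0 < ε) :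
    ∑ T, ∫ x in M.elem T, inner ℝ (r T x) (gradient (w T) x) ≤
      ε * M.fieldSq r + (4 * ε)⁻¹ * M.gradSq w := by
  rw [Mesh.fieldSq, Mesh.gradSq, Finset.mul_sum, Finset.mul_sum, ← Finset.sum_add_distrib]
  refine Finset.sum_le_sum fun T _ => ?_
  have h1 : IntegrableOn (fun x => ‖r T x‖ ^ 2) (M.elem T) :=
    M.integrableOn_elem T ((hr T).norm.pow 2)
  have h2 : IntegrableOn (fun x => ‖gradient (w T) x‖ ^ 2) (M.elem T) :=
    M.integrableOn_elem T ((hw T).norm.pow 2)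
  rw [← integral_const_mul, ← integral_const_mul,
    ← integral_add (h1.const_mul ε) (h2.const_mul _)]
  refine integral_mono (M.integrableOn_elem T ((hr T).inner (hw T)))
    ((h1.const_mul ε).add (h2.const_mul _)) fun x => ?_
  have h3 := real_inner_le_norm (r T x) (gradient (w T) x)
  refine h3.trans ?_
  have h4 : ε * ‖r T x‖ ^ 2 + (4 * ε)⁻¹ * ‖gradient (w T) x‖ ^ 2 -
      ‖r T x‖ * ‖gradient (w T) x‖ =
        ε * (‖r T x‖ - (2 * ε)⁻¹ * ‖gradient (w T) x‖) ^ 2 := by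
    field_simp; ring
  have h5 : 0 ≤ ε * (‖r T x‖ - (2 * ε)⁻¹ * ‖gradient (w T) x‖) ^ 2 := by positivity
  exact sub_nonneg.1 (h4 ▸ h5)

theorem le_of_sq_le_mul {l N R ε : ℝ} (hN : 0 ≤ N) (hR : 0 ≤ R) (hε : 0 < ε)
    (h : l ^ 2 ≤ N * R) : l ≤ ε * R + (4 * ε)⁻¹ * N := by
  refine le_of_sq_le_sq ?_ (by positivity)
  have h1 : (ε * R + (4 * ε)⁻¹ * N) ^ 2 = (ε * R - (4 * ε)⁻¹ * N) ^ 2 + N * R := by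
    field_simp; ring
  nlinarith [sq_nonneg (ε * R - (4 * ε)⁻¹ * N)]

/-- For the lift `r` of the jumps, integration by parts reads `jumpSq w = (∇·r, w) + (r, ∇w)`. Both
terms are split by Young's inequality, and the part with `r` is absorbed since `fieldSq r` is
bounded by the jumps. -/
theorem exists_jumpSq_bound (K : ElemKind) (m p : ℕ) (hm : 1 ≤ m) {κ : ℝ} (hκ : 0 < κ) :
    ∃ C : ℝ, 0 < C ∧
    ∀ (Ω : Set (Vec (m + 1))) (M : Mesh K (m + 1) Ω), (∀ T, ∃ β γ, M.IsScaling κ T β γ) →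
      ∀ w ∈ M.V p, ∀ N : ℝ, 0 ≤ N →
        (∀ r ∈ M.SigDiv p, M.l2 (M.dvg r) w ^ 2 ≤ N * M.fieldSq r) →
        M.jumpSq w ≤ C * (N + M.gradSq w) := by
  obtain ⟨C, hC, hb⟩ := exists_lift K m p hm hκ
  refine ⟨4 * C, by positivity, fun Ω M hM w hw N hN h => ?_⟩
  choose z hzP hz hz' using fun s => exists_jump hw s
  obtain ⟨r, hr, hn, hle⟩ := hb Ω M hM z hzP (fun s t hst x hx => by
    rw [hz t s hst.symm x (hst.2 ▸ hx), hz s t hst x hx]; ring)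
  have hle2 := hle.trans (mul_le_mul_of_nonneg_left (sum_jump_le hz hz') hC.le)
  have hwc : ∀ T, Continuous (w T) := fun T => (Mesh.contDiff_of_mem_V hw T (n := 0)).continuous
  have hR : 0 ≤ M.fieldSq r :=
    Finset.sum_nonneg fun T _ => integral_nonneg fun x => sq_nonneg _
  have h1 := M.l2_dvg (fun T => Mesh.contDiff_of_mem_Sig hr.1 T)
    (fun T => Mesh.contDiff_of_mem_V hw T)
  have h2 : ∑ s : M.Side, ∫ x, w s.1 x * inner ℝ (r s.1 x) (M.normal s) ∂(M.surf s) =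
      M.jumpSq w := by
    rw [← sum_mul_jump hwc hz hz']
    refine Finset.sum_congr rfl fun s _ => ?_
    rw [← integral_const_mul]
    refine M.integral_surf_congr s fun x hx => ?_
    rw [hn s x hx]; ring
  rw [h2] at h1
  -- As `fieldSq r ≤ 2 C jumpSq w`, this weight costs a quarter of `jumpSq w` in each of the two
  -- terms; half of it survives.
  have hε : 0 < (8 * C)⁻¹ := by positivity
  have h3 := M.sum_inner_gradient_le (fun T => (Mesh.contDiff_of_mem_Sig hr.1 T (n := 0)).continuous)
    (fun T => continuous_gradient (Mesh.contDiff_of_mem_V hw T)) hε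
  have h4 := le_of_sq_le_mul hN hR hε (h r hr)
  have h5 : (4 * (8 * C)⁻¹)⁻¹ = 2 * C := by field_simp; norm_num
  have h6 : (8 * C)⁻¹ * M.fieldSq r ≤ M.jumpSq w / 4 := by
    calc (8 * C)⁻¹ * M.fieldSq r ≤ (8 * C)⁻¹ * (C * (2 * M.jumpSq w)) := by gcongr
      _ = M.jumpSq w / 4 := by field_simp; ring
  rw [h5] at h3 h4
  linarith

/-- The DG norm is controlled by the dual norm of the discrete divergence. -/
theorem exists_stability (K : ElemKind) (m p : ℕ) (hm : 1 ≤ m) (σ : ℝ) :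
    ∃ C : ℝ, 0 < C ∧
    ∀ (Ω : Set (Vec (m + 1))) (M : Mesh K (m + 1) Ω), M.ShapeRegular σ →
      ∀ w ∈ M.V p, ∀ N : ℝ, 0 ≤ N →
        (∀ r ∈ M.SigDiv p, M.l2 (M.dvg r) w ^ 2 ≤ N * M.fieldSq r) →
        M.gradSq w ≤ C * N ∧ M.jumpSq w ≤ C * N := by
  obtain ⟨κ, hκ, hs⟩ := exists_scaling K m σ
  obtain ⟨C, hC, hg⟩ := exists_gradSq_bound K m p hκ
  obtain ⟨C', hC', hj⟩ := exists_jumpSq_bound K m p hm hκ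
  refine ⟨C + C' * (1 + C), by positivity, fun Ω M hM w hw N hN h => ?_⟩
  have h1 := hg Ω M (hs Ω M hM) w hw N hN h
  have h2 := hj Ω M (hs Ω M hM) w hw N hN h
  have h3 : C' * (N + M.gradSq w) ≤ C' * (N + C * N) := by gcongr
  have h4 : 0 ≤ C * N := by positivity
  have h5 : 0 ≤ C' * (N + C * N) := by positivity
  exact ⟨by linarith, by linarith⟩

end Stability

/-! ### Mixed variational inequalities in finite dimensions -/

section Abstract

theorem isClosed_box {V ι : Type*} [NormedAddCommGroup V] [NormedSpace ℝ V]
    [FiniteDimensional ℝ V] (φ : ι → V →ₗ[ℝ] ℝ) (lo hi : ι → EReal) :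
    IsClosed {v : V | ∀ i, lo i ≤ (φ i v : EReal) ∧ (φ i v : EReal) ≤ hi i} := by
  have hc : ∀ i, Continuous fun v : V => (φ i v : EReal) := fun i =>
    continuous_coe_real_ereal.comp (φ i).continuous_of_finiteDimensional
  simp only [Set.ofPred_forall, Set.ofPred_and]
  exact isClosed_iInter fun i =>
    (isClosed_le continuous_const (hc i)).inter (isClosed_le (hc i) continuous_const)

theorem convex_ereal_Icc (lo hi : EReal) :
    Convex ℝ {y : ℝ | lo ≤ (y : EReal) ∧ (y : EReal) ≤ hi} := by
  refine Set.OrdConnected.convex ⟨fun x hx y hy z hz => ⟨hx.1.trans ?_, le_trans ?_ hy.2⟩⟩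
  · exact EReal.coe_le_coe_iff.2 hz.1
  · exact EReal.coe_le_coe_iff.2 hz.2

theorem convex_box {V ι : Type*} [AddCommGroup V] [Module ℝ V]
    (φ : ι → V →ₗ[ℝ] ℝ) (lo hi : ι → EReal) :
    Convex ℝ {v : V | ∀ i, lo i ≤ (φ i v : EReal) ∧ (φ i v : EReal) ≤ hi i} := by
  rw [Set.ofPred_forall]
  exact convex_iInter fun i => (convex_ereal_Icc (lo i) (hi i)).linear_preimage (φ i)

/-- `u` is the projection of the Riesz representative of `l` onto the closed convex box. -/
theorem exists_inner_VI {V ι : Type*} [NormedAddCommGroup V] [InnerProductSpace ℝ V]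
    [FiniteDimensional ℝ V] (φ : ι → V →ₗ[ℝ] ℝ) (lo hi : ι → EReal)
    (hne : ∃ v : V, ∀ i, lo i ≤ (φ i v : EReal) ∧ (φ i v : EReal) ≤ hi i) (l : V →ₗ[ℝ] ℝ) :
    ∃ u : V, (∀ i, lo i ≤ (φ i u : EReal) ∧ (φ i u : EReal) ≤ hi i) ∧
      ∀ v : V, (∀ i, lo i ≤ (φ i v : EReal) ∧ (φ i v : EReal) ≤ hi i) →
        l (v - u) ≤ inner ℝ u (v - u) := by
  have : CompleteSpace V := FiniteDimensional.complete ℝ V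
  obtain ⟨z, hz⟩ : ∃ z : V, ∀ v, inner ℝ z v = l v :=
    ⟨(InnerProductSpace.toDual ℝ V).symm (LinearMap.toContinuousLinearMap l), fun v => by
      rw [InnerProductSpace.toDual_symm_apply]; rfl⟩
  obtain ⟨u, hu, hmin⟩ := exists_norm_eq_iInf_of_complete_convex hne
    (isClosed_box φ lo hi).isComplete (convex_box φ lo hi) z
  refine ⟨u, hu, fun v hv => ?_⟩
  have h := (norm_eq_iInf_iff_real_inner_le_zero (convex_box φ lo hi) hu).1 hmin v hv
  rw [inner_sub_left, hz] at h
  linarith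

/-- Elimination of the flux: `q = q₀ + Q u`, where `q₀` carries the boundary data and `a (Q u) r = b
r u`. What remains is a variational inequality for the Schur complement `c u v = a (Q u) (Q v)`,
which is an inner product by `hdef` and `hinj`. -/
theorem exists_mixed_VI {S V ι : Type*} [AddCommGroup S] [Module ℝ S] [FiniteDimensional ℝ S]
    [AddCommGroup V] [Module ℝ V] [FiniteDimensional ℝ V] (a : S →ₗ[ℝ] S →ₗ[ℝ] ℝ)
    (b : S →ₗ[ℝ] V →ₗ[ℝ] ℝ) (hsymm : ∀ q r, a q r = a r q) (hnn : ∀ r, 0 ≤ a r r)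
    (hdef : ∀ r, a r r = 0 → r = 0) (hinj : ∀ v, (∀ r, b r v = 0) → v = 0)
    (φ : ι → V →ₗ[ℝ] ℝ) (lo hi : ι → EReal)
    (hne : ∃ v : V, ∀ i, lo i ≤ (φ i v : EReal) ∧ (φ i v : EReal) ≤ hi i)
    (l : V →ₗ[ℝ] ℝ) (g : S →ₗ[ℝ] ℝ) :
    ∃ (q : S) (u : V), (∀ i, lo i ≤ (φ i u : EReal) ∧ (φ i u : EReal) ≤ hi i) ∧
      (∀ r, a q r - b r u = -g r) ∧
      ∀ v : V, (∀ i, lo i ≤ (φ i v : EReal) ∧ (φ i v : EReal) ≤ hi i) →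
        0 ≤ b q (v - u) - l (v - u) := by
  have hker : Function.Injective a := by
    rw [← LinearMap.ker_eq_bot, LinearMap.ker_eq_bot']
    exact fun r hr => hdef r (by rw [hr]; rfl)
  let e : S ≃ₗ[ℝ] Module.Dual ℝ S :=
    LinearMap.linearEquivOfInjective a hker Subspace.dual_finrank_eq.symm
  have he : ∀ (x : Module.Dual ℝ S) r, a (e.symm x) r = x r := fun x r => by
    have : e (e.symm x) r = x r := by rw [e.apply_symm_apply]
    exact this
  let Q : V →ₗ[ℝ] S := e.symm.toLinearMap ∘ₗ b.flip
  have hQ : ∀ v r, a (Q v) r = b r v := fun v r => he (b.flip v) r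
  let q₀ : S := e.symm (-g)
  have hq₀ : ∀ r, a q₀ r = -g r := fun r => he (-g) r
  let c : V →ₗ[ℝ] V →ₗ[ℝ] ℝ := b ∘ₗ Q
  have hc : ∀ u v, c u v = a (Q u) (Q v) := fun u v => by
    rw [hsymm, hQ]; rfl
  let core := formCore c (fun u v => by rw [hc, hc, hsymm]) (fun v => by rw [hc]; exact hnn _)
    (fun v hv => by
      rw [hc] at hv
      refine hinj v fun r => ?_
      rw [← hQ, hdef _ hv, map_zero]; rfl)
  obtain ⟨u, hu, huv⟩ := @exists_inner_VI V ι core.toNormedAddCommGroup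
    (InnerProductSpace.ofCore core.toCore) _ φ lo hi hne (l - b q₀)
  refine ⟨q₀ + Q u, u, hu, fun r => ?_, fun v hv => ?_⟩
  · rw [map_add, LinearMap.add_apply, hq₀, hQ]; ring
  · have h1 : (l - b q₀) (v - u) ≤ c u (v - u) := huv v hv
    have h2 : c u (v - u) = b (Q u) (v - u) := rfl
    rw [LinearMap.sub_apply] at h1
    rw [map_add b, LinearMap.add_apply]
    linarith

/-- Each solution is tested with the other one; the sum gives `a (q - q') (q - q') ≤ 0`. Equality of
the potentials then follows from `hinj`. -/
theorem mixed_VI_unique {S V : Type*} [AddCommGroup S] [Module ℝ S]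
    [AddCommGroup V] [Module ℝ V] {a : S →ₗ[ℝ] S →ₗ[ℝ] ℝ}
    {b : S →ₗ[ℝ] V →ₗ[ℝ] ℝ} (hnn : ∀ r, 0 ≤ a r r)
    (hdef : ∀ r, a r r = 0 → r = 0) (hinj : ∀ v, (∀ r, b r v = 0) → v = 0)
    {l : V →ₗ[ℝ] ℝ} {g : S →ₗ[ℝ] ℝ} {q q' : S} {u u' : V}
    (h1 : ∀ r, a q r - b r u = -g r) (h1' : ∀ r, a q' r - b r u' = -g r)
    (h2 : 0 ≤ b q (u' - u) - l (u' - u)) (h2' : 0 ≤ b q' (u - u') - l (u - u')) :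
    q = q' ∧ u = u' := by
  have h3 : ∀ r, a (q - q') r = b r (u - u') := fun r => by
    have := h1 r
    have := h1' r
    simp only [map_sub, LinearMap.sub_apply]
    linarith
  have h4 : a (q - q') (q - q') ≤ 0 := by
    rw [h3]
    simp only [map_sub, LinearMap.sub_apply] at h2 h2' ⊢
    linarith
  have h5 := hdef _ (le_antisymm h4 (hnn _))
  refine ⟨sub_eq_zero.1 h5, sub_eq_zero.1 (hinj _ fun r => ?_)⟩
  rw [← h3, h5, map_zero]; rfl

end Abstract

/-! ### Injectivity of the discrete divergence -/

section Injective

variable {K : ElemKind} {m p : ℕ} {Ω : Set (Vec (m + 1))} {M : Mesh K (m + 1) Ω}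

theorem Mesh.eq_on_facet_of_jumpSq (hd : ∀ s, 0 < Metric.diam (M.facet s)) {w : M.ScalarFn}
    (hw : ∀ T, Continuous (w T)) (h : M.jumpSq w ≤ 0) :
    (∀ s t, M.Adj s t → ∀ x ∈ M.facet s, w s.1 x = w t.1 x) ∧
      ∀ s, M.IsBdry s → ∀ x ∈ M.facet s, w s.1 x = 0 := by
  classical
  have h1 : ∀ s t : M.Side, 0 ≤ if M.Adj s t then
      (Metric.diam (M.facet s))⁻¹ * ∫ x, (w s.1 x - w t.1 x) ^ 2 ∂(M.surf s) else 0 := by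
    intro s t
    split_ifs
    · exact mul_nonneg (inv_nonneg.2 Metric.diam_nonneg) (integral_nonneg fun x => sq_nonneg _)
    · exact le_rfl
  have h2 : ∀ s : M.Side, 0 ≤ if M.IsBdry s then
      (Metric.diam (M.facet s))⁻¹ * ∫ x, (w s.1 x) ^ 2 ∂(M.surf s) else 0 := by
    intro s
    split_ifs
    · exact mul_nonneg (inv_nonneg.2 Metric.diam_nonneg) (integral_nonneg fun x => sq_nonneg _)
    · exact le_rfl
  have h3 := Finset.sum_nonneg fun s (_ : s ∈ Finset.univ) =>
    Finset.sum_nonneg fun t (_ : t ∈ Finset.univ) => h1 s t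
  have h4 := Finset.sum_nonneg fun s (_ : s ∈ Finset.univ) => h2 s
  rw [Mesh.jumpSq] at h
  have h5 := (Finset.sum_eq_zero_iff_of_nonneg fun s _ =>
    Finset.sum_nonneg fun t (_ : t ∈ Finset.univ) => h1 s t).1 (le_antisymm (by linarith) h3)
  have h6 := (Finset.sum_eq_zero_iff_of_nonneg fun s _ => h2 s).1 (le_antisymm (by linarith) h4)
  constructor
  · intro s t hst x hx
    have h7 := (Finset.sum_eq_zero_iff_of_nonneg fun t _ => h1 s t).1
      (h5 s (Finset.mem_univ s)) t (Finset.mem_univ t)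
    rw [if_pos hst] at h7
    have h8 := (mul_eq_zero.1 h7).resolve_left (inv_ne_zero (hd s).ne')
    exact sub_eq_zero.1 (M.eq_zero_on_facet s ((hw s.1).sub (hw t.1)) h8 x hx)
  · intro s hs x hx
    have h7 := h6 s (Finset.mem_univ s)
    rw [if_pos hs] at h7
    have h8 := (mul_eq_zero.1 h7).resolve_left (inv_ne_zero (hd s).ne')
    exact M.eq_zero_on_facet s (hw s.1) h8 x hx

theorem divergence_id (d : ℕ) (x : Vec d) : divergence (fun x : Vec d => x) x = d := by
  simp [divergence]

/-- A piecewise constant function without jumps that vanishes on the boundary is zero. -/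
theorem Mesh.eq_zero_of_gradSq_of_jumpSq (hd : ∀ s, 0 < Metric.diam (M.facet s))
    {w : M.ScalarFn} (hw : w ∈ M.V p) (hg : M.gradSq w ≤ 0) (hj : M.jumpSq w ≤ 0) : w = 0 := by
  classical
  have hw1 : ∀ T, ContDiff ℝ 1 (w T) := fun T => Mesh.contDiff_of_mem_V hw T
  have hwc : ∀ T, Continuous (w T) := fun T => (hw1 T).continuous
  obtain ⟨hadj, hbd⟩ := M.eq_on_facet_of_jumpSq hd hwc hj
  have hg0 : ∀ T, ∀ x ∈ M.elem T, gradient (w T) x = 0 := by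
    intro T
    have h1 := (Finset.sum_eq_zero_iff_of_nonneg fun T _ =>
      integral_nonneg fun x => sq_nonneg ‖gradient (w T) x‖).1
      (le_antisymm hg (Finset.sum_nonneg fun T _ => integral_nonneg fun x => sq_nonneg _))
      T (Finset.mem_univ T)
    have hc := continuous_gradient (hw1 T)
    rw [integral_eq_zero_iff_of_nonneg (fun x => sq_nonneg _)
      (M.integrableOn_elem T (hc.norm.pow 2))] at h1
    refine M.eqOn_elem T hc continuous_const ?_
    filter_upwards [h1] with x hx
    simpa using hx
  -- The field `x` has the constant divergence `d`, so integration by parts against `w²` gives `d ∫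
  -- w² = 0`: the gradient vanishes, the contributions of interior facets cancel, and `w` is zero on
  -- the boundary. No connectivity of the mesh is needed.
  have hibp := M.l2_dvg (r := fun _ x => x) (v := fun T x => w T x ^ 2) (fun T => contDiff_id)
    (fun T => (hw1 T).pow 2)
  have h1 : ∑ T, ∫ x in M.elem T, inner ℝ x (gradient (fun x => w T x ^ 2) x) = 0 := by
    refine Finset.sum_eq_zero fun T _ => ?_
    rw [setIntegral_congr_fun (g := fun _ => (0 : ℝ)) (M.measurableSet_elem T), integral_zero]
    intro x hx
    simp only
    rw [inner_gradient, fderiv_fun_pow 2 ((hw1 T).differentiable one_ne_zero x),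
      smul_apply, ← inner_gradient, hg0 T x hx]
    simp
  have h2 : ∑ s : M.Side, ∫ x, w s.1 x ^ 2 * inner ℝ x (M.normal s) ∂(M.surf s) = 0 := by
    rw [M.sum_sides, M.sum_adj_symm, Finset.sum_eq_zero, Finset.sum_eq_zero]
    · simp
    · intro s _
      split_ifs with hs
      · rw [M.integral_surf_congr s (g := fun _ => 0), integral_zero]
        intro x hx
        rw [hbd s hs x hx]; simp
      · rfl
    · intro s _
      refine Finset.sum_eq_zero fun t _ => ?_
      split_ifs with hst
      · rw [hst.surf_eq, hst.normal_eq, M.integral_surf_congr s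
          (f := fun x => w t.1 x ^ 2 * inner ℝ x (-M.normal s))
          (g := fun x => -(w s.1 x ^ 2 * inner ℝ x (M.normal s))), integral_neg, add_neg_cancel]
        intro x hx
        rw [hadj s t hst x hx, inner_neg_right]; ring
      · rfl
  rw [h1, h2, neg_zero, add_zero] at hibp
  have h3 : ∀ T, 0 ≤ ∫ x in M.elem T, M.dvg (fun _ x => x) T x * w T x ^ 2 := fun T => by
    refine integral_nonneg fun x => ?_
    simp only [Mesh.dvg, divergence_id]
    positivity
  have h4 := (Finset.sum_eq_zero_iff_of_nonneg fun T _ => h3 T).1 hibp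
  funext T
  refine Mesh.eq_zero_of_eqOn_localPoly (M.mem_V.1 hw T) ?_
  have h5 := h4 T (Finset.mem_univ T)
  simp only [Mesh.dvg, divergence_id] at h5
  replace h5 := (integral_eq_zero_iff_of_nonneg (f := fun x => ((m + 1 : ℕ) : ℝ) * w T x ^ 2)
    (fun x => by positivity) (M.integrableOn_elem T (continuous_const.mul ((hwc T).pow 2)))).1 h5
  refine M.eqOn_elem T (hwc T) continuous_const ?_
  filter_upwards [h5] with x hx
  have hm : ((m + 1 : ℕ) : ℝ) ≠ 0 := by positivity
  simpa [hm] using (mul_eq_zero.1 hx).resolve_left hm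

/-- The stability estimate with `N = 0`. -/
theorem divForm_injective (hm : 1 ≤ m) {σ : ℝ} (hM : M.ShapeRegular σ) {v : M.V p}
    (h : ∀ r, divForm M p r v = 0) : v = 0 := by
  obtain ⟨C, hC, hst⟩ := exists_stability K m p hm σ
  obtain ⟨κ, hκ, hs⟩ := exists_scaling K m σ
  obtain ⟨hg, hj⟩ := hst Ω M hM v.1 v.2 0 le_rfl fun r hr => by
    have : M.l2 (M.dvg r) v.1 = 0 := h ⟨r, hr⟩
    rw [this]; simp
  rw [mul_zero] at hg hj
  refine Subtype.ext (M.eq_zero_of_gradSq_of_jumpSq (fun s => ?_) v.2 hg hj)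
  obtain ⟨β, γ, hsc⟩ := hs Ω M hM s.1
  exact (hsc.inv_diam_facet_le hm).1

end Injective

/-! ### Entropies -/

theorem IsEntropyPair.mem {lo hi : EReal} {Υ R : ℝ → ℝ} (h : IsEntropyPair lo hi Υ R) (z : ℝ) :
    lo < (Υ z : EReal) ∧ (Υ z : EReal) < hi := by
  have : Υ z ∈ Set.range Υ := ⟨z, rfl⟩
  rwa [h.range_eq] at this

/-- The tangent to `R` at the interior point `Υ z` has slope `z` and lies below `R`. The point `y`
may be an end point of the interval, as the nodal values of `u*` may be. -/
theorem IsEntropyPair.tangent_le {lo hi : EReal} {Υ R : ℝ → ℝ} (h : IsEntropyPair lo hi Υ R)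
    {y : ℝ} (hy : lo ≤ (y : EReal) ∧ (y : EReal) ≤ hi) (z : ℝ) :
    0 ≤ R y - R (Υ z) - z * (y - Υ z) := by
  have hz := h.mem z
  have hz' : Υ z ∈ {y : ℝ | lo ≤ (y : EReal) ∧ (y : EReal) ≤ hi} := ⟨hz.1.le, hz.2.le⟩
  have hcv := h.strictConvex.convexOn
  rcases lt_trichotomy y (Υ z) with hlt | heq | hlt
  · have h1 := hcv.slope_le_of_hasDerivAt hy hz' hlt (h.hasDerivAt z)
    rw [slope_def_field, div_le_iff₀ (sub_pos.2 hlt)] at h1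
    linarith
  · simp [heq]
  · have h1 := hcv.le_slope_of_hasDerivAt hz' hy hlt (h.hasDerivAt z)
    rw [slope_def_field, le_div_iff₀ (sub_pos.2 hlt)] at h1
    linarith

section Discrete

variable {K : ElemKind} {m p : ℕ} {Ω : Set (Vec (m + 1))} {M : Mesh K (m + 1) Ω}
  {Q : QuadRule K (m + 1) p} {lo hi : Vec (m + 1) → EReal} {Υ R : Vec (m + 1) → ℝ → ℝ}

theorem exists_nodal (hQ : IsQuadSpace M Q) (c : M.Elem → Fin Q.n → ℝ) :
    ∃ v ∈ M.V p, ∀ T i, v T (qnode M Q T i) = c T i := by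
  choose φ hφ hφe using hQ
  refine ⟨fun T => ∑ i, c T i • φ T i, M.mem_V.2 fun T => Submodule.sum_mem _ fun i _ =>
    Submodule.smul_mem _ _ (hφ T i), fun T i => ?_⟩
  simp [Finset.sum_apply, hφe]

theorem bregman_eq (hE : ∀ T i, IsEntropyPair (lo (qnode M Q T i)) (hi (qnode M Q T i))
      (Υ (qnode M Q T i)) (R (qnode M Q T i))) {u ψ : M.ScalarFn}
    (hu : ∀ T i, u T (qnode M Q T i) = Υ (qnode M Q T i) (ψ T (qnode M Q T i)))
    (v : M.ScalarFn) :
    bregman M Q R v u = ∑ T, ∑ i, (R (qnode M Q T i) (v T (qnode M Q T i)) -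
      R (qnode M Q T i) (u T (qnode M Q T i)) -
      ψ T (qnode M Q T i) * (v T (qnode M Q T i) - u T (qnode M Q T i))) * qweight M Q T i := by
  simp only [bregman, qInner, ← Finset.sum_sub_distrib]
  refine Finset.sum_congr rfl fun T _ => Finset.sum_congr rfl fun i _ => ?_
  have h1 : deriv (R (qnode M Q T i)) (u T (qnode M Q T i)) = ψ T (qnode M Q T i) := by
    rw [hu]; exact ((hE T i).hasDerivAt _).deriv
  simp only [Pi.sub_apply, superpose, Mesh.glob, h1]
  ring

theorem bregman_nonneg (hE : ∀ T i, IsEntropyPair (lo (qnode M Q T i)) (hi (qnode M Q T i))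
      (Υ (qnode M Q T i)) (R (qnode M Q T i))) {u ψ v : M.ScalarFn}
    (hu : ∀ T i, u T (qnode M Q T i) = Υ (qnode M Q T i) (ψ T (qnode M Q T i)))
    (hv : v ∈ feasible M Q lo hi) : 0 ≤ bregman M Q R v u := by
  rw [bregman_eq hE hu]
  refine Finset.sum_nonneg fun T _ => Finset.sum_nonneg fun i _ =>
    mul_nonneg ?_ (qweight_pos M Q T i).le
  rw [hu]
  exact (hE T i).tangent_le (hv.2 T i) _

theorem mem_feasible_of_nodal (hE : ∀ T i, IsEntropyPair (lo (qnode M Q T i)) (hi (qnode M Q T i))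
      (Υ (qnode M Q T i)) (R (qnode M Q T i))) {u ψ : M.ScalarFn} (hV : u ∈ M.V p)
    (hu : ∀ T i, u T (qnode M Q T i) = Υ (qnode M Q T i) (ψ T (qnode M Q T i))) :
    u ∈ feasible M Q lo hi := by
  refine ⟨hV, fun T i => ?_⟩
  rw [hu]
  exact ⟨((hE T i).mem _).1.le, ((hE T i).mem _).2.le⟩

/-- The three-point inequality of the Bregman distance. -/
theorem qInner_le_bregman_sub (hE : ∀ T i, IsEntropyPair (lo (qnode M Q T i))
      (hi (qnode M Q T i)) (Υ (qnode M Q T i)) (R (qnode M Q T i))) {u ψ u' ψ' : M.ScalarFn}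
    (hu : ∀ T i, u T (qnode M Q T i) = Υ (qnode M Q T i) (ψ T (qnode M Q T i)))
    (hu' : ∀ T i, u' T (qnode M Q T i) = Υ (qnode M Q T i) (ψ' T (qnode M Q T i)))
    (v : M.ScalarFn) :
    qInner M Q (ψ - ψ') (u' - v) ≤ bregman M Q R v u - bregman M Q R v u' := by
  rw [bregman_eq hE hu, bregman_eq hE hu', qInner]
  simp only [← Finset.sum_sub_distrib]
  refine Finset.sum_le_sum fun T _ => Finset.sum_le_sum fun i _ => ?_
  rw [← sub_mul]
  refine mul_le_mul_of_nonneg_right ?_ (qweight_pos M Q T i).le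
  have h2 := (hE T i).mem (ψ' T (qnode M Q T i))
  -- The two sides differ by the nodal Bregman distance of `u'` from `u`, which is nonnegative.
  have h1 := (hE T i).tangent_le ⟨h2.1.le, h2.2.le⟩ (ψ T (qnode M Q T i))
  rw [← hu, ← hu'] at h1
  simp only [Pi.sub_apply]
  linarith

theorem qInner_latent_nonneg (hE : ∀ T i, IsEntropyPair (lo (qnode M Q T i))
      (hi (qnode M Q T i)) (Υ (qnode M Q T i)) (R (qnode M Q T i))) {u ψ u' ψ' : M.ScalarFn}
    (hu : ∀ T i, u T (qnode M Q T i) = Υ (qnode M Q T i) (ψ T (qnode M Q T i)))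
    (hu' : ∀ T i, u' T (qnode M Q T i) = Υ (qnode M Q T i) (ψ' T (qnode M Q T i))) :
    0 ≤ qInner M Q (ψ - ψ') (u - u') := by
  refine Finset.sum_nonneg fun T _ => Finset.sum_nonneg fun i _ =>
    mul_nonneg ?_ (qweight_pos M Q T i).le
  simp only [Pi.sub_apply]
  rw [hu, hu']
  have hmono := (hE T i).strictMono.monotone
  rcases le_total (ψ T (qnode M Q T i)) (ψ' T (qnode M Q T i)) with h | h
  · exact mul_nonneg_of_nonpos_of_nonpos (sub_nonpos.2 h) (sub_nonpos.2 (hmono h))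
  · exact mul_nonneg (sub_nonneg.2 h) (sub_nonneg.2 (hmono h))

/-! ### The discrete variational inequality -/

variable {a₀ a₁ : ℝ} {A : Vec (m + 1) → Matrix (Fin (m + 1)) (Fin (m + 1)) ℝ}
  {f g : Vec (m + 1) → ℝ}

theorem l2_dvg_sub_glob (hΩ : interior (closure Ω) = Ω) (hf : MemLp f 2 (volume.restrict Ω))
    {q : M.VectorFn} (hq : q ∈ M.Sig p) {v : M.ScalarFn} (hv : v ∈ M.V p) :
    M.l2 (M.dvg q - M.glob f) v = M.l2 (M.dvg q) v - M.l2 (M.glob f) v := by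
  simp only [Mesh.l2, ← Finset.sum_sub_distrib]
  refine Finset.sum_congr rfl fun T _ => ?_
  have hvc : Continuous (v T) := (Mesh.contDiff_of_mem_V hv T (n := 0)).continuous
  have h1 : IntegrableOn (fun x => M.dvg q T x * v T x) (M.elem T) := M.integrableOn_elem T
    ((continuous_divergence (Mesh.contDiff_of_mem_Sig hq T)).mul hvc)
  have h2 : IntegrableOn (fun x => M.glob f T x * v T x) (M.elem T) :=
    integrableOn_source M hΩ hf T hvc
  rw [← integral_sub h1 h2]
  refine integral_congr_ae (Eventually.of_forall fun x => ?_)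
  exact sub_mul _ _ _

theorem exists_unique_VI (hm : 1 ≤ m) {σ : ℝ} (hM : M.ShapeRegular σ) (hQ : IsQuadSpace M Q)
    (hA : IsDiffusion Ω a₀ a₁ A) (ha : 0 < a₀) (hΩ : interior (closure Ω) = Ω)
    (hf : MemLp f 2 (volume.restrict Ω)) (hg : ∀ s, M.IsBdry s → MemLp g 2 (M.surf s))
    (hE : ∀ T i, IsEntropyPair (lo (qnode M Q T i))
      (hi (qnode M Q T i)) (Υ (qnode M Q T i)) (R (qnode M Q T i))) :
    ∃ qs us, IsVISolution M Q A f g lo hi qs us ∧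
      ∀ q' u', IsVISolution M Q A f g lo hi q' u' → q' = qs ∧ u' = us := by
  let φ : M.Elem × Fin Q.n → M.V p →ₗ[ℝ] ℝ := fun j =>
    (LinearMap.proj (qnode M Q j.1 j.2) ∘ₗ LinearMap.proj j.1) ∘ₗ (M.V p).subtype
  have hnn : ∀ r, 0 ≤ fluxForm M hA ha hΩ p r r := fun r => invForm_nonneg M hA ha hΩ r.1
  have hdef : ∀ r, fluxForm M hA ha hΩ p r r = 0 → r = 0 := fun r =>
    fluxForm_definite M hA ha hΩ
  have hinj : ∀ v, (∀ r, divForm M p r v = 0) → v = 0 := fun v => divForm_injective hm hM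
  -- Any value of `Υ` lies strictly between the bounds, so interpolating `Υ` at `0` gives a feasible
  -- function.
  obtain ⟨v₀, hv₀, hv₀e⟩ := exists_nodal hQ fun T i => Υ (qnode M Q T i) 0
  obtain ⟨q, u, hu, h1, h2⟩ := exists_mixed_VI (fluxForm M hA ha hΩ p) (divForm M p)
    (fun q r => invForm_comm M hA hΩ _ _) hnn hdef hinj φ (fun j => lo (qnode M Q j.1 j.2))
    (fun j => hi (qnode M Q j.1 j.2))
    ⟨⟨v₀, hv₀⟩, fun j => by
      have h := mem_feasible_of_nodal (ψ := 0) hE hv₀ hv₀e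
      exact h.2 j.1 j.2⟩ (sourceForm M hf hΩ p) (bdryFunctional M hg p)
  have key : ∀ (q : M.sigDivSub p) (v : M.V p), M.l2 (M.dvg q.1 - M.glob f) v.1 =
      divForm M p q v - sourceForm M hf hΩ p v := fun q v => l2_dvg_sub_glob hΩ hf q.2.1 v.2
  refine ⟨q.1, u.1, ⟨q.2, ⟨u.2, fun T i => hu (T, i)⟩, fun r hr => ?_, fun v hv => ?_⟩,
    fun q' u' h' => ?_⟩
  · rw [M.l2_comm]
    exact h1 ⟨r, hr⟩
  · have := h2 ⟨v, hv.1⟩ fun j => hv.2 j.1 j.2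
    rw [← key] at this
    exact this
  · have h3 := mixed_VI_unique (q := (⟨q', h'.flux_mem⟩ : M.sigDivSub p)) (q' := q)
      (u := (⟨u', h'.mem.1⟩ : M.V p)) (u' := u) hnn hdef hinj (fun r => by
        have := h'.flux_eq r.1 r.2
        rw [M.l2_comm] at this
        exact this) h1 (by rw [← key]; exact h'.ineq u.1 ⟨u.2, fun T i => hu (T, i)⟩)
      (h2 ⟨u', h'.mem.1⟩ fun j => h'.mem.2 j.1 j.2)
    exact ⟨congrArg Subtype.val h3.1, congrArg Subtype.val h3.2⟩

/-! ### Convergence -/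

theorem mixed_energy {S V : Type*} [AddCommGroup S] [Module ℝ S]
    [AddCommGroup V] [Module ℝ V] {a : S →ₗ[ℝ] S →ₗ[ℝ] ℝ}
    {b : S →ₗ[ℝ] V →ₗ[ℝ] ℝ} {g : S →ₗ[ℝ] ℝ} {q q' : S} {u u' : V}
    (h : ∀ r, a q r - b r u = -g r) (h' : ∀ r, a q' r - b r u' = -g r) (r : S) :
    a (q - q') r = b r (u - u') := by
  have := h r
  have := h' r
  simp only [map_sub, LinearMap.sub_apply]
  linarith

/-- Both sides are `J(u') - J(us)` and `J(u) - J(us)` for the convex energy `J(u) = a q q / 2 - l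
u`, whose gradient at `u'` is `b q' - l`. By `hmono` the step back from `u'` to `u` does not go
downhill; the difference of the energies is at least `a (q - q') (q - q') / 2`. -/
theorem mixed_energy_antitone {S V : Type*} [AddCommGroup S] [Module ℝ S]
    [AddCommGroup V] [Module ℝ V] {a : S →ₗ[ℝ] S →ₗ[ℝ] ℝ} (hsymm : ∀ q r, a q r = a r q)
    (hnn : ∀ r, 0 ≤ a r r) {b : S →ₗ[ℝ] V →ₗ[ℝ] ℝ} {g : S →ₗ[ℝ] ℝ} {l : V →ₗ[ℝ] ℝ}
    {qs q q' : S} {us u u' : V} (h : ∀ r, a q r - b r u = -g r)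
    (h' : ∀ r, a q' r - b r u' = -g r) (hmono : 0 ≤ b q' (u - u') - l (u - u')) :
    a (q' - qs) (q' - qs) / 2 + (b qs (u' - us) - l (u' - us)) ≤
      a (q - qs) (q - qs) / 2 + (b qs (u - us) - l (u - us)) := by
  have h1 := mixed_energy h h' (q' - qs)
  have h2 := hnn (q - q')
  have h3 := hsymm q q'
  have h4 := hsymm q qs
  have h5 := hsymm q' qs
  simp only [map_sub, LinearMap.sub_apply] at h1 h2 hmono ⊢
  linarith

/-- A telescoping sum in which all earlier values of `E` are replaced by the last, smallest one. -/
theorem mul_sum_le_of_descent {α E D : ℕ → ℝ} (hα : ∀ k, 1 ≤ k → 0 < α k)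
    (hE : ∀ k, 1 ≤ k → E (k + 1) ≤ E k) (hD : ∀ k, α (k + 1) * E (k + 1) ≤ D k - D (k + 1))
    (ℓ : ℕ) : (∑ k ∈ Finset.Icc 1 ℓ, α k) * E ℓ ≤ D 0 - D ℓ := by
  induction ℓ with
  | zero => simp
  | succ n ih =>
    rw [Finset.sum_Icc_succ_top (by omega), add_mul]
    have h1 : (∑ k ∈ Finset.Icc 1 n, α k) * E (n + 1) ≤ (∑ k ∈ Finset.Icc 1 n, α k) * E n := by
      -- For `n = 0` the sum is empty, and monotonicity from index `0` is not available: there is no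
      -- flux at the initial guess.
      rcases Nat.eq_zero_or_pos n with rfl | hn
      · simp
      · exact mul_le_mul_of_nonneg_left (hE n hn)
          (Finset.sum_nonneg fun k hk => (hα k (Finset.mem_Icc.1 hk).1).le)
    have := hD n
    linarith

theorem dgNormSq_le (hA : IsDiffusion Ω a₀ a₁ A) (ha : 0 < a₀) (hΩ : interior (closure Ω) = Ω)
    {w : M.ScalarFn} (hw : w ∈ M.V p) :
    0 ≤ M.dgNormSq A w ∧ M.dgNormSq A w ≤ |a₁| * M.gradSq w + M.jumpSq w := by
  have h0 : ∀ T, ∀ᵐ x ∂(volume.restrict (M.elem T)),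
      0 ≤ bil (A x) (gradient (w T) x) (gradient (w T) x) := fun T => by
    filter_upwards [hA.ae_elem hΩ T] with x hx
    exact le_trans (by positivity) (hx.2 _).1
  have h1 : M.dgNormSq A w = (∑ T, ∫ x in M.elem T,
      bil (A x) (gradient (w T) x) (gradient (w T) x)) + M.jumpSq w := by
    rw [Mesh.dgNormSq, Mesh.jumpSq, add_assoc]
  have h2 := M.jumpSq_nonneg w
  have h3 : 0 ≤ ∑ T, ∫ x in M.elem T, bil (A x) (gradient (w T) x) (gradient (w T) x) :=
    Finset.sum_nonneg fun T _ => integral_nonneg_of_ae (h0 T)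
  rw [h1]
  refine ⟨by linarith, ?_⟩
  gcongr
  rw [Mesh.gradSq, Finset.mul_sum]
  refine Finset.sum_le_sum fun T _ => ?_
  rw [← integral_const_mul]
  have hc := continuous_gradient (Mesh.contDiff_of_mem_V hw T)
  refine integral_mono_of_nonneg (h0 T) (M.integrableOn_elem T (by fun_prop)) ?_
  filter_upwards [hA.ae_elem hΩ T] with x hx
  exact (hx.2 _).2.trans (mul_le_mul_of_nonneg_right (le_abs_self _) (sq_nonneg _))

/-- The error of a flux controls the error of the potential. -/
theorem dgNormSq_le_fluxNormSq {C : ℝ}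
    (hst : ∀ w ∈ M.V p, ∀ N : ℝ, 0 ≤ N →
      (∀ r ∈ M.SigDiv p, M.l2 (M.dvg r) w ^ 2 ≤ N * M.fieldSq r) →
      M.gradSq w ≤ C * N ∧ M.jumpSq w ≤ C * N)
    (hA : IsDiffusion Ω a₀ a₁ A) (ha : 0 < a₀) (hΩ : interior (closure Ω) = Ω)
    {e : M.sigDivSub p} {w : M.V p} (h : ∀ r, fluxForm M hA ha hΩ p e r = divForm M p r w) :
    M.dgNormSq A w.1 ≤ (|a₁| + 1) * C * a₀⁻¹ * M.fluxNormSq A e.1 := by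
  have hnn : ∀ r : M.sigDivSub p, 0 ≤ fluxForm M hA ha hΩ p r r := fun r =>
    invForm_nonneg M hA ha hΩ r.1
  have he : 0 ≤ M.fluxNormSq A e.1 := hnn e
  -- The divergence tested with `w` equals `(A⁻¹ e, r)`; Cauchy–Schwarz in the flux form and the
  -- bound `a₀⁻¹` for `A⁻¹` give this choice of `N`.
  obtain ⟨h1, h2⟩ := hst w.1 w.2 (a₀⁻¹ * M.fluxNormSq A e.1) (by positivity) fun r hr => by
    have h3 := LinearMap.BilinForm.apply_sq_le_of_symm (fluxForm M hA ha hΩ p) hnn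
      ⟨fun q r => invForm_comm M hA hΩ _ _⟩ e ⟨r, hr⟩
    rw [h] at h3
    have h4 : M.invForm A r r ≤ a₀⁻¹ * M.fieldSq r := invForm_le M hA ha hΩ fun T =>
      (Mesh.contDiff_of_mem_Sig hr.1 T (n := 0)).continuous
    calc M.l2 (M.dvg r) w.1 ^ 2 ≤ M.fluxNormSq A e.1 * M.invForm A r r := h3
      _ ≤ M.fluxNormSq A e.1 * (a₀⁻¹ * M.fieldSq r) := mul_le_mul_of_nonneg_left h4 he
      _ = _ := by ring
  have h3 := (dgNormSq_le hA ha hΩ w.2).2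
  have h4 := mul_le_mul_of_nonneg_left h1 (abs_nonneg a₁)
  calc M.dgNormSq A w.1 ≤ |a₁| * M.gradSq w.1 + M.jumpSq w.1 := h3
    _ ≤ |a₁| * (C * (a₀⁻¹ * M.fluxNormSq A e.1)) + C * (a₀⁻¹ * M.fluxNormSq A e.1) := by linarith
    _ = _ := by ring

end Discrete

/-! ### Energy descent and convergence of the iterates -/

section Convergence

variable {K : ElemKind} {m p : ℕ} {Ω : Set (Vec (m + 1))} {M : Mesh K (m + 1) Ω}
  {Q : QuadRule K (m + 1) p} {lo hi : Vec (m + 1) → EReal} {Υ R : Vec (m + 1) → ℝ → ℝ}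
  {a₀ a₁ : ℝ} {A : Vec (m + 1) → Matrix (Fin (m + 1)) (Fin (m + 1)) ℝ}
  {f g : Vec (m + 1) → ℝ} {α : ℕ → ℝ} {q : ℕ → M.VectorFn} {u ψ : ℕ → M.ScalarFn}

theorem IsMixedRun.latent_mem (h : IsMixedRun M Q A f g Υ α q u ψ) (k : ℕ) : ψ k ∈ M.V p := by
  cases k with
  | zero => exact h.init.latent_mem
  | succ k => exact (h.step k).latent_mem

theorem IsMixedRun.mem (h : IsMixedRun M Q A f g Υ α q u ψ) (k : ℕ) : u k ∈ M.V p := by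
  cases k with
  | zero => exact h.init.mem
  | succ k => exact (h.step k).mem

theorem IsMixedRun.nodal (h : IsMixedRun M Q A f g Υ α q u ψ) (hQ : IsQuadSpace M Q) (k : ℕ)
    (T : M.Elem) (i : Fin Q.n) :
    u k T (qnode M Q T i) = Υ (qnode M Q T i) (ψ k T (qnode M Q T i)) := by
  refine nodal_eq Q hQ (h.mem k) (z := superpose M Υ (ψ k)) ?_ T i
  cases k with
  | zero => exact h.init.latent_eq
  | succ k => exact fun w hw => sub_eq_zero.1 ((h.step k).latent_eq w hw)

/-- The sequence `E` below is the energy gap `J(u^k) - J(u*)`. It decreases, and `α_k E_k` is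
bounded by the drop of the Bregman distance to `u*`. Half the squared flux error is one of the two
nonnegative parts of `E`. -/
theorem IsMixedRun.fluxNormSq_le (hrun : IsMixedRun M Q A f g Υ α q u ψ) (hQ : IsQuadSpace M Q)
    (hA : IsDiffusion Ω a₀ a₁ A) (ha : 0 < a₀) (hΩ : interior (closure Ω) = Ω)
    (hf : MemLp f 2 (volume.restrict Ω)) (hg : ∀ s, M.IsBdry s → MemLp g 2 (M.surf s))
    (hE : ∀ T i, IsEntropyPair (lo (qnode M Q T i))
      (hi (qnode M Q T i)) (Υ (qnode M Q T i)) (R (qnode M Q T i)))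
    (hα : ∀ k, 1 ≤ k → 0 < α k) {qs : M.sigDivSub p} {us : M.V p}
    (hVI : IsVISolution M Q A f g lo hi qs.1 us.1) {ℓ : ℕ} (hℓ : 1 ≤ ℓ) :
    M.fluxNormSq A (q ℓ - qs.1) ≤
      2 * (bregman M Q R us.1 (u 0) / ∑ k ∈ Finset.Icc 1 ℓ, α k) := by
  have hmemq : ∀ k, 1 ≤ k → q k ∈ M.SigDiv p := fun k hk => by
    obtain ⟨n, rfl⟩ : ∃ n, k = n + 1 := ⟨k - 1, by omega⟩
    exact (hrun.step n).flux_mem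
  -- Nothing is known about `q 0`; the value `0` is a filler that is never used.
  let q' : ℕ → M.sigDivSub p := fun k => if hk : 1 ≤ k then ⟨q k, hmemq k hk⟩ else 0
  have hq' : ∀ k (hk : 1 ≤ k), q' k = ⟨q k, hmemq k hk⟩ := fun k hk => dif_pos hk
  let u' : ℕ → M.V p := fun k => ⟨u k, hrun.mem k⟩
  let a := fluxForm M hA ha hΩ p
  let b := divForm M p
  let l := sourceForm M hf hΩ p
  have hsymm : ∀ r r', a r r' = a r' r := fun r r' => invForm_comm M hA hΩ _ _
  have hnn : ∀ r, 0 ≤ a r r := fun r => invForm_nonneg M hA ha hΩ r.1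
  have hflux : ∀ k, 1 ≤ k → ∀ r, a (q' k) r - b r (u' k) = -bdryFunctional M hg p r := by
    intro k hk r
    rw [hq' k hk]
    obtain ⟨n, rfl⟩ : ∃ n, k = n + 1 := ⟨k - 1, by omega⟩
    exact (hrun.step n).flux_eq r.1 r.2
  have hfluxs : ∀ r, a qs r - b r us = -bdryFunctional M hg p r := fun r => by
    have := hVI.flux_eq r.1 r.2
    rw [M.l2_comm] at this
    exact this
  -- Exactness of the quadrature turns the latent terms into nodal sums, on which the pointwise
  -- entropy inequalities act.
  have hbal : ∀ k (v : M.V p), α (k + 1) * (b (q' (k + 1)) v - l v) =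
      qInner M Q (ψ k - ψ (k + 1)) v.1 := by
    intro k v
    rw [hq' (k + 1) (by omega)]
    have h1 : α (k + 1) * M.l2 (M.dvg (q (k + 1))) v.1 + M.l2 (ψ (k + 1)) v.1 =
      α (k + 1) * M.l2 (M.glob f) v.1 + M.l2 (ψ k) v.1 := (hrun.step k).balance v.1 v.2
    rw [l2_eq_qInner M Q (hrun.latent_mem _) v.2, l2_eq_qInner M Q (hrun.latent_mem _) v.2] at h1
    have h2 : qInner M Q (ψ k - ψ (k + 1)) v.1 =
        qInner M Q (ψ k) v.1 - qInner M Q (ψ (k + 1)) v.1 := by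
      simp only [qInner, ← Finset.sum_sub_distrib]
      refine Finset.sum_congr rfl fun T _ => Finset.sum_congr rfl fun i _ => ?_
      simp only [Pi.sub_apply]; ring
    rw [h2]
    change α (k + 1) * (M.l2 (M.dvg (q (k + 1))) v.1 - M.l2 (M.glob f) v.1) = _
    linarith
  -- The iterates are feasible because their nodal values are values of `Υ`, so they are admissible
  -- in the variational inequality for `us`.
  have hG : ∀ k, 0 ≤ b qs (u' k - us) - l (u' k - us) := fun k => by
    have h1 := hVI.ineq (u k) (mem_feasible_of_nodal hE (hrun.mem k) (hrun.nodal hQ k))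
    rw [l2_dvg_sub_glob hΩ hf qs.2.1 (sub_mem (hrun.mem k) us.2)] at h1
    exact h1
  let E : ℕ → ℝ := fun k =>
    a (q' k - qs) (q' k - qs) / 2 + (b qs (u' k - us) - l (u' k - us))
  have hanti : ∀ k, 1 ≤ k → E (k + 1) ≤ E k := by
    intro k hk
    refine mixed_energy_antitone hsymm hnn (hflux k hk) (hflux (k + 1) (by omega)) ?_
    have h1 : 0 ≤ α (k + 1) * (b (q' (k + 1)) (u' k - u' (k + 1)) - l (u' k - u' (k + 1))) := by
      rw [hbal]
      exact qInner_latent_nonneg hE (hrun.nodal hQ k) (hrun.nodal hQ (k + 1))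
    exact nonneg_of_mul_nonneg_right h1 (hα (k + 1) (by omega))
  have hdesc : ∀ k, α (k + 1) * E (k + 1) ≤
      bregman M Q R us.1 (u k) - bregman M Q R us.1 (u (k + 1)) := by
    intro k
    refine le_trans ?_ (qInner_le_bregman_sub hE (hrun.nodal hQ k) (hrun.nodal hQ (k + 1)) us.1)
    have h1 : qInner M Q (ψ k - ψ (k + 1)) (u (k + 1) - us.1) = _ :=
      (hbal k (u' (k + 1) - us)).symm
    rw [h1]
    refine mul_le_mul_of_nonneg_left ?_ (hα (k + 1) (by omega)).le
    -- The balance equation produces the full squared flux error; the energy contains only half of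
    -- it, and the rest is dropped.
    have h2 := mixed_energy (hflux (k + 1) (by omega)) hfluxs (q' (k + 1) - qs)
    have h3 := hnn (q' (k + 1) - qs)
    have h4 : b (q' (k + 1)) (u' (k + 1) - us) = b (q' (k + 1) - qs) (u' (k + 1) - us) +
        b qs (u' (k + 1) - us) := by
      rw [map_sub b, LinearMap.sub_apply]; ring
    change a (q' (k + 1) - qs) (q' (k + 1) - qs) / 2 + _ ≤ _
    linarith
  have hsum := mul_sum_le_of_descent hα hanti hdesc ℓ
  have hpos : 0 < ∑ k ∈ Finset.Icc 1 ℓ, α k :=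
    Finset.sum_pos (fun k hk => hα k (Finset.mem_Icc.1 hk).1) ⟨1, Finset.mem_Icc.2 ⟨le_rfl, hℓ⟩⟩
  have hD := bregman_nonneg hE (hrun.nodal hQ ℓ) hVI.mem
  have h1 : E ℓ ≤ bregman M Q R us.1 (u 0) / ∑ k ∈ Finset.Icc 1 ℓ, α k := by
    rw [le_div_iff₀ hpos]
    linarith
  have h2 : E ℓ = M.fluxNormSq A (q ℓ - qs.1) / 2 + (b qs (u' ℓ - us) - l (u' ℓ - us)) := by
    simp only [E, hq' ℓ hℓ]
    rfl
  have h3 := hG ℓ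
  linarith

theorem IsMixedRun.dgNormSq_error_le (hrun : IsMixedRun M Q A f g Υ α q u ψ) {C : ℝ}
    (hst : ∀ w ∈ M.V p, ∀ N : ℝ, 0 ≤ N →
      (∀ r ∈ M.SigDiv p, M.l2 (M.dvg r) w ^ 2 ≤ N * M.fieldSq r) →
      M.gradSq w ≤ C * N ∧ M.jumpSq w ≤ C * N)
    (hA : IsDiffusion Ω a₀ a₁ A) (ha : 0 < a₀) (hΩ : interior (closure Ω) = Ω)
    (hg : ∀ s, M.IsBdry s → MemLp g 2 (M.surf s)) {qs : M.VectorFn} {us : M.ScalarFn}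
    (hVI : IsVISolution M Q A f g lo hi qs us) (n : ℕ) :
    M.dgNormSq A (u (n + 1) - us) ≤
      (|a₁| + 1) * C * a₀⁻¹ * M.fluxNormSq A (q (n + 1) - qs) := by
  let q' : M.sigDivSub p := ⟨q (n + 1), (hrun.step n).flux_mem⟩
  let qs' : M.sigDivSub p := ⟨qs, hVI.flux_mem⟩
  let u' : M.V p := ⟨u (n + 1), hrun.mem _⟩
  let us' : M.V p := ⟨us, hVI.mem.1⟩
  have h1 : ∀ r : M.sigDivSub p, fluxForm M hA ha hΩ p q' r - divForm M p r u' =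
      -bdryFunctional M hg p r := fun r => (hrun.step n).flux_eq r.1 r.2
  have h2 : ∀ r : M.sigDivSub p, fluxForm M hA ha hΩ p qs' r - divForm M p r us' =
      -bdryFunctional M hg p r := fun r => by
    have := hVI.flux_eq r.1 r.2
    rw [M.l2_comm] at this
    exact this
  exact dgNormSq_le_fluxNormSq hst hA ha hΩ (e := q' - qs') (w := u' - us') (mixed_energy h1 h2)

theorem IsMixedRun.convergesTo (hrun : IsMixedRun M Q A f g Υ α q u ψ) {C : ℝ} (hC : 0 < C)
    (hst : ∀ w ∈ M.V p, ∀ N : ℝ, 0 ≤ N →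
      (∀ r ∈ M.SigDiv p, M.l2 (M.dvg r) w ^ 2 ≤ N * M.fieldSq r) →
      M.gradSq w ≤ C * N ∧ M.jumpSq w ≤ C * N) (hQ : IsQuadSpace M Q)
    (hA : IsDiffusion Ω a₀ a₁ A) (ha : 0 < a₀) (hΩ : interior (closure Ω) = Ω)
    (hf : MemLp f 2 (volume.restrict Ω)) (hg : ∀ s, M.IsBdry s → MemLp g 2 (M.surf s))
    (hE : ∀ T i, IsEntropyPair (lo (qnode M Q T i))
      (hi (qnode M Q T i)) (Υ (qnode M Q T i)) (R (qnode M Q T i)))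
    (hα : ∀ k, 1 ≤ k → 0 < α k) {qs : M.VectorFn} {us : M.ScalarFn}
    (hVI : IsVISolution M Q A f g lo hi qs us) :
    ConvergesTo M Q A (((|a₁| + 1) * C * a₀⁻¹ + 1) * 2) R α q u qs us := by
  have hflux : ∀ ℓ, 1 ≤ ℓ → M.fluxNormSq A (q ℓ - qs) ≤
      2 * (bregman M Q R us (u 0) / ∑ k ∈ Finset.Icc 1 ℓ, α k) := fun ℓ hℓ =>
    hrun.fluxNormSq_le hQ hA ha hΩ hf hg hE hα (qs := ⟨qs, hVI.flux_mem⟩)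
      (us := ⟨us, hVI.mem.1⟩) hVI hℓ
  have hdg : ∀ ℓ, 1 ≤ ℓ → M.dgNormSq A (u ℓ - us) ≤
      (|a₁| + 1) * C * a₀⁻¹ * M.fluxNormSq A (q ℓ - qs) := fun ℓ hℓ => by
    obtain ⟨n, rfl⟩ : ∃ n, ℓ = n + 1 := ⟨ℓ - 1, by omega⟩
    exact hrun.dgNormSq_error_le hst hA ha hΩ hg hVI n
  have hdg0 : ∀ ℓ, 0 ≤ M.dgNormSq A (u ℓ - us) := fun ℓ =>
    (dgNormSq_le hA ha hΩ (sub_mem (hrun.mem ℓ) hVI.mem.1)).1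
  have hfl0 : ∀ ℓ, 0 ≤ M.fluxNormSq A (q ℓ - qs) := fun ℓ => invForm_nonneg M hA ha hΩ _
  have hc : 0 < (|a₁| + 1) * C * a₀⁻¹ := by positivity
  refine ⟨fun ℓ hℓ => ?_, fun hlim => ?_⟩
  · have h1 := hdg ℓ hℓ
    have h2 := mul_le_mul_of_nonneg_left (hflux ℓ hℓ)
      (by positivity : 0 ≤ (|a₁| + 1) * C * a₀⁻¹ + 1)
    rw [errSq]
    linarith
  · have hlim0 : Tendsto (fun ℓ => 2 * (bregman M Q R us (u 0) / ∑ k ∈ Finset.Icc 1 ℓ, α k))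
        atTop (𝓝 0) := by
      simpa using (hlim.const_div_atTop (bregman M Q R us (u 0))).const_mul 2
    have hfl : Tendsto (fun ℓ => M.fluxNormSq A (q ℓ - qs)) atTop (𝓝 0) :=
      squeeze_zero' (Eventually.of_forall hfl0)
        ((eventually_ge_atTop 1).mono fun ℓ hℓ => hflux ℓ hℓ) hlim0
    refine ⟨squeeze_zero' (Eventually.of_forall hdg0)
        ((eventually_ge_atTop 1).mono fun ℓ hℓ => hdg ℓ hℓ) ?_, hfl⟩
    simpa using hfl.const_mul ((|a₁| + 1) * C * a₀⁻¹)

/-! ### The hybridized method -/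

/-- Integration by parts on each element. The hypothesis on `μ` supplies the integrability needed to
split the facet term. -/
theorem Mesh.hybForm_eq {r : M.VectorFn} {v : M.ScalarFn} {μ : M.SideFn}
    (hr : ∀ T, ContDiff ℝ 1 (r T)) (hv : ∀ T, ContDiff ℝ 1 (v T))
    (hμ : ∀ s, ∃ φ, Continuous φ ∧ ∀ x ∈ M.facet s, μ s x = φ x) :
    M.hybForm r v μ = -M.l2 (M.dvg r) v +
      ∑ s : M.Side, ∫ x, μ s x * inner ℝ (r s.1 x) (M.normal s) ∂(M.surf s) := by
  rw [M.l2_dvg hr hv, Mesh.hybForm]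
  have h1 : ∀ s : M.Side, ∫ x, (v s.1 x - μ s x) * inner ℝ (r s.1 x) (M.normal s) ∂(M.surf s) =
      (∫ x, v s.1 x * inner ℝ (r s.1 x) (M.normal s) ∂(M.surf s)) -
        ∫ x, μ s x * inner ℝ (r s.1 x) (M.normal s) ∂(M.surf s) := by
    intro s
    obtain ⟨φ, hφ, hμφ⟩ := hμ s
    have hrc := (hr s.1).continuous
    have hvc := (hv s.1).continuous
    rw [M.integral_surf_congr s (f := fun x => μ s x * inner ℝ (r s.1 x) (M.normal s))
        (g := fun x => φ x * inner ℝ (r s.1 x) (M.normal s)) fun x hx => by rw [hμφ x hx],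
      M.integral_surf_congr s (f := fun x => (v s.1 x - μ s x) * inner ℝ (r s.1 x) (M.normal s))
        (g := fun x => v s.1 x * inner ℝ (r s.1 x) (M.normal s) -
          φ x * inner ℝ (r s.1 x) (M.normal s)) fun x hx => by rw [hμφ x hx, sub_mul],
      integral_sub (M.integrable_surf s (by fun_prop)) (M.integrable_surf s (by fun_prop))]
  simp only [h1, Finset.sum_sub_distrib]
  ring

theorem Mesh.exists_continuous_of_mem_facetSpace {μ : M.SideFn} (h : μ ∈ M.FacetSpace p g)
    (s : M.Side) : ∃ φ, Continuous φ ∧ ∀ x ∈ M.facet s, μ s x = φ x := by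
  obtain ⟨φ, hφ, he⟩ := h.1 s
  exact ⟨φ, (Mesh.contDiff_of_mem_localPoly hφ (n := 0)).continuous, he⟩

theorem Mesh.zero_mem_facetSpace : (0 : M.SideFn) ∈ M.FacetSpace p 0 :=
  ⟨fun _ => ⟨0, zero_mem _, fun _ _ => rfl⟩, fun _ _ _ _ _ => rfl, fun _ _ _ _ => rfl⟩

theorem Mesh.contDiff_zero (T : M.Elem) : ContDiff ℝ 1 ((0 : M.ScalarFn) T) :=
  contDiff_const (c := (0 : ℝ))

open scoped Classical in
variable (M) in
/-- The jump of the normal component of a field. -/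
def Mesh.normalJump (r : M.VectorFn) : M.SideFn := fun s x =>
  if h : ∃ t, M.Adj s t then
    inner ℝ (r s.1 x) (M.normal s) + inner ℝ (r h.choose.1 x) (M.normal h.choose) else 0

theorem Mesh.Adj.normalJump_eq {s t : M.Side} (h : M.Adj s t) (r : M.VectorFn) (x : Vec (m + 1)) :
    M.normalJump r s x = inner ℝ (r s.1 x) (M.normal s) + inner ℝ (r t.1 x) (M.normal t) := by
  have h' : ∃ t, M.Adj s t := ⟨t, h⟩
  rw [Mesh.normalJump, dif_pos h', h'.choose_spec.unique h]

theorem Mesh.IsBdry.normalJump_eq {s : M.Side} (h : M.IsBdry s) (r : M.VectorFn)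
    (x : Vec (m + 1)) : M.normalJump r s x = 0 :=
  dif_neg (not_exists.2 h)

/-- Normal traces of Raviart–Thomas fields are in `𝒫_p` on each facet, those of the neighbour by
`Mesh.Adj.exists_trace`; being symmetric, the jump is single-valued. So the hybridized method may be
tested with it. -/
theorem Mesh.normalJump_mem {r : M.VectorFn} (hr : r ∈ M.Sig p) :
    M.normalJump r ∈ M.FacetSpace p 0 := by
  refine ⟨fun s => ?_, fun s t hst x _ => ?_, fun s hs φ _ => ?_⟩
  · by_cases hs : M.IsBdry s
    · exact ⟨0, zero_mem _, fun x _ => hs.normalJump_eq r x⟩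
    · simp only [Mesh.IsBdry, not_forall, not_not] at hs
      obtain ⟨t, ht⟩ := hs
      obtain ⟨φ, hφ, he⟩ := M.exists_normal_trace hr s
      obtain ⟨φ', hφ', he'⟩ := M.exists_normal_trace hr t
      obtain ⟨χ, hχ, heχ⟩ := ht.exists_trace hφ'
      refine ⟨φ + χ, add_mem hφ hχ, fun x hx => ?_⟩
      rw [ht.normalJump_eq, he x hx, he' x (ht.2 ▸ hx), Pi.add_apply, heχ x hx]
  · rw [hst.normalJump_eq, hst.symm.normalJump_eq]
    exact add_comm (inner ℝ (r s.1 x) (M.normal s)) _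
  · simp only [hs.normalJump_eq, Pi.zero_apply]

theorem Mesh.sum_normalJump {r : M.VectorFn} (hr : ∀ T, Continuous (r T)) :
    ∑ s : M.Side, ∫ x, M.normalJump r s x * inner ℝ (r s.1 x) (M.normal s) ∂(M.surf s) =
      (1 / 2) * ∑ s : M.Side, ∑ t : M.Side, open scoped Classical in if M.Adj s t then
        ∫ x, (inner ℝ (r s.1 x) (M.normal s) + inner ℝ (r t.1 x) (M.normal t)) ^ 2
          ∂(M.surf s) else 0 := by
  classical
  rw [M.sum_sides, M.sum_adj_symm, Finset.sum_eq_zero (s := Finset.univ (α := M.Side))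
    (f := fun s => if M.IsBdry s then _ else _), add_zero]
  · congr 1
    refine Finset.sum_congr rfl fun s _ => Finset.sum_congr rfl fun t _ => ?_
    split_ifs with hst
    · have h1 := hr s.1
      have h2 := hr t.1
      simp only [hst.normalJump_eq, hst.symm.normalJump_eq]
      rw [hst.surf_eq, ← integral_add (M.integrable_surf s (by fun_prop))
        (M.integrable_surf s (by fun_prop))]
      refine integral_congr_ae (Eventually.of_forall fun x => ?_)
      ring
    · rfl
  · intro s _
    split_ifs with hs
    · simp [hs.normalJump_eq]
    · rfl

/-- On interior facets the two sides cancel, as `μ` is single-valued and the normal components are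
opposite. On boundary facets the normal component is in `𝒫_p`, so the projection of `g` may be
replaced by `g`. -/
theorem Mesh.sum_facetSpace {r : M.VectorFn} (hr : r ∈ M.SigDiv p) {μ : M.SideFn}
    (hμ : μ ∈ M.FacetSpace p g) :
    ∑ s : M.Side, ∫ x, μ s x * inner ℝ (r s.1 x) (M.normal s) ∂(M.surf s) = M.bdryForm g r := by
  classical
  rw [M.sum_sides, M.sum_adj_symm, Finset.sum_eq_zero (s := Finset.univ (α := M.Side))
    (f := fun s => ∑ t, if M.Adj s t then _ else _), mul_zero, zero_add, Mesh.bdryForm]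
  · refine Finset.sum_congr rfl fun s _ => ?_
    split_ifs with hs
    · obtain ⟨φ, hφ, he⟩ := M.exists_normal_trace hr.1 s
      rw [M.integral_surf_congr s (g := fun x => μ s x * φ x) fun x hx => by rw [he x hx],
        hμ.2.2 s hs φ hφ]
      exact M.integral_surf_congr s fun x hx => by rw [he x hx]
    · rfl
  · intro s _
    refine Finset.sum_eq_zero fun t _ => ?_
    split_ifs with hst
    · rw [hst.surf_eq, M.integral_surf_congr s
        (f := fun x => μ t x * inner ℝ (r t.1 x) (M.normal t))
        (g := fun x => -(μ s x * inner ℝ (r s.1 x) (M.normal s))), integral_neg, add_neg_cancel]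
      intro x hx
      have h1 := hr.2 s t hst x hx
      rw [inner_sub_left] at h1
      rw [hμ.2.1 s t hst x hx, hst.normal_eq, inner_neg_right, sub_eq_zero.1 h1]
      ring
    · rfl

/-- The facet unknown is a Lagrange multiplier for the continuity of the normal component. Once `q`
is known to be in `Σ_{h,div}^p`, zero facet tests and conforming flux tests turn the remaining
equations into the mixed ones. -/
theorem IsHybridStep.isMixedStep {α : ℝ} (hα : 0 < α) {ψ₀ u ψ : M.ScalarFn} {q : M.VectorFn}
    {μ : M.SideFn} (h : IsHybridStep M Q A f g Υ α ψ₀ q u μ ψ) :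
    IsMixedStep M Q A f g Υ α ψ₀ q u ψ := by
  classical
  have hq1 : ∀ T, ContDiff ℝ 1 (q T) := fun T => Mesh.contDiff_of_mem_Sig h.flux_mem T
  have hqc : ∀ T, Continuous (q T) := fun T => (hq1 T).continuous
  have hl0 : ∀ w : M.ScalarFn, M.l2 w 0 = 0 := fun w => by simp [Mesh.l2]
  -- The test function is zero on the elements and the normal jump of `q` on the facets. The form is
  -- then the sum of the squared normal jumps.
  have hjump : M.hybForm q 0 (M.normalJump q) = 0 := by
    have h1 := h.balance 0 (zero_mem _) _ (M.normalJump_mem h.flux_mem)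
    rw [hl0, hl0, hl0, mul_zero, add_zero, add_zero] at h1
    exact (mul_eq_zero.1 h1).resolve_left (neg_ne_zero.2 hα.ne')
  rw [M.hybForm_eq hq1 M.contDiff_zero
    (M.exists_continuous_of_mem_facetSpace (M.normalJump_mem h.flux_mem)), hl0, neg_zero, zero_add,
    M.sum_normalJump hqc] at hjump
  have hnn : ∀ s t : M.Side, 0 ≤ if M.Adj s t then
      ∫ x, (inner ℝ (q s.1 x) (M.normal s) + inner ℝ (q t.1 x) (M.normal t)) ^ 2
        ∂(M.surf s) else 0 := by
    intro s t
    split_ifs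
    · exact integral_nonneg fun x => sq_nonneg _
    · exact le_rfl
  have h0 := (mul_eq_zero.1 hjump).resolve_left (by norm_num)
  have hdiv : q ∈ M.SigDiv p := by
    refine ⟨h.flux_mem, fun s t hst x hx => ?_⟩
    have h2 := (Finset.sum_eq_zero_iff_of_nonneg fun s _ =>
      Finset.sum_nonneg fun t (_ : t ∈ Finset.univ) => hnn s t).1 h0 s (Finset.mem_univ s)
    have h3 := (Finset.sum_eq_zero_iff_of_nonneg fun t _ => hnn s t).1 h2 t (Finset.mem_univ t)
    rw [if_pos hst] at h3
    have h4 := hqc s.1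
    have h5 := hqc t.1
    have h6 := M.eq_zero_on_facet s (by fun_prop) h3 x hx
    rw [hst.normal_eq, inner_neg_right] at h6
    rw [inner_sub_left]
    linarith
  refine ⟨hdiv, h.mem, h.latent_mem, fun v hv => ?_, fun r hr => ?_, h.latent_eq⟩
  · have h1 := h.balance v hv 0 M.zero_mem_facetSpace
    rw [M.hybForm_eq hq1 (fun T => Mesh.contDiff_of_mem_V hv T)
      (M.exists_continuous_of_mem_facetSpace (M.zero_mem_facetSpace (p := p)))] at h1
    simp only [Pi.zero_apply, zero_mul, integral_zero, Finset.sum_const_zero, add_zero] at h1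
    linarith
  · have h1 := h.flux_eq r hr.1
    rw [M.hybForm_eq (fun T => Mesh.contDiff_of_mem_Sig hr.1 T)
      (fun T => Mesh.contDiff_of_mem_V h.mem T)
      (M.exists_continuous_of_mem_facetSpace h.facet_mem), M.sum_facetSpace hr h.facet_mem] at h1
    linarith

theorem IsHybridRun.isMixedRun (hα : ∀ k, 1 ≤ k → 0 < α k) {μ : ℕ → M.SideFn}
    (h : IsHybridRun M Q A f g Υ α q u μ ψ) : IsMixedRun M Q A f g Υ α q u ψ :=
  ⟨h.init, fun k => (h.step k).isMixedStep (hα (k + 1) (by omega))⟩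

end Convergence

end FOSPG

end

theorem mainTheorem1 (K : ElemKind) (d : ℕ) (hd : d = 2 ∨ d = 3) (p : ℕ)
    (σ a₀ a₁ : ℝ) (ha₀ : 0 < a₀) :
    ∃ C : ℝ, 0 < C ∧
      ∀ (Ω : Set (Vec d)), interior (closure Ω) = Ω →
      ∀ (M : Mesh K d Ω), M.ShapeRegular σ →
      ∀ (Q : QuadRule K d p), IsQuadSpace M Q →
      ∀ (A : Vec d → Matrix (Fin d) (Fin d) ℝ), IsDiffusion Ω a₀ a₁ A →
      ∀ (f : Vec d → ℝ), MemLp f 2 (volume.restrict Ω) →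
      ∀ (g : Vec d → ℝ), (∀ s, M.IsBdry s → MemLp g 2 (M.surf s)) →
      ∀ (lo hi : Vec d → EReal) (Υ R : Vec d → ℝ → ℝ),
        (∀ T i, IsEntropyPair (lo (qnode M Q T i)) (hi (qnode M Q T i))
          (Υ (qnode M Q T i)) (R (qnode M Q T i))) →
      ∃ (qs : M.VectorFn) (us : M.ScalarFn),
        IsVISolution M Q A f g lo hi qs us ∧
        (∀ q' u', IsVISolution M Q A f g lo hi q' u' → q' = qs ∧ u' = us) ∧
        ∀ (α : ℕ → ℝ), (∀ k, 1 ≤ k → 0 < α k) →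
          (∀ q u ψ, IsMixedRun M Q A f g Υ α q u ψ → ConvergesTo M Q A C R α q u qs us) ∧
          (∀ q u μ ψ, IsHybridRun M Q A f g Υ α q u μ ψ →
            ConvergesTo M Q A C R α q u qs us) := by
  obtain ⟨m, hm, rfl⟩ : ∃ m, 1 ≤ m ∧ d = m + 1 := by
    rcases hd with rfl | rfl
    exacts [⟨1, le_rfl, rfl⟩, ⟨2, one_le_two, rfl⟩]
  obtain ⟨C, hC, hst⟩ := exists_stability K m p hm σ
  -- The bracket bounds the total squared error by the squared flux error; the factor `2` undoes the
  -- one half in the energy.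
  refine ⟨((|a₁| + 1) * C * a₀⁻¹ + 1) * 2, by positivity, ?_⟩
  intro Ω hΩ M hM Q hQ A hA f hf g hg lo hi Υ R hE
  obtain ⟨qs, us, hVI, huniq⟩ := exists_unique_VI hm hM hQ hA ha₀ hΩ hf hg hE
  have hconv : ∀ α : ℕ → ℝ, (∀ k, 1 ≤ k → 0 < α k) → ∀ q u ψ,
      IsMixedRun M Q A f g Υ α q u ψ →
      ConvergesTo M Q A (((|a₁| + 1) * C * a₀⁻¹ + 1) * 2) R α q u qs us := fun α hα q u ψ hrun =>
    hrun.convergesTo hC (hst Ω M hM) hQ hA ha₀ hΩ hf hg hE hα hVI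
  exact ⟨qs, us, hVI, huniq, fun α hα => ⟨hconv α hα, fun q u μ ψ hrun =>
    hconv α hα q u ψ (hrun.isMixedRun hα)⟩⟩
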